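/- **Setting.** Write $z\cdot w=\sum_\alpha z^\alpha w^\alpha$ and $z^2=z\cdot z$ on $\mathbb C^D$, $D\ge 1$. A *globally conformal invariant (GCI) quantum field theory in the analytic picture* consists of a complex Hilbert space $\mathcal H$ with a dense domain $\mathcal D$, a finite set of nonzero fields $\phi_A$, $A\in I$, with parities $p_A\in\{0,1\}$ (bosonic or fermionic) and dimensions $d_A>0$, a vacuum $|0\rangle\in\mathcal D$ of norm $1$, and operators $T_\alpha,C_\alpha,H,\Omega_{\alpha\beta}$ on $\mathcal D$ satisfying the commutation relations of the conformal Lie algebra (with $[T_\alpha,C_\beta]=2(\delta_{\alpha\beta}H-\Omega_{\alpha\beta})$), with $T_\alpha^*=-C_\alpha$, $H^*=H$, $\Omega_{\alpha\beta}^*=-\Omega_{\alpha\beta}$ on $\mathcal D$. The fields are formal series $$\phi_A(z)=\sum_{n\in\mathbb Z}\sum_{m\ge 0}\phi_{A\{n,m\}}(z)\,(z^2)^n,$$ where $\phi_{A\{n,m\}}(z)$ is a homogeneous harmonic polynomial of degree $m$ in $z$ with values in the operators on $\mathcal D$, and for every $\Psi\in\mathcal D$ one has $\phi_{A\{n,m\}}(z)\Psi=0$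 for all $m$ if $n$ is sufficiently negative. It is assumed that: * *(covariance)* the fields transform under an elementary induced representation: $[T_\alpha,\phi(z)]=\partial_\alpha\phi(z)$, $[H,\phi_A(z)]=(z\cdot\partial+d_A)\phi_A(z)$, $[\Omega_{\alpha\beta},\phi(z)]=(z^\alpha\partial_\beta-z^\beta\partial_\alpha)\phi(z)+(\Omega_{\alpha\beta}\phi)(z)$, $[C_\alpha,\phi_A(z)]=(z^2\partial_\alpha-2z^\alpha z\cdot\partial-2z^\alpha d_A)\phi_A(z)+2\sum_\beta z^\beta(\Omega_{\beta\alpha}\phi)_A(z)$, where the action $\Omega_{\alpha\beta}$ on the fibre spanned by the $\phi_A$ is the derivative of a representation $\pi$ of $\mathrm{Spin}(D)$ that preserves dimensions, and $\pi(-1)\phi_A=e^{2\pi i d_A}\phi_A$; * *(conjugation)* there is an antilinear involution $\phi_A\mapsto\phi_A^*$ of the fibre, preserving dimensions and parities and intertwining $\pi(s)$ with $\pi(e_Dse_D)$, $s\in\mathrm{Spin}(D)$, such that, for the compact picture fields below with $\zeta$ real, the hermitian conjugate of $\phi_A(\zeta,u)$ is $(\pi(u\,e_D)\phi_A^*)(\zeta,u)$,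 where $u\,e_D\in\mathrm{Spin}(D)$ is the Clifford product with the last basis vector $e_D$; * *(spectrum and vacuum)* $H\ge 0$, and the vacuum is, up to a factor, the only vector of $\mathcal D$ annihilated by all $T_\alpha,C_\alpha,H,\Omega_{\alpha\beta}$; * *(strong locality)* for all $A,B$ there is $M\ge 1$ with $\big((z-w)^2\big)^M\big(\phi_A(z)\phi_B(w)-(-1)^{p_Ap_B}\phi_B(w)\phi_A(z)\big)=0$ as formal series; * *(completeness)* $\mathcal D$ is spanned by products of the operators $\phi_{A\{n,m\}}(z)$ applied to $|0\rangle$. Assume moreover that $H$ has finite dimensional eigenspaces. **Thermal correlation functions.** For $\zeta\in\mathbb C$ and $u$ in the unit sphere $\mathbb S^{D-1}\subset\mathbb R^D$ put $\phi_A(\zeta,u)=e^{2\pi i d_A\zeta}\phi_A(e^{2\pi i\zeta}u)=\sum_{n,m}\phi_{A\{n,m\}}(u)\,e^{2\pi i(d_A+2n+m)\zeta}$. For an operator $X$ on $\mathcal D$ let $\langle X\rangle_q=\mathrm{tr}(Xq^H)/\mathrm{tr}(q^H)$, a formal power series in $q^{1/2}=e^{\pi i\tau}$, where the coefficient of $q^{j/2}$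 in $\mathrm{tr}(Xq^H)$ is the trace of $X$ over the eigenspace of $H$ with eigenvalue $j/2$. The thermal correlation function $\langle\phi_{A_1}(\zeta_1,u_1)\cdots\phi_{A_n}(\zeta_n,u_n)\rangle_q$ is the series $$\sum_{(n_k,m_k)_{k=1}^n}\big\langle\phi_{A_1\{n_1,m_1\}}(u_1)\cdots\phi_{A_n\{n_n,m_n\}}(u_n)\big\rangle_q\;e^{2\pi i\sum_k(d_{A_k}+2n_k+m_k)\zeta_k},$$ each mean value being expanded in powers of $q^{1/2}$. Write $\zeta_{jk}=\zeta_j-\zeta_k$ and $\mathfrak H=\{\mathrm{Im}\,\tau>0\}$. **Hypothesis.** Fix $n\ge 0$. For all $A_1,\dots,A_n\in I$ and $u_1,\dots,u_n\in\mathbb S^{D-1}$ this series (over all $(n_k,m_k)_k$ and all powers of $q^{1/2}$) converges absolutely for all $(\zeta,\tau)\in\mathbb C^n\times\mathfrak H$ with $0<-\mathrm{Im}\,\zeta_{jk}<\mathrm{Im}\,\tau$ $(1\le j<k\le n)$, and there its sum is equal to a function $f_{A_1\dots A_n}(\zeta_1,u_1;\dots;\zeta_n,u_n;\tau)$ that is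 meromorphic in $(\zeta,\tau)$ on $\mathbb C^n\times\mathfrak H$. **Conclusion.** The functions $f_{A_1\dots A_n}$ are elliptic, of the type of the basic functions $E^{(N)}_c=F^{(N)}_c/\Omega_n^N$. That is, as identities of meromorphic functions on $\mathbb C^n\times\mathfrak H$: 1. for $m=1,\dots,n$, both replacing $\zeta_m$ by $\zeta_m+1$ and replacing $\zeta_m$ by $\zeta_m+\tau$ multiplies $f_{A_1\dots A_n}$ by $(-1)^{p_{A_m}}$; 2. for every permutation $\sigma$, $f_{A_{\sigma(1)}\dots A_{\sigma(n)}}(\zeta_{\sigma(1)},u_{\sigma(1)};\dots;\zeta_{\sigma(n)},u_{\sigma(n)};\tau)=(-1)^{\varepsilon(\sigma)}f_{A_1\dots A_n}(\zeta_1,u_1;\dots;\zeta_n,u_n;\tau)$, where $\varepsilon(\sigma)=\sum p_{A_{\sigma(i)}}p_{A_{\sigma(j)}}$ over the pairs $i<j$ with $\sigma(i)>\sigma(j)$; 3. there is $N\in\mathbb N$ (depending on the theory and on $n$ only) such that for all $A_k$, $u_k$ $$f_{A_1\dots A_n}=\frac{F(\zeta_{12},\dots,\zeta_{n-1\,n};\tau)}{\Omega_n^N},\qquad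 \Omega_n=\prod_{1\le j<k\le n}e^{-\pi i\tau/2}\,\vartheta_{11}(\zeta_{jk}+\alpha_{jk},\tau)\,\vartheta_{11}(\zeta_{jk}-\alpha_{jk},\tau),\quad u_j\cdot u_k=\cos 2\pi\alpha_{jk},$$ with $\vartheta_{11}(\zeta,\tau)=-2\sum_{r\ge 0}(-1)^re^{i\pi\tau(r+1/2)^2}\sin(2r+1)\pi\zeta$, where $F$ is holomorphic on $\mathbb C^{n-1}\times\mathfrak H$, is there the sum of a Taylor series in $q^{1/2}$ whose coefficients are Laurent polynomials in $e^{\pi i\zeta_{12}},\dots,e^{\pi i\zeta_{n-1\,n}}$, and satisfies for all $\lambda\in\mathbb Z^{n-1}$, with $\varepsilon_k=\sum_{l>k}p_{A_l}$ and with $A^{(n)}$ the symmetric matrix of the quadratic form $\sum_{1\le l\le m\le n-1}(\lambda_l+\dots+\lambda_m)^2$, $$F(\zeta_{12}+\lambda_1,\dots,\zeta_{n-1\,n}+\lambda_{n-1};\tau)=(-1)^{\sum_k\lambda_k\varepsilon_k}F(\zeta_{12},\dots,\zeta_{n-1\,n};\tau),$$ $$F(\zeta_{12}+\lambda_1\tau,\dots,\zeta_{n-1\,n}+\lambda_{n-1}\tau;\tau)=(-1)^{\sum_k\lambda_k\varepsilon_k}\exp\Big\{-2\pi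 iN\Big(\sum_{j,k}\lambda_jA^{(n)}_{jk}\lambda_k\Big)\tau-4\pi iN\sum_{j,k}\lambda_jA^{(n)}_{jk}\zeta_{k\,k+1}\Big\}F(\zeta_{12},\dots,\zeta_{n-1\,n};\tau).$$ -/

import Mathlib

open scoped BigOperators

noncomputable section

namespace GCI

/-! ### Complex Euclidean space, the unit sphere, harmonic polynomials -/

/-- The bilinear form `z · w = ∑ z^α w^α` on `ℂ^D` (no complex conjugation). -/
def dot {D : ℕ} (z w : Fin D → ℂ) : ℂ := ∑ α, z α * w α

/-- The complex Euclidean interval `z² = z · z`. -/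
def sq {D : ℕ} (z : Fin D → ℂ) : ℂ := dot z z

/-- The real unit sphere `S^{D-1} ⊂ ℝ^D`. -/
abbrev USphere (D : ℕ) : Type := Metric.sphere (0 : EuclideanSpace ℝ (Fin D)) 1

/-- A point of the real sphere, viewed as a vector of `ℂ^D`. -/
def toC {D : ℕ} (u : USphere D) : Fin D → ℂ := fun α => ((u : EuclideanSpace ℝ (Fin D)) α : ℂ)

/-- The Laplace operator on complex polynomials in `D` variables. -/
def laplacian (D : ℕ) : MvPolynomial (Fin D) ℂ →ₗ[ℂ] MvPolynomial (Fin D) ℂ :=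
  ∑ α : Fin D, ((MvPolynomial.pderiv α).toLinearMap ∘ₗ (MvPolynomial.pderiv α).toLinearMap)

/-- Homogeneous harmonic polynomials of degree `m` on `ℂ^D`. -/
def harmonic (D m : ℕ) : Submodule ℂ (MvPolynomial (Fin D) ℂ) :=
  MvPolynomial.homogeneousSubmodule (Fin D) ℂ m ⊓ LinearMap.ker (laplacian D)

/-- Operator valued homogeneous harmonic polynomials of degree `m`: finite sums
`∑_σ a_σ h_σ(z)` with operators `a_σ` and `h_σ` homogeneous harmonic of degree `m`. -/
def operatorHarmonic (D m : ℕ) (V : Type*) [AddCommGroup V] [Module ℂ V] :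
    Submodule ℂ ((Fin D → ℂ) → Module.End ℂ V) :=
  Submodule.span ℂ {f | ∃ h ∈ harmonic D m, ∃ a : Module.End ℂ V,
    f = fun z => MvPolynomial.eval z h • a}

/-! ### Formal field series

A field is a formal series `φ(z) = ∑_{n ∈ ℤ} ∑_{m ≥ 0} φ_{n,m}(z) (z²)^n` where `φ_{n,m}` is an
operator valued homogeneous harmonic polynomial of degree `m`.  Its component of degree `k` in `z`,
applied to a vector `Ψ`, is a finite sum because `φ_{n,m} Ψ = 0` for `n` negative enough; it is a
vector valued function on `{z² ≠ 0}` (a polynomial in `z` and `1/z²`).  By uniqueness of the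
harmonic decomposition, an identity between formal series is the same as the identities between the
components of all degrees, as functions on `{z² ≠ 0}`. -/

/-- Component of degree `k` of the formal series with modes `φ`, applied to `Ψ`. -/
def comp {D : ℕ} {V : Type*} [AddCommGroup V] [Module ℂ V]
    (φ : ℤ → ℕ → (Fin D → ℂ) → Module.End ℂ V) (k : ℤ) (z : Fin D → ℂ) (Ψ : V) : V :=
  ∑ᶠ p : {p : ℤ × ℕ // 2 * p.1 + (p.2 : ℤ) = k}, (sq z) ^ p.1.1 • φ p.1.1 p.1.2 z Ψ

/-- Multiplication of a two-variable formal series `X(z,w) = ∑ X_{k,l}(z,w)` (given by its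
components of bidegree `(k,l)`) by `(z - w)² = z² - 2 z · w + w²`. -/
def mulInterval {D : ℕ} {V : Type*} [AddCommGroup V] [Module ℂ V] (z w : Fin D → ℂ)
    (X : ℤ → ℤ → V) : ℤ → ℤ → V := fun k l =>
  sq z • X (k - 2) l - (2 * dot z w) • X (k - 1) (l - 1) + sq w • X k (l - 2)

/-! ### The group `Spin(D)` -/

/-- The Euclidean quadratic form `x²` on `ℝ^D`. -/
def euclForm (D : ℕ) : QuadraticForm ℝ (EuclideanSpace ℝ (Fin D)) :=
  LinearMap.BilinMap.toQuadraticMap (innerₗ (EuclideanSpace ℝ (Fin D)))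

/-- The compact group `Spin(D)`, inside the Clifford algebra with `x x = x²`.  The element `s` acts
on vectors by `x ↦ s x s⁻¹`. -/
abbrev Spin (D : ℕ) : Type := spinGroup (euclForm D)

lemma euclForm_apply {D : ℕ} (u : USphere D) :
    euclForm D (u : EuclideanSpace ℝ (Fin D)) = 1 := by
  have h : ‖(u : EuclideanSpace ℝ (Fin D))‖ = 1 := by simp
  simp [euclForm, h]

lemma ι_sq {D : ℕ} (u : USphere D) :
    CliffordAlgebra.ι (euclForm D) (u : EuclideanSpace ℝ (Fin D)) *
      CliffordAlgebra.ι (euclForm D) (u : EuclideanSpace ℝ (Fin D)) = 1 := by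
  rw [CliffordAlgebra.ι_sq_scalar, euclForm_apply, map_one]

lemma ι_mul_mem {D : ℕ} (u v : USphere D) :
    CliffordAlgebra.ι (euclForm D) (u : EuclideanSpace ℝ (Fin D)) *
      CliffordAlgebra.ι (euclForm D) (v : EuclideanSpace ℝ (Fin D)) ∈ spinGroup (euclForm D) := by
  have hu := ι_sq u
  have hv := ι_sq v
  have hl : ∀ u : USphere D, (⟨_, _, ι_sq u, ι_sq u⟩ : (CliffordAlgebra (euclForm D))ˣ) ∈
      lipschitzGroup (euclForm D) := fun u => Subgroup.subset_closure ⟨_, rfl⟩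
  refine ⟨⟨⟨_, mul_mem (hl u) (hl v), rfl⟩, ?_⟩, ?_⟩
  · set a := CliffordAlgebra.ι (euclForm D) (u : EuclideanSpace ℝ (Fin D))
    set b := CliffordAlgebra.ι (euclForm D) (v : EuclideanSpace ℝ (Fin D))
    have hs : star (a * b) = b * a := by
      simp [a, b, CliffordAlgebra.star_def]
    rw [SetLike.mem_coe, Unitary.mem_iff, hs]
    constructor
    · calc b * a * (a * b) = b * (a * a) * b := by noncomm_ring
        _ = 1 := by rw [hu, mul_one, hv]
    · calc a * b * (b * a) = a * (b * b) * a := by noncomm_ring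
        _ = 1 := by rw [hv, mul_one, hu]
  · exact CliffordAlgebra.ι_mul_ι_mem_evenOdd_zero _ _ _

/-- The element `u v ∈ Spin(D)`, for unit vectors `u`, `v`.  It lifts the product of the reflections
in `u` and in `v`, i.e. the rotation in the plane of `v`, `u` by twice the angle from `v` to `u`. -/
def spinPair {D : ℕ} (u v : USphere D) : Spin D := ⟨_, ι_mul_mem u v⟩

/-- The unit vector `cos t e_α + sin t e_β`. -/
def arc {D : ℕ} {α β : Fin D} (h : α ≠ β) (t : ℝ) : USphere D :=
  ⟨Real.cos t • EuclideanSpace.single α (1 : ℝ) + Real.sin t • EuclideanSpace.single β (1 : ℝ), by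
    have h0 : inner ℝ (EuclideanSpace.single α (1 : ℝ)) (EuclideanSpace.single β (1 : ℝ)) = 0 := by
      rw [EuclideanSpace.inner_single_left]
      simp [h]
    rw [mem_sphere_zero_iff_norm, ← sq_eq_sq₀ (norm_nonneg _) zero_le_one, norm_add_sq_real]
    simp [norm_smul, inner_smul_left, inner_smul_right, h0]⟩

/-- The one-parameter subgroup `e^{t Ω_{αβ}}` of `Spin(D)`, which rotates `e_α` towards `e_β` by the
angle `t` and generates the vector field `z^α ∂_β - z^β ∂_α`. -/
def rot {D : ℕ} {α β : Fin D} (h : α ≠ β) (t : ℝ) : Spin D :=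
  spinPair (arc h (t / 2)) (arc h 0)

/-- The last basis vector `e_D` of `ℝ^D`, as a point of the sphere. -/
def lastVec (D : ℕ) [NeZero D] : USphere D :=
  ⟨EuclideanSpace.single ⟨D - 1, Nat.sub_lt (NeZero.pos D) one_pos⟩ (1 : ℝ), by simp⟩

/-! ### Globally conformal invariant quantum field theory in the analytic picture -/

/-- A globally conformal invariant Wightman theory in the analytic (`z`-) picture on a Hilbert space
`𝓗`, for finitely many fields `φ_A`, `A ∈ I`, which transform under an elementary induced
representation of the conformal group.  The Lie algebra of the conformal group is
represented by the operators `T_α`, `C_α`, `H`, `Ω_{αβ}` on the fields' domain. -/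
structure Theory (D : ℕ) [NeZero D] (𝓗 : Type*) [NormedAddCommGroup 𝓗] [InnerProductSpace ℂ 𝓗]
    (I : Type*) [Fintype I] [DecidableEq I] where
  /-- The fields' domain. -/
  dom : Submodule ℂ 𝓗
  dense_dom : Dense (dom : Set 𝓗)
  /-- The modes `φ_{A {n,m}}(z)`, operator valued harmonic polynomials on the domain. -/
  mode : I → ℤ → ℕ → (Fin D → ℂ) → Module.End ℂ dom
  mode_harmonic : ∀ A n m, mode A n m ∈ operatorHarmonic D m dom
  mode_ne_zero : ∀ A, ∃ n m z, mode A n m z ≠ 0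
  mode_bounded : ∀ (A : I) (Ψ : dom), ∃ N : ℕ, ∀ n : ℤ, n ≤ -(N : ℤ) → ∀ m z, mode A n m z Ψ = 0
  /-- Generators of translations of `z`. -/
  T : Fin D → Module.End ℂ dom
  /-- Generators of special conformal transformations of `z`. -/
  C : Fin D → Module.End ℂ dom
  /-- The conformal Hamiltonian. -/
  H : Module.End ℂ dom
  /-- Generators of rotations of `z`. -/
  Om : Fin D → Fin D → Module.End ℂ dom
  -- Commutation relations of the conformal Lie algebra.
  Om_antisymm : ∀ α β, Om β α = -Om α β
  comm_H_T : ∀ α, ⁅H, T α⁆ = T α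
  comm_H_C : ∀ α, ⁅H, C α⁆ = -C α
  comm_T_C : ∀ α β, ⁅T α, C β⁆ = (2 : ℂ) • ((if α = β then H else 0) - Om α β)
  comm_T_T : ∀ α β, ⁅T α, T β⁆ = 0
  comm_C_C : ∀ α β, ⁅C α, C β⁆ = 0
  comm_H_Om : ∀ α β, ⁅H, Om α β⁆ = 0
  comm_Om_T : ∀ α β γ, ⁅Om α β, T γ⁆ =
    (if α = γ then T β else 0) - (if β = γ then T α else 0)
  comm_Om_C : ∀ α β γ, ⁅Om α β, C γ⁆ =
    (if α = γ then C β else 0) - (if β = γ then C α else 0)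
  comm_Om_Om : ∀ α β γ δ, ⁅Om α β, Om γ δ⁆ =
    (if β = δ then Om α γ else 0) + (if α = γ then Om β δ else 0)
      - (if α = δ then Om β γ else 0) - (if β = γ then Om α δ else 0)
  -- Unitarity: the real generators of the conformal group are antihermitian.
  adj_T : ∀ (α) (Φ Ψ : dom), inner ℂ Φ (T α Ψ) = -inner ℂ (C α Φ) Ψ
  adj_H : ∀ Φ Ψ : dom, inner ℂ Φ (H Ψ) = inner ℂ (H Φ) Ψ
  adj_Om : ∀ (α β) (Φ Ψ : dom), inner ℂ Φ (Om α β Ψ) = -inner ℂ (Om α β Φ) Ψ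
  /-- The dimensions of the fields. -/
  dim : I → ℝ
  dim_pos : ∀ A, 0 < dim A
  /-- Together with the dimensions, the representation of the maximal compact subgroup
  `(U(1) × Spin(D)) / ℤ₂` on the fibre with basis `φ_A`; `s φ_A = ∑_B (rep s)_{BA} φ_B`. -/
  rep : Spin D →* Matrix I I ℂ
  rep_dim : ∀ s A B, rep s B A ≠ 0 → dim B = dim A
  rep_neg_one : ∀ s : Spin D, (s : CliffordAlgebra (euclForm D)) = -1 →
    rep s = Matrix.diagonal fun A => Complex.exp (2 * Real.pi * Complex.I * (dim A : ℂ))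
  /-- The matrices of the generators `Ω_{αβ}` in the fibre. -/
  rep₀ : Fin D → Fin D → Matrix I I ℂ
  rep₀_self : ∀ α, rep₀ α α = 0
  rep₀_deriv : ∀ (α β : Fin D) (h : α ≠ β) (A B : I),
    HasDerivAt (fun t : ℝ => rep (rot h t) B A) (rep₀ α β B A) 0
  /-- `[T_α, φ_A(z)] = ∂_α φ_A(z)`, in degree `k`. -/
  cov_T : ∀ (A : I) (k : ℤ) (α : Fin D) (z : Fin D → ℂ) (Ψ : dom), sq z ≠ 0 →
    HasDerivAt (fun t : ℂ => comp (mode A) (k + 1) (z + t • Pi.single α 1) Ψ)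
      (T α (comp (mode A) k z Ψ) - comp (mode A) k z (T α Ψ)) 0
  /-- `[H, φ_A(z)] = (z · ∂ + d_A) φ_A(z)`, in terms of modes. -/
  cov_H : ∀ (A : I) (n : ℤ) (m : ℕ) (z : Fin D → ℂ),
    ⁅H, mode A n m z⁆ = ((dim A : ℂ) + 2 * n + m) • mode A n m z
  /-- `[Ω_{αβ}, φ_A(z)] = (z^α ∂_β - z^β ∂_α) φ_A(z) + (Ω_{αβ} φ)_A(z)`, in degree `k`. -/
  cov_Om : ∀ (A : I) (k : ℤ) (α β : Fin D) (z : Fin D → ℂ) (Ψ : dom), sq z ≠ 0 →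
    HasDerivAt (fun t : ℂ => comp (mode A) k
        (z + t • (z α • Pi.single β 1 - z β • Pi.single α 1)) Ψ)
      (Om α β (comp (mode A) k z Ψ) - comp (mode A) k z (Om α β Ψ)
        - ∑ B, rep₀ α β B A • comp (mode B) k z Ψ) 0
  /-- `[C_α, φ_A(z)] = (z² ∂_α - 2 z^α z · ∂ - 2 z^α d_A) φ_A(z) + 2 z^β (Ω_{βα} φ)_A(z)`,
  in degree `k + 1`. -/
  cov_C : ∀ (A : I) (k : ℤ) (α : Fin D) (z : Fin D → ℂ) (Ψ : dom), sq z ≠ 0 →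
    HasDerivAt (fun t : ℂ => comp (mode A) k
        (z + t • (sq z • Pi.single α 1 - (2 * z α) • z)) Ψ)
      (C α (comp (mode A) (k + 1) z Ψ) - comp (mode A) (k + 1) z (C α Ψ)
        + (2 * z α * (dim A : ℂ)) • comp (mode A) k z Ψ
        - ∑ β, (2 * z β) • ∑ B, rep₀ β α B A • comp (mode B) k z Ψ) 0
  /-- Statistical parities of the fields. -/
  parity : I → Fin 2
  /-- The conjugation `φ_A ↦ φ*_A = ∑_B conj_{BA} φ_B` of the fibre, an antilinear involution. -/
  conj : Matrix I I ℂ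
  conj_invol : conj * conj.map (starRingEnd ℂ) = 1
  conj_dim : ∀ A B, conj B A ≠ 0 → dim B = dim A
  conj_parity : ∀ A B, conj B A ≠ 0 → parity B = parity A
  /-- Invariance of the conjugation (which intertwines `s` with `e_D s e_D`, because `z ↦ z*` is
  the composition of `z ↦ R_D(z̄)` with the Weyl reflection). -/
  conj_rep : ∀ s s' : Spin D,
    (s' : CliffordAlgebra (euclForm D)) =
      CliffordAlgebra.ι (euclForm D) (lastVec D : EuclideanSpace ℝ (Fin D)) * s *
        CliffordAlgebra.ι (euclForm D) (lastVec D : EuclideanSpace ℝ (Fin D)) →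
    conj * (rep s).map (starRingEnd ℂ) = rep s' * conj
  /-- The field conjugation law, on the real points `z = e^{2π i ζ} u`: there the hermitian
  conjugate of `φ_A(ζ,u) = e^{2π i d_A ζ} φ_A(e^{2π i ζ} u)` is the action of the Weyl reflection on
  `φ*_A(ζ,u)`, which for an elementary induced representation is the action of `u e_D ∈ Spin(D)`;
  the component of degree `k` is conjugate to that of degree `k'` with
  `d_A + k' = -(d_A + k)`. -/
  conj_law : ∀ (A : I) (k k' : ℤ), (k : ℝ) + k' + 2 * dim A = 0 →
    ∀ (u : USphere D) (Φ Ψ : dom),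
      inner ℂ Φ (comp (mode A) k (toC u) Ψ) =
        inner ℂ (∑ B, (rep (spinPair u (lastVec D)) * conj) B A • comp (mode B) k' (toC u) Φ) Ψ
  -- Spectral condition.
  H_nonneg : ∀ Ψ : dom, 0 ≤ (inner ℂ Ψ (H Ψ)).re
  /-- The vacuum. -/
  vac : dom
  norm_vac : ‖vac‖ = 1
  vac_invariant : (∀ α, T α vac = 0) ∧ (∀ α, C α vac = 0) ∧ H vac = 0 ∧ ∀ α β, Om α β vac = 0
  vac_unique : ∀ Ψ : dom, (∀ α, T α Ψ = 0) → (∀ α, C α Ψ = 0) → H Ψ = 0 →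
    (∀ α β, Om α β Ψ = 0) → ∃ c : ℂ, Ψ = c • vac
  /-- Strong locality (Huygens principle):
  `((z-w)²)^M (φ_A(z) φ_B(w) - (-1)^{p_A p_B} φ_B(w) φ_A(z)) = 0` as a formal series. -/
  locality : ∀ A B : I, ∃ M : ℕ, 0 < M ∧ ∀ (z w : Fin D → ℂ) (Ψ : dom), sq z ≠ 0 → sq w ≠ 0 →
    (mulInterval z w)^[M] (fun k l =>
      comp (mode A) k z (comp (mode B) l w Ψ)
        - (-1 : ℂ) ^ ((parity A : ℕ) * (parity B : ℕ)) •
          comp (mode B) l w (comp (mode A) k z Ψ)) = 0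
  /-- Completeness: products of modes applied to the vacuum span the domain. -/
  complete : Submodule.span ℂ {Ψ : dom | ∃ L : List (I × ℤ × ℕ × (Fin D → ℂ)),
    Ψ = (L.map fun x => mode x.1 x.2.1 x.2.2.1 x.2.2.2).prod vac} = ⊤

section Thermal

variable {D : ℕ} [NeZero D] {𝓗 : Type*} [NormedAddCommGroup 𝓗] [InnerProductSpace ℂ 𝓗]
  {I : Type*} [Fintype I] [DecidableEq I]

/-! ### Thermal correlation functions -/

/-- The conformal Hamiltonian has finite dimensional eigenspaces. -/
def Theory.FiniteDegeneracy (Q : Theory D 𝓗 I) : Prop :=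
  ∀ μ : ℂ, FiniteDimensional ℂ (Module.End.eigenspace Q.H μ)

/-- The eigenspace of `H` with eigenvalue `j / 2`. -/
def Theory.level (Q : Theory D 𝓗 I) (j : ℕ) : Submodule ℂ Q.dom :=
  Module.End.eigenspace Q.H ((j : ℂ) / 2)

/-- The trace `∑_σ ⟨Ψ_{jσ} | X Ψ_{jσ}⟩` over an orthonormal basis of the eigenspace of `H` with
eigenvalue `j / 2`. -/
def Theory.levelTrace (Q : Theory D 𝓗 I) (hQ : Q.FiniteDegeneracy) (j : ℕ)
    (X : Module.End ℂ Q.dom) : ℂ :=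
  haveI : FiniteDimensional ℂ (Q.level j) := hQ _
  ∑ σ, inner ℂ (stdOrthonormalBasis ℂ (Q.level j) σ : Q.dom)
    (X (stdOrthonormalBasis ℂ (Q.level j) σ : Q.dom))

/-- `tr (X q^H)`, a formal power series in `q^{1/2}`. -/
def Theory.thermalTrace (Q : Theory D 𝓗 I) (hQ : Q.FiniteDegeneracy)
    (X : Module.End ℂ Q.dom) : PowerSeries ℂ :=
  PowerSeries.mk fun j => Q.levelTrace hQ j X

/-- The thermal mean value `⟨X⟩_q = tr (X q^H) / Z`, with the partition function `Z = tr q^H`, a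
formal power series in `q^{1/2}`. -/
def Theory.thermalMean (Q : Theory D 𝓗 I) (hQ : Q.FiniteDegeneracy)
    (X : Module.End ℂ Q.dom) : PowerSeries ℂ :=
  (Q.thermalTrace hQ 1)⁻¹ * Q.thermalTrace hQ X

/-- The general term of the series
`⟨φ_{A_1}(ζ_1,u_1) … φ_{A_n}(ζ_n,u_n)⟩_q = ∑ ⟨φ_{A_1;ν_1,m_1}(u_1) … φ_{A_n;ν_n,m_n}(u_n)⟩_q
  e^{-2π i (ν_1 ζ_1 + … + ν_n ζ_n)}`, where `-ν_k = d_{A_k} + 2 n_k + m_k` and every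
thermal mean value is itself expanded in powers of `q^{1/2} = e^{π i τ}`.  The index consists of the
pairs `(n_k, m_k)` and of the power `j` of `q^{1/2}`; the argument is `p = (ζ, τ)`. -/
def Theory.thermalTerm (Q : Theory D 𝓗 I) (hQ : Q.FiniteDegeneracy) {n : ℕ} (A : Fin n → I)
    (u : Fin n → USphere D) (p : (Fin n → ℂ) × ℂ) (x : (Fin n → ℤ × ℕ) × ℕ) : ℂ :=
  PowerSeries.coeff x.2 (Q.thermalMean hQ
      (List.ofFn fun k => Q.mode (A k) (x.1 k).1 (x.1 k).2 (toC (u k))).prod)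
    * Complex.exp (Real.pi * Complex.I * p.2 * x.2)
    * Complex.exp (2 * Real.pi * Complex.I *
        ∑ k, ((Q.dim (A k) : ℂ) + 2 * (x.1 k).1 + (x.1 k).2) * p.1 k)

end Thermal

/-- The domain `0 < -Im ζ_{jk} < Im τ`, `j < k`, for `τ` in the upper half plane. -/
def thermalDomain (n : ℕ) : Set ((Fin n → ℂ) × ℂ) :=
  {p | 0 < p.2.im ∧ ∀ j k : Fin n, j < k →
    0 < -(p.1 j - p.1 k).im ∧ -(p.1 j - p.1 k).im < p.2.im}

/-! ### Meromorphic functions of several variables -/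

/-- `ℂ^n` times the upper half plane. -/
def timeDomain (n : ℕ) : Set ((Fin n → ℂ) × ℂ) := {p | 0 < p.2.im}

/-- Meromorphy in several variables: near every point of `U`, the function is a quotient of two
holomorphic functions, outside the (nowhere dense) zero set of the denominator. -/
def IsMeromorphic {E : Type*} [NormedAddCommGroup E] [NormedSpace ℂ E] (f : E → ℂ)
    (U : Set E) : Prop :=
  ∀ x ∈ U, ∃ V : Set E, IsOpen V ∧ x ∈ V ∧ V ⊆ U ∧ ∃ g h : E → ℂ,
    AnalyticOnNhd ℂ g V ∧ AnalyticOnNhd ℂ h V ∧ V ⊆ closure {y ∈ V | h y ≠ 0} ∧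
      ∀ y ∈ V, h y ≠ 0 → f y = g y / h y

/-- Equality of meromorphic functions on `U`: agreement on a dense open subset. -/
def MeroEq {E : Type*} [TopologicalSpace E] (U : Set E) (f g : E → ℂ) : Prop :=
  ∃ W : Set E, IsOpen W ∧ W ⊆ U ∧ U ⊆ closure W ∧ Set.EqOn f g W

/-- The thermal correlation function `⟨φ_{A_1}(ζ_1,u_1) … φ_{A_n}(ζ_n,u_n)⟩_q` converges absolutely
in the domain `0 < -Im ζ_{jk} < Im τ` to the function `f` of `(ζ, τ)`, which is meromorphic. -/
def Theory.ConvergesToMeromorphic {D : ℕ} [NeZero D] {𝓗 : Type*} [NormedAddCommGroup 𝓗]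
    [InnerProductSpace ℂ 𝓗] {I : Type*} [Fintype I] [DecidableEq I]
    (Q : Theory D 𝓗 I) (hQ : Q.FiniteDegeneracy) {n : ℕ}
    (A : Fin n → I) (u : Fin n → USphere D) (f : (Fin n → ℂ) × ℂ → ℂ) : Prop :=
  IsMeromorphic f (timeDomain n) ∧ ∀ p ∈ thermalDomain n,
    Summable (fun x => ‖Q.thermalTerm hQ A u p x‖) ∧ HasSum (Q.thermalTerm hQ A u p) (f p)

/-! ### The basic elliptic functions -/

/-- The odd Jacobi theta function `ϑ₁₁(ζ, τ)`. -/
def theta11 (ζ τ : ℂ) : ℂ :=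
  Complex.exp (Real.pi * Complex.I * τ / 4 + Real.pi * Complex.I * (ζ + 1 / 2)) *
    jacobiTheta₂ (ζ + (τ + 1) / 2) τ

/-- The angle variable `α` with `u · v = cos 2πα`. -/
def angle {D : ℕ} (u v : USphere D) : ℝ :=
  Real.arccos (inner ℝ (u : EuclideanSpace ℝ (Fin D)) v) / (2 * Real.pi)

/-- The elliptic version `Θ(ζ₁,u₁;ζ₂,u₂;τ)` of the compact picture interval, as a function of
`ζ = ζ₁ - ζ₂`. -/
def bigTheta {D : ℕ} (ζ : ℂ) (u v : USphere D) (τ : ℂ) : ℂ :=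
  Complex.exp (-(Real.pi * Complex.I * τ / 2)) *
    theta11 (ζ + angle u v) τ * theta11 (ζ - angle u v) τ

/-- `Ω_n = ∏_{j < k} Θ_{jk}`. -/
def bigOmega {D n : ℕ} (u : Fin n → USphere D) (p : (Fin n → ℂ) × ℂ) : ℂ :=
  ∏ x : Fin n × Fin n with x.1 < x.2, bigTheta (p.1 x.1 - p.1 x.2) (u x.1) (u x.2) p.2

/-- The time differences `(ζ_{12}, …, ζ_{n-1 n})`. -/
def timeDiff {n : ℕ} (ζ : Fin n → ℂ) : Fin (n - 1) → ℂ := fun k =>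
  ζ ⟨k, by omega⟩ - ζ ⟨k + 1, by omega⟩

/-- The symmetric integral matrix `A^{(n)}` of the quadratic form `∑_{l ≤ m} (λ_l + … + λ_m)²`. -/
def thetaMatrix (n : ℕ) : Matrix (Fin (n - 1)) (Fin (n - 1)) ℤ := fun j k =>
  (min (j : ℤ) k + 1) * ((n : ℤ) - 1 - max (j : ℤ) k)

/-- The numbers `ε_k = p_{k+1} + … + p_n`, `k = 1, …, n - 1`. -/
def epsilon {n : ℕ} (p : Fin n → Fin 2) (k : Fin (n - 1)) : ℤ :=
  ∑ l ∈ Finset.univ.filter (fun l : Fin n => (k : ℕ) < (l : ℕ)), ((p l : ℕ) : ℤ)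

/-- The properties of the numerators `F_c^{(N)}` of the basic elliptic functions
`E_c^{(N)} = F_c^{(N)} / Ω_n^N`: a function of `n - 1` time differences and of `τ`, holomorphic on
`ℂ^{n-1}` times the upper half plane, which is the sum of a Taylor series in `q^{1/2} = e^{π i τ}`
whose coefficients are Laurent polynomials in `e^{π i ζ_{k k+1}}`, with the stated
quasi-periodicity. -/
structure IsThetaNumerator (n N : ℕ) (p : Fin n → Fin 2)
    (F : (Fin (n - 1) → ℂ) × ℂ → ℂ) : Prop where
  holo : AnalyticOnNhd ℂ F {x | 0 < x.2.im}
  expansion : ∃ P : ℕ → (Fin (n - 1) → ℤ) →₀ ℂ, ∀ (w : Fin (n - 1) → ℂ) (τ : ℂ), 0 < τ.im →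
    HasSum (fun j : ℕ => ((P j).sum fun k c => c * Complex.exp (Real.pi * Complex.I * ∑ i, k i * w i))
      * Complex.exp (Real.pi * Complex.I * τ * j)) (F (w, τ))
  period_one : ∀ (l : Fin (n - 1) → ℤ) (w : Fin (n - 1) → ℂ) (τ : ℂ), 0 < τ.im →
    F (fun k => w k + l k, τ) = (-1 : ℂ) ^ (∑ k, l k * epsilon p k) * F (w, τ)
  period_tau : ∀ (l : Fin (n - 1) → ℤ) (w : Fin (n - 1) → ℂ) (τ : ℂ), 0 < τ.im →
    F (fun k => w k + l k * τ, τ) = (-1 : ℂ) ^ (∑ k, l k * epsilon p k) *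
      Complex.exp
        (-(2 * Real.pi * Complex.I * N * (∑ j, ∑ k, (l j : ℂ) * thetaMatrix n j k * l k) * τ)
          - 4 * Real.pi * Complex.I * N * ∑ j, ∑ k, (l j : ℂ) * thetaMatrix n j k * w k) *
      F (w, τ)

/-- The sign exponent `ε(σ) = ∑ p_{σ(i)} p_{σ(j)}` over the pairs `i < j` with `σ(i) > σ(j)`. -/
def permSign {n : ℕ} (p : Fin n → Fin 2) (σ : Equiv.Perm (Fin n)) : ℕ :=
  ∑ x : Fin n × Fin n with x.1 < x.2 ∧ σ x.2 < σ x.1, (p (σ x.1) : ℕ) * (p (σ x.2) : ℕ)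

end GCI

end

/-!
The thermal mean values become holomorphic on a tube once the short distance singularities are
multiplied away, and the periods of the tube are then supplied by the spectrum of `H` and by the KMS
condition.

*Integral shifts.* `φ_A(ζ + 1, u) = e^{2π i d_A} φ_A(ζ, u)`, so the behaviour under `ζ_m ↦ ζ_m + 1`
is termwise, and the sign is `(-1)^{p_m}` by the spin–statistics relation
(`Theory.spin_statistics`). The latter comes from comparing the vacuum mean values of
`φ_A^* φ_A` and `φ_A φ_A^*` along a coordinate axis: translation covariance determines both up to a
positive factor, and locality relates them.

*Locality.* Grouping the modes by homogeneous degree, the thermal series is a series in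
`e^{2π i ζ_k}` and `q^{1/2}`. Multiplying its coefficients by the `N`-th powers of the compact
picture intervals of all pairs of points (the Laurent polynomial `links`) makes the series of the
permuted products of fields coincide up to the statistical sign (`Theory.act_links_permCoef`). The
hypothesis gives absolute convergence of this one series in every permuted copy of the thermal
domain. Absolute convergence at two points implies it at their midpoint, hence it holds in the whole
`tube` `|Im ζ_{jk}| < Im τ` (`Theory.summable_redCoef`), where the sum is holomorphic
(`analyticOnNhd_tsum_exp`). The identity theorem for meromorphic functions
(`IsMeromorphic.meroEq_of_eqOn`) turns this into the permutation symmetry (`Theory.meroEq_perm`).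

*Shifts by `τ`.* Cyclicity of the trace moves the last field to the front, with its time shifted by
`-τ` (`Theory.coef_rotate`, `Theory.eqOn_rotate`), and the permutation symmetry brings it back. The
resulting sign involves the parities of all the other fields; it equals `(-1)^{p_m}` because a
mean value vanishes unless the total dimension is an integer, that is, unless the total parity is
even (`Theory.meroEq_shift_tau_last`).

*The numerator.* Each factor of `Ω_n` is the compact picture interval times two values of the entire
function `kap` (`bigTheta_eq`), so `Ω_n^N f` is holomorphic in the tube. The translates of the tube
by multiples of `τ` cover the whole domain and `Ω_n^N f` is multiplied by a nowhere vanishing factor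
under such translations, so it is holomorphic everywhere (`Theory.exists_numerator`). It depends on
time differences only, and `F` is its restriction to first time `0` (`sec`); the quadratic form of
its quasi-periods is computed in `sum_pairs_sec`. Each power of `q^{1/2}` has a Laurent polynomial
as coefficient, since locality bounds the degree of every field from below and their sum is fixed
(`Theory.finite_support_act_coef`). The expansion in `q^{1/2}` converges a priori only for `Im τ`
large compared with the times, and everywhere because a holomorphic function of period `2`
in `τ`, bounded for large `Im τ`, is a power series in `q^{1/2}` on the whole disc
(`hasSum_exp_of_large_im`).
-/

noncomputable section

namespace GCI

open Filter Topology Set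

/-! ### Sums of exponentials -/

/-- A series of exponentials of linear forms is analytic at `p₀` if it still converges absolutely there
with the weights `e^{δ ‖L i‖}`, which dominate the Taylor expansions of the terms. -/
lemma analyticAt_tsum_exp_of_summable {ι E : Type*} [NormedAddCommGroup E] [NormedSpace ℂ E]
    (c : ι → ℂ) (L : ι → E →L[ℂ] ℂ) (p₀ : E) (δ : ℝ) (hδ : 0 < δ)
    (hs : Summable fun i => ‖c i * Complex.exp (L i p₀)‖ * Real.exp (δ * ‖L i‖)) :
    AnalyticAt ℂ (fun p => ∑' i, c i * Complex.exp (L i p)) p₀ := by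
  set w : ι → ℂ := fun i => c i * Complex.exp (L i p₀) with hw
  set M : ι → (m : ℕ) → ContinuousMultilinearMap ℂ (fun _ : Fin m => E) ℂ := fun i m =>
    (w i / (m.factorial : ℂ)) • (ContinuousMultilinearMap.mkPiAlgebraFin ℂ m ℂ).compContinuousLinearMap
      (fun _ => L i) with hM
  have hMn : ∀ i m, ‖M i m‖ * δ ^ m ≤ ‖w i‖ * ((δ * ‖L i‖) ^ m / m.factorial) := by
    intro i m
    have h1 : ‖(ContinuousMultilinearMap.mkPiAlgebraFin ℂ m ℂ).compContinuousLinearMap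
        (fun _ => L i)‖ ≤ ‖L i‖ ^ m := by
      refine (ContinuousMultilinearMap.norm_compContinuousLinearMap_le _ _).trans ?_
      simp
    have h2 : ‖M i m‖ ≤ ‖w i‖ / m.factorial * ‖L i‖ ^ m := by
      simp only [hM]
      rw [norm_smul, norm_div, Complex.norm_natCast]
      gcongr
    calc ‖M i m‖ * δ ^ m ≤ ‖w i‖ / m.factorial * ‖L i‖ ^ m * δ ^ m := by gcongr
      _ = _ := by rw [mul_pow]; ring
  have hexp : ∀ i, HasSum (fun m : ℕ => ‖w i‖ * ((δ * ‖L i‖) ^ m / m.factorial))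
      (‖w i‖ * Real.exp (δ * ‖L i‖)) := by
    intro i
    have := NormedSpace.expSeries_div_hasSum_exp (δ * ‖L i‖)
    rw [← Real.exp_eq_exp_ℝ] at this
    exact this.mul_left _
  have hnn : ∀ i (m : ℕ), 0 ≤ ‖w i‖ * ((δ * ‖L i‖) ^ m / m.factorial) := fun i m => by positivity
  have hle : ∀ i m, ‖M i m‖ * δ ^ m ≤ ‖w i‖ * Real.exp (δ * ‖L i‖) := fun i m =>
    (hMn i m).trans (le_hasSum (hexp i) m fun b _ => hnn i b)
  have hMs : ∀ m, Summable fun i => ‖M i m‖ := by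
    intro m
    have h : Summable fun i => ‖M i m‖ * δ ^ m :=
      Summable.of_nonneg_of_le (fun i => by positivity) (fun i => hle i m) hs
    exact (summable_mul_right_iff (pow_ne_zero m hδ.ne')).1 h
  set p : FormalMultilinearSeries ℂ E ℂ := fun m => ∑' i, M i m with hp
  have hrad : ENNReal.ofReal δ ≤ p.radius := by
    rw [ENNReal.ofReal]
    refine p.le_radius_of_bound (∑' i, ‖w i‖ * Real.exp (δ * ‖L i‖)) fun m => ?_
    rw [Real.coe_toNNReal δ hδ.le]
    calc ‖p m‖ * δ ^ m ≤ (∑' i, ‖M i m‖) * δ ^ m := by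
          gcongr; exact norm_tsum_le_tsum_norm (hMs m)
      _ = ∑' i, ‖M i m‖ * δ ^ m := tsum_mul_right.symm
      _ ≤ _ := ((hMs m).mul_right _).tsum_le_tsum (fun i => hle i m) hs
  refine ⟨p, ENNReal.ofReal δ, hrad, by simpa using hδ, fun {y} hy => ?_⟩
  have hy' : ‖y‖ < δ := by
    rw [Metric.mem_eball, edist_eq_enorm_sub, sub_zero, ← ofReal_norm] at hy
    exact (ENNReal.ofReal_lt_ofReal_iff hδ).1 hy
  have hval : ∀ m i, M i m (fun _ => y) = w i * ((L i y) ^ m / m.factorial) := by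
    intro m i
    simp [hM]
    ring
  have hb : ∀ i m, ‖w i * ((L i y) ^ m / m.factorial)‖
      ≤ ‖w i‖ * ((δ * ‖L i‖) ^ m / m.factorial) := by
    intro i m
    rw [norm_mul, norm_div, norm_pow, Complex.norm_natCast]
    gcongr
    calc ‖L i y‖ ≤ ‖L i‖ * ‖y‖ := (L i).le_opNorm y
      _ ≤ ‖L i‖ * δ := by gcongr
      _ = _ := mul_comm _ _
  have hsum2 : Summable fun x : ι × ℕ => w x.1 * ((L x.1 y) ^ x.2 / x.2.factorial) := by
    refine Summable.of_norm_bounded (g := fun x : ι × ℕ =>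
      ‖w x.1‖ * ((δ * ‖L x.1‖) ^ x.2 / x.2.factorial)) ?_ fun x => hb x.1 x.2
    rw [summable_prod_of_nonneg fun x => hnn x.1 x.2]
    exact ⟨fun i => (hexp i).summable, by simpa only [(hexp _).tsum_eq] using hs⟩
  have hin : ∀ i, HasSum (fun m : ℕ => w i * ((L i y) ^ m / m.factorial))
      (c i * Complex.exp (L i (p₀ + y))) := by
    intro i
    have := NormedSpace.expSeries_div_hasSum_exp (L i y)
    rw [← Complex.exp_eq_exp_ℂ] at this
    have h := this.mul_left (w i)
    rwa [hw, mul_assoc, ← Complex.exp_add, ← map_add] at h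
  have htot := hsum2.hasSum
  have e1 := htot.prod_fiberwise hin
  have e2 : HasSum (fun m : ℕ => ∑' i, w i * ((L i y) ^ m / m.factorial))
      (∑' x : ι × ℕ, w x.1 * ((L x.1 y) ^ x.2 / x.2.factorial)) := by
    have h3 := (Equiv.prodComm ℕ ι).hasSum_iff.2 htot
    refine h3.prod_fiberwise fun m => ?_
    exact (((Equiv.prodComm ℕ ι).summable_iff.2 hsum2).prod_factor m).hasSum
  rw [e1.tsum_eq]
  refine e2.congr_fun fun m => ?_
  rw [show p m (fun _ : Fin m => y) = ∑' i, M i m (fun _ => y) from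
    ((hMs m).of_norm.hasSum.mapL
      (ContinuousMultilinearMap.apply ℂ (fun _ : Fin m => E) ℂ (fun _ => y))).tsum_eq.symm]
  exact tsum_congr fun i => hval m i

/-- The four complex directions `±1, ±i`. -/
def dir : Fin 2 × Fin 2 → ℂ := fun s =>
  if s.1 = 0 then (if s.2 = 0 then 1 else -1) else (if s.2 = 0 then Complex.I else -Complex.I)

/-- The weight `e^{δ ‖a‖}` is dominated by translations in the four coordinate directions, so absolute
convergence on a neighbourhood implies convergence with weights. -/
lemma exp_mul_norm_le_sum_dir (δ : ℝ) (hδ : 0 ≤ δ) (a : ℂ) :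
    Real.exp (δ * ‖a‖) ≤ ∑ s, Real.exp (2 * δ * (dir s * a).re) := by
  have h := Complex.norm_le_abs_re_add_abs_im a
  have e : ∑ s, Real.exp (2 * δ * (dir s * a).re) = Real.exp (2 * δ * a.re)
      + Real.exp (-(2 * δ * a.re)) + Real.exp (-(2 * δ * a.im)) + Real.exp (2 * δ * a.im) := by
    rw [Fintype.sum_prod_type]
    simp [dir, Fin.sum_univ_two]
    ring
  rw [e]
  have p1 := Real.exp_pos (2 * δ * a.re)
  have p2 := Real.exp_pos (-(2 * δ * a.re))
  have p3 := Real.exp_pos (2 * δ * a.im)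
  have p4 := Real.exp_pos (-(2 * δ * a.im))
  have key : ∀ x, ‖a‖ ≤ 2 * x → Real.exp (δ * ‖a‖) ≤ Real.exp (2 * δ * x) := fun x hx =>
    Real.exp_le_exp.2 (by nlinarith)
  rcases le_total |a.re| |a.im| with h1 | h1
  · rcases abs_cases a.im with ⟨h2, -⟩ | ⟨h2, -⟩
    · have := key a.im (by linarith)
      linarith
    · have := key (-a.im) (by linarith)
      rw [mul_neg] at this
      linarith
  · rcases abs_cases a.re with ⟨h2, -⟩ | ⟨h2, -⟩
    · have := key a.re (by linarith)
      linarith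
    · have := key (-a.re) (by linarith)
      rw [mul_neg] at this
      linarith

/-- A series of exponentials of linear forms which converges absolutely at every point of an open
set is analytic there: near `p₀` its terms are dominated by the sum of their values at the finitely
many points `p₀ + 2 δ ∑ₖ sₖ vₖ` with `sₖ ∈ {±1, ±i}`. -/
lemma analyticOnNhd_tsum_exp {ι E κ : Type*} [NormedAddCommGroup E] [NormedSpace ℂ E] [Fintype κ]
    (v : κ → E) (hv : ∀ L : E →L[ℂ] ℂ, ‖L‖ ≤ ∑ k, ‖L (v k)‖)
    (c : ι → ℂ) (L : ι → E →L[ℂ] ℂ) (U : Set E) (hU : IsOpen U)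
    (hs : ∀ p ∈ U, Summable fun i => ‖c i * Complex.exp (L i p)‖) :
    AnalyticOnNhd ℂ (fun p => ∑' i, c i * Complex.exp (L i p)) U := by
  classical
  intro p₀ hp₀
  have hcont : ∀ s : κ → Fin 2 × Fin 2, ∀ᶠ δ : ℝ in 𝓝 0,
      p₀ + (2 * δ : ℂ) • ∑ k, dir (s k) • v k ∈ U := by
    intro s
    have : ContinuousAt (fun δ : ℝ => p₀ + (2 * δ : ℂ) • ∑ k, dir (s k) • v k) 0 := by fun_prop
    exact this.eventually_mem (hU.mem_nhds (by simpa using hp₀))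
  have hcont' := (eventually_all.2 hcont)
  obtain ⟨δ, hδm, hδ⟩ := ((hcont'.filter_mono nhdsWithin_le_nhds).and
    (self_mem_nhdsWithin : Ioi (0 : ℝ) ∈ 𝓝[>] 0)).exists
  refine analyticAt_tsum_exp_of_summable c L p₀ δ hδ ?_
  refine Summable.of_nonneg_of_le (fun i => by positivity) (fun i => ?_)
    (summable_sum (s := Finset.univ) fun (s : κ → Fin 2 × Fin 2) _ => hs _ (hδm s))
  calc ‖c i * Complex.exp (L i p₀)‖ * Real.exp (δ * ‖L i‖)
      ≤ ‖c i * Complex.exp (L i p₀)‖ * ∏ k, ∑ s, Real.exp (2 * δ * (dir s * L i (v k)).re) := by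
        gcongr
        calc Real.exp (δ * ‖L i‖) ≤ Real.exp (δ * ∑ k, ‖L i (v k)‖) := by
              exact Real.exp_le_exp.2 (mul_le_mul_of_nonneg_left (hv _) (le_of_lt hδ))
          _ = ∏ k, Real.exp (δ * ‖L i (v k)‖) := by rw [Finset.mul_sum, Real.exp_sum]
          _ ≤ _ := Finset.prod_le_prod (fun _ _ => (Real.exp_pos _).le) fun k _ =>
              exp_mul_norm_le_sum_dir δ (le_of_lt hδ) _
    _ = ∑ s : κ → Fin 2 × Fin 2,
          ‖c i * Complex.exp (L i (p₀ + (2 * δ : ℂ) • ∑ k, dir (s k) • v k))‖ := by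
        rw [Finset.prod_univ_sum, Finset.mul_sum, Fintype.piFinset_univ]
        refine Finset.sum_congr rfl fun s _ => ?_
        rw [← Real.exp_sum, norm_mul, norm_mul, Complex.norm_exp, Complex.norm_exp, mul_assoc,
          ← Real.exp_add, map_add, Complex.add_re]
        congr 3
        simp only [map_smul, map_sum, smul_eq_mul]
        rw [show (2 * (δ : ℂ)) = ((2 * δ : ℝ) : ℂ) by push_cast; ring, Complex.re_ofReal_mul,
          Complex.re_sum, Finset.mul_sum]

/-! ### Meromorphic functions of several variables -/

section GenericAgreement

variable {E : Type*} [TopologicalSpace E]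

lemma MeroEq.of_local {U : Set E} (hU : IsOpen U) {f g : E → ℂ}
    (h : ∀ x ∈ U, ∃ V : Set E, IsOpen V ∧ x ∈ V ∧ MeroEq V f g) : MeroEq U f g := by
  refine ⟨interior {x | f x = g x} ∩ U, isOpen_interior.inter hU, inter_subset_right, ?_,
    fun x hx => interior_subset (s := {x | f x = g x}) hx.1⟩
  intro x hx
  obtain ⟨V, hV, hxV, W, hW, hWV, hVW, hfg⟩ := h x hx
  rw [mem_closure_iff]
  intro O hO hxO
  obtain ⟨y, hy, hyW⟩ := mem_closure_iff.1 (hVW hxV) (O ∩ U) (hO.inter hU) ⟨hxO, hx⟩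
  exact ⟨y, hy.1, interior_maximal (fun z hz => hfg hz) hW hyW, hy.2⟩

lemma MeroEq.refl {U : Set E} (hU : IsOpen U) (f : E → ℂ) : MeroEq U f f :=
  ⟨U, hU, subset_rfl, subset_closure, fun _ _ => rfl⟩

lemma MeroEq.symm {U : Set E} {f g : E → ℂ} (h : MeroEq U f g) : MeroEq U g f := by
  obtain ⟨W, hW, hWU, hd, he⟩ := h
  exact ⟨W, hW, hWU, hd, he.symm⟩

lemma subset_closure_inter_of_dense {U W W' : Set E} (hW' : IsOpen W')
    (hd : U ⊆ closure W) (hd' : U ⊆ closure W') (hW'U : W' ⊆ U) : U ⊆ closure (W ∩ W') := by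
  intro x hx
  rw [mem_closure_iff]
  intro O hO hxO
  obtain ⟨y, hyO, hyW⟩ := mem_closure_iff.1 (hd' hx) O hO hxO
  obtain ⟨z, hz, hzW⟩ := mem_closure_iff.1 (hd (hW'U hyW)) (O ∩ W') (hO.inter hW') ⟨hyO, hyW⟩
  exact ⟨z, hz.1, hzW, hz.2⟩

/-- Generic agreement passes to pointwise operations on two pairs of functions. -/
lemma MeroEq.map₂ {U : Set E} {f g f' g' h h' : E → ℂ} (h₁ : MeroEq U f g) (h₂ : MeroEq U f' g')
    (H : ∀ x ∈ U, f x = g x → f' x = g' x → h x = h' x) : MeroEq U h h' := by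
  obtain ⟨W, hW, hWU, hd, he⟩ := h₁
  obtain ⟨W', hW', hWU', hd', he'⟩ := h₂
  exact ⟨W ∩ W', hW.inter hW', inter_subset_left.trans hWU,
    subset_closure_inter_of_dense hW' hd hd' hWU',
    fun x hx => H x (hWU hx.1) (he hx.1) (he' hx.2)⟩

lemma MeroEq.map {U : Set E} {f g h h' : E → ℂ} (h₁ : MeroEq U f g)
    (H : ∀ x ∈ U, f x = g x → h x = h' x) : MeroEq U h h' :=
  h₁.map₂ h₁ fun x hx e _ => H x hx e

lemma MeroEq.trans {U : Set E} {f g h : E → ℂ} (h₁ : MeroEq U f g) (h₂ : MeroEq U g h) :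
    MeroEq U f h :=
  h₁.map₂ h₂ fun _ _ e e' => e.trans e'

lemma MeroEq.mono {U V : Set E} {f g : E → ℂ} (h : MeroEq U f g) (hV : IsOpen V) (hVU : V ⊆ U) :
    MeroEq V f g := by
  obtain ⟨W, hW, hWU, hd, he⟩ := h
  refine ⟨W ∩ V, hW.inter hV, inter_subset_right, fun x hx => ?_, fun x hx => he hx.1⟩
  rw [mem_closure_iff]
  intro O hO hxO
  obtain ⟨y, hy, hyW⟩ := mem_closure_iff.1 (hd (hVU hx)) (O ∩ V) (hO.inter hV) ⟨hxO, hx⟩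
  exact ⟨y, hy.1, hyW, hy.2⟩

lemma MeroEq.comp_homeomorph {E' : Type*} [TopologicalSpace E']
    {U : Set E} {f g : E → ℂ} (h : MeroEq U f g) (e : E' ≃ₜ E) :
    MeroEq (e ⁻¹' U) (f ∘ e) (g ∘ e) := by
  obtain ⟨W, hW, hWU, hd, he⟩ := h
  refine ⟨e ⁻¹' W, hW.preimage e.continuous, preimage_mono hWU, ?_, fun x hx => he hx⟩
  rw [← e.preimage_closure]
  exact preimage_mono hd

lemma MeroEq.eqOn_of_continuousOn {U : Set E} {f g : E → ℂ} (h : MeroEq U f g)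
    (hf : ContinuousOn f U) (hg : ContinuousOn g U) : EqOn f g U := by
  obtain ⟨W, hW, hWU, hd, he⟩ := h
  exact he.of_subset_closure hf hg hWU hd

end GenericAgreement

section Mero

variable {E : Type*} [NormedAddCommGroup E] [NormedSpace ℂ E]

lemma _root_.AnalyticOnNhd.isMeromorphic {f : E → ℂ} {U : Set E} (hU : IsOpen U)
    (hf : AnalyticOnNhd ℂ f U) : IsMeromorphic f U := fun x hx =>
  ⟨U, hU, hx, subset_rfl, f, fun _ => 1, hf, fun _ _ => analyticAt_const,
    by simpa using subset_closure, by simp⟩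

lemma IsMeromorphic.analytic_mul {f g : E → ℂ} {U : Set E} (hg : AnalyticOnNhd ℂ g U)
    (hf : IsMeromorphic f U) : IsMeromorphic (fun x => g x * f x) U := by
  intro x hx
  obtain ⟨V, hV, hxV, hVU, a, b, ha, hb, hd, hab⟩ := hf x hx
  refine ⟨V, hV, hxV, hVU, fun x => g x * a x, b, (hg.mono hVU).mul ha, hb, hd, fun y hy h => ?_⟩
  simp only [hab y hy h, mul_div_assoc]

lemma IsMeromorphic.comp_homeomorph {E' : Type*} [NormedAddCommGroup E'] [NormedSpace ℂ E']
    {f : E → ℂ} {U : Set E} (hf : IsMeromorphic f U) (e : E' ≃ₜ E)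
    (he : AnalyticOnNhd ℂ e univ) :
    IsMeromorphic (f ∘ e) (e ⁻¹' U) := by
  intro x hx
  obtain ⟨V, hV, hxV, hVU, a, b, ha, hb, hd, hab⟩ := hf (e x) hx
  refine ⟨e ⁻¹' V, hV.preimage e.continuous, hxV, preimage_mono hVU, a ∘ e, b ∘ e,
    fun y hy => (ha _ hy).comp (he y trivial), fun y hy => (hb _ hy).comp (he y trivial), ?_,
    fun y hy h => hab _ hy h⟩
  intro y hy
  have := hd hy
  rw [← mem_preimage, e.preimage_closure] at this
  exact this

/-- An analytic function on a preconnected open set which is nonzero at one point is nonzero on a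
dense subset. -/
lemma _root_.AnalyticOnNhd.subset_closure_ne_zero {h : E → ℂ} {U : Set E} (hU : IsOpen U)
    (hUc : IsPreconnected U) (hh : AnalyticOnNhd ℂ h U) {x₀ : E} (hx₀ : x₀ ∈ U) (hne : h x₀ ≠ 0) :
    U ⊆ closure {y ∈ U | h y ≠ 0} := by
  intro x hx
  rw [mem_closure_iff]
  intro O hO hxO
  by_contra hcon
  have hz : h =ᶠ[𝓝 x] 0 := by
    filter_upwards [(hO.inter hU).mem_nhds ⟨hxO, hx⟩] with y hy
    by_contra hy0
    exact hcon ⟨y, hy.1, hy.2, hy0⟩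
  exact hne (hh.eqOn_zero_of_preconnected_of_eventuallyEq_zero hUc hx hz hx₀)

/-- The identity theorem for meromorphic functions of several variables. -/
lemma IsMeromorphic.meroEq_of_eqOn {f g : E → ℂ} {U : Set E} (hU : IsOpen U)
    (hUc : IsPreconnected U) (hf : IsMeromorphic f U) (hg : IsMeromorphic g U) {O : Set E}
    (hO : IsOpen O) (hOne : O.Nonempty) (hOU : O ⊆ U) (hfg : EqOn f g O) : MeroEq U f g := by
  have key : ∀ x ∈ U, ∃ V : Set E, IsOpen V ∧ x ∈ V ∧ V ⊆ U ∧
      ((∃ O' : Set E, IsOpen O' ∧ O'.Nonempty ∧ O' ⊆ V ∧ EqOn f g O') → MeroEq V f g) := by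
    intro x hx
    obtain ⟨V, hV, hxV, hVU, a, b, ha, hb, hd, hab⟩ := hf x hx
    obtain ⟨V', hV', hxV', hVU', a', b', ha', hb', hd', hab'⟩ := hg x hx
    obtain ⟨ε, hε, hB⟩ := Metric.isOpen_iff.1 (hV.inter hV') x ⟨hxV, hxV'⟩
    set B := Metric.ball x ε
    have hBo : IsOpen B := Metric.isOpen_ball
    refine ⟨B, hBo, Metric.mem_ball_self hε, (hB.trans inter_subset_left).trans hVU, ?_⟩
    rintro ⟨O', hO', ⟨y, hy⟩, hOB, he⟩
    have hBV : B ⊆ V := hB.trans inter_subset_left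
    have hBV' : B ⊆ V' := hB.trans inter_subset_right
    have hW : ∀ {V : Set E} {b : E → ℂ}, AnalyticOnNhd ℂ b V → IsOpen V → B ⊆ V →
        V ⊆ closure {y ∈ V | b y ≠ 0} → IsOpen {y ∈ B | b y ≠ 0} ∧
          B ⊆ closure {y ∈ B | b y ≠ 0} := by
      intro V b hb hV hBV hd
      refine ⟨(hb.continuousOn.mono hBV).isOpen_inter_preimage hBo isOpen_compl_singleton, ?_⟩
      intro z hz
      rw [mem_closure_iff]
      intro Q hQ hzQ
      obtain ⟨t, ht, ht'⟩ := mem_closure_iff.1 (hd (hBV hz)) (Q ∩ B) (hQ.inter hBo) ⟨hzQ, hz⟩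
      exact ⟨t, ht.1, ht.2, ht'.2⟩
    obtain ⟨o1, d1⟩ := hW hb hV hBV hd
    obtain ⟨o2, d2⟩ := hW hb' hV' hBV' hd'
    have d12 := subset_closure_inter_of_dense o2 d1 d2 (sep_subset B _)
    have hcross : EqOn (fun z => a z * b' z) (fun z => a' z * b z) B := by
      obtain ⟨y', hy', hyW⟩ := mem_closure_iff.1 (d12 (hOB hy)) O' hO' hy
      refine AnalyticOnNhd.eqOn_of_preconnected_of_eventuallyEq
        ((ha.mono hBV).mul (hb'.mono hBV')) ((ha'.mono hBV').mul (hb.mono hBV))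
        (convex_ball x ε).isPreconnected (hOB hy') ?_
      filter_upwards [(hO'.inter (o1.inter o2)).mem_nhds ⟨hy', hyW⟩] with z hz
      have e1 := hab z (hBV hz.2.1.1) hz.2.1.2
      have e2 := hab' z (hBV' hz.2.2.1) hz.2.2.2
      have e3 := he hz.1
      rw [e1, e2, div_eq_div_iff hz.2.1.2 hz.2.2.2] at e3
      exact e3
    refine ⟨_, o1.inter o2, inter_subset_left.trans (sep_subset B _), d12, fun z hz => ?_⟩
    rw [hab z (hBV hz.1.1) hz.1.2, hab' z (hBV' hz.2.1) hz.2.2, div_eq_div_iff hz.1.2 hz.2.2]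
    exact hcross hz.1.1
  set S := {x ∈ U | ∃ V : Set E, IsOpen V ∧ x ∈ V ∧ MeroEq V f g} with hS
  have hSo : IsOpen S := by
    rw [isOpen_iff_mem_nhds]
    rintro x ⟨hx, V, hV, hxV, hm⟩
    filter_upwards [(hU.inter hV).mem_nhds ⟨hx, hxV⟩] with y hy
    exact ⟨hy.1, V, hV, hy.2, hm⟩
  have hSU : U ⊆ S := by
    refine hUc.subset_of_closure_inter_subset hSo ?_ ?_
    · obtain ⟨y, hy⟩ := hOne
      exact ⟨y, hOU hy, hOU hy, O, hO, hy, O, hO, subset_rfl, subset_closure, hfg⟩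
    · rintro x ⟨hxc, hx⟩
      obtain ⟨V, hV, hxV, hVU, hk⟩ := key x hx
      obtain ⟨y, hyV, hyU, V', hV', hyV', W, hW, hWV, hVW, he⟩ := mem_closure_iff.1 hxc V hV hxV
      refine ⟨hx, V, hV, hxV, hk ⟨W ∩ V, hW.inter hV, ?_, inter_subset_right,
        fun z hz => he hz.1⟩⟩
      obtain ⟨z, hz, hzW⟩ := mem_closure_iff.1 (hVW hyV') V hV hyV
      exact ⟨z, hzW, hz⟩
  exact MeroEq.of_local hU fun x hx => (hSU hx).2

/-- A function which near every point agrees generically with an analytic function agrees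
generically with a globally analytic function. -/
lemma exists_analyticOnNhd_meroEq {U : Set E} (hU : IsOpen U) {f : E → ℂ}
    (h : ∀ x ∈ U, ∃ V : Set E, ∃ g : E → ℂ, IsOpen V ∧ x ∈ V ∧ AnalyticOnNhd ℂ g V ∧
      MeroEq V f g) : ∃ G : E → ℂ, AnalyticOnNhd ℂ G U ∧ MeroEq U f G := by
  classical
  choose! V g hV hxV hg hm using h
  have hG : ∀ x ∈ U, EqOn (fun y => g y y) (g x) (V x ∩ U) := by
    intro x hx y hy
    have h1 := (hm x hx).mono ((hV x hx).inter (hV y hy.2)) inter_subset_left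
    have h2 := (hm y hy.2).mono ((hV x hx).inter (hV y hy.2)) inter_subset_right
    exact (h2.symm.trans h1).eqOn_of_continuousOn
      ((hg y hy.2).continuousOn.mono inter_subset_right)
      ((hg x hx).continuousOn.mono inter_subset_left) ⟨hy.1, hxV y hy.2⟩
  refine ⟨fun y => g y y, fun x hx => ?_, MeroEq.of_local hU fun x hx =>
    ⟨V x ∩ U, (hV x hx).inter hU, ⟨hxV x hx, hx⟩, ?_⟩⟩
  · refine (hg x hx x (hxV x hx)).congr ?_
    filter_upwards [((hV x hx).inter hU).mem_nhds ⟨hxV x hx, hx⟩] with y hy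
    exact (hG x hx hy).symm
  · exact ((hm x hx).mono ((hV x hx).inter hU) inter_subset_left).map fun y hy e =>
      e.trans (hG x hx hy).symm

end Mero

/-! ### Uniqueness of the harmonic decomposition -/

/-- The polynomial `z²`. -/
def sqPoly (D : ℕ) : MvPolynomial (Fin D) ℂ := ∑ α, MvPolynomial.X α ^ 2

lemma eval_sqPoly {D : ℕ} (z : Fin D → ℂ) : MvPolynomial.eval z (sqPoly D) = sq z := by
  simp [sqPoly, sq, dot, pow_two]

lemma sqPoly_isHomogeneous (D : ℕ) : (sqPoly D).IsHomogeneous 2 :=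
  MvPolynomial.IsHomogeneous.sum _ _ _ fun α _ => by
    simpa using (MvPolynomial.isHomogeneous_X ℂ α).pow 2

lemma laplacian_apply (D : ℕ) (f : MvPolynomial (Fin D) ℂ) :
    laplacian D f = ∑ α, MvPolynomial.pderiv α (MvPolynomial.pderiv α f) := by
  simp [laplacian]

lemma pderiv_sqPoly (D : ℕ) (α : Fin D) :
    MvPolynomial.pderiv α (sqPoly D) = 2 * MvPolynomial.X α := by
  simp only [sqPoly, map_sum, MvPolynomial.pderiv_pow, MvPolynomial.pderiv_X]
  rw [Finset.sum_eq_single α]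
  · simp
  · intro b _ hb
    simp [hb.symm]
  · simp

lemma laplacian_sqPoly_mul {D m : ℕ} {f : MvPolynomial (Fin D) ℂ} (hf : f.IsHomogeneous m) :
    laplacian D (sqPoly D * f) = (2 * D + 4 * m : ℂ) • f + sqPoly D * laplacian D f := by
  have hE := hf.sum_X_mul_pderiv
  have h : ∀ α, MvPolynomial.pderiv α (MvPolynomial.pderiv α (sqPoly D * f)) =
      2 * f + 4 * (MvPolynomial.X α * MvPolynomial.pderiv α f)
        + sqPoly D * MvPolynomial.pderiv α (MvPolynomial.pderiv α f) := by
    intro α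
    have h2 : MvPolynomial.pderiv α (2 : MvPolynomial (Fin D) ℂ) = 0 := by
      simpa using (MvPolynomial.pderiv α).map_natCast 2
    simp only [MvPolynomial.pderiv_mul, map_add, pderiv_sqPoly, h2, MvPolynomial.pderiv_X_self]
    ring
  rw [laplacian_apply, laplacian_apply]
  simp only [h, Finset.sum_add_distrib, ← Finset.mul_sum, hE]
  simp only [Finset.sum_const, Finset.card_univ, Fintype.card_fin, nsmul_eq_mul, add_smul,
    MvPolynomial.smul_eq_C_mul, map_mul, map_natCast, map_ofNat]
  ring

lemma laplacian_sqPoly_pow_mul {D m : ℕ} {h : MvPolynomial (Fin D) ℂ} (hh : h ∈ harmonic D m)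
    (n : ℕ) : laplacian D (sqPoly D ^ (n + 1) * h) =
      (2 * (n + 1) * (2 * n + 2 * m + D) : ℂ) • (sqPoly D ^ n * h) := by
  have h1 : h.IsHomogeneous m := hh.1
  have h2 : laplacian D h = 0 := hh.2
  induction n with
  | zero =>
    rw [zero_add, pow_one, laplacian_sqPoly_mul h1, h2]
    simp only [mul_zero, add_zero, pow_zero, one_mul]
    congr 1
    push_cast
    ring
  | succ n ih =>
    have h3 : (sqPoly D ^ (n + 1) * h).IsHomogeneous (2 * (n + 1) + m) :=
      ((sqPoly_isHomogeneous D).pow (n + 1)).mul h1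
    rw [pow_succ' (sqPoly D) (n + 1), mul_assoc, laplacian_sqPoly_mul h3, ih, mul_smul_comm,
      ← mul_assoc, ← pow_succ', ← add_smul]
    congr 1
    push_cast
    ring

/-- Uniqueness of the decomposition of a polynomial into terms `(z²)ⁿ hₙ(z)`, `hₙ` harmonic: the
Laplace operator multiplies `(z²)ⁿ hₙ` by `2n (2n + 2 deg hₙ + D - 2) / z²`, which is nonzero for
`n ≥ 1`. -/
lemma harmonic_unique {D : ℕ} [NeZero D] (N : ℕ) (h : ℕ → MvPolynomial (Fin D) ℂ) (m : ℕ → ℕ)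
    (hh : ∀ n < N, h n ∈ harmonic D (m n))
    (h0 : ∑ n ∈ Finset.range N, sqPoly D ^ n * h n = 0) : ∀ n < N, h n = 0 := by
  induction N generalizing h m with
  | zero => simp
  | succ N ih =>
    have hs : ∀ n < N, h (n + 1) = 0 := by
      have hc : ∀ n : ℕ, (2 * (n + 1) * (2 * n + 2 * m (n + 1) + D) : ℂ) ≠ 0 := by
        intro n
        have := NeZero.pos D
        exact_mod_cast (by positivity : 2 * (n + 1) * (2 * n + 2 * m (n + 1) + D) ≠ 0)
      have hsm := ih (fun n => (2 * (n + 1) * (2 * n + 2 * m (n + 1) + D) : ℂ) • h (n + 1))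
        (fun n => m (n + 1)) (fun n hn => Submodule.smul_mem _ _ (hh _ (by omega))) (by
          have h1 := congrArg (laplacian D) h0
          rw [Finset.sum_range_succ', map_add, map_sum, map_zero, pow_zero, one_mul,
            show laplacian D (h 0) = 0 from (hh 0 (by omega)).2, add_zero] at h1
          rw [← h1]
          refine Finset.sum_congr rfl fun n hn => ?_
          rw [laplacian_sqPoly_pow_mul (hh _ (by simpa using hn)), mul_smul_comm])
      exact fun n hn => (smul_eq_zero.1 (hsm n hn)).resolve_left (hc n)
    intro n hn
    rcases n with _ | n
    · rw [Finset.sum_range_succ', Finset.sum_eq_zero] at h0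
      · simpa using h0
      · intro n hn
        rw [hs n (by simpa using hn), mul_zero]
    · exact hs n (by omega)

lemma operatorHarmonic.exists_eval {D m : ℕ} {V : Type*} [AddCommGroup V] [Module ℂ V]
    {f : (Fin D → ℂ) → Module.End ℂ V} (hf : f ∈ operatorHarmonic D m V)
    (φ : Module.End ℂ V →ₗ[ℂ] ℂ) : ∃ h ∈ harmonic D m, ∀ z, φ (f z) = MvPolynomial.eval z h := by
  induction hf using Submodule.span_induction with
  | mem x hx =>
    obtain ⟨h, hh, a, rfl⟩ := hx
    exact ⟨φ a • h, Submodule.smul_mem _ _ hh, fun z => by simp [mul_comm]⟩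
  | zero => exact ⟨0, Submodule.zero_mem _, fun z => by simp⟩
  | add x y _ _ hx hy =>
    obtain ⟨h, hh, hx⟩ := hx
    obtain ⟨h', hh', hy⟩ := hy
    exact ⟨h + h', Submodule.add_mem _ hh hh', fun z => by simp [hx, hy]⟩
  | smul c x _ hx =>
    obtain ⟨h, hh, hx⟩ := hx
    exact ⟨c • h, Submodule.smul_mem _ _ hh, fun z => by simp [hx]⟩

lemma operatorHarmonic.smul_apply {D m : ℕ} {V : Type*} [AddCommGroup V] [Module ℂ V]
    {f : (Fin D → ℂ) → Module.End ℂ V} (hf : f ∈ operatorHarmonic D m V) (t : ℂ)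
    (z : Fin D → ℂ) : f (t • z) = t ^ m • f z := by
  induction hf using Submodule.span_induction with
  | mem x hx =>
    obtain ⟨h, hh, a, rfl⟩ := hx
    have h1 : MvPolynomial.eval (t • z) h = t ^ m * MvPolynomial.eval z h := by
      rw [MvPolynomial.eval_eq, MvPolynomial.eval_eq, Finset.mul_sum]
      refine Finset.sum_congr rfl fun d hd => ?_
      have hdeg : d.degree = m := by
        have := (show h.IsHomogeneous m from hh.1) (MvPolynomial.mem_support_iff.1 hd)
        rw [Finsupp.degree_eq_weight_one (R := ℕ)]
        exact this
      simp only [Pi.smul_apply, smul_eq_mul, mul_pow, Finset.prod_mul_distrib,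
        Finset.prod_pow_eq_pow_sum]
      rw [show ∑ i ∈ d.support, d i = m from hdeg]
      ring
    simp [h1, mul_smul]
  | zero => simp
  | add x y _ _ hx hy => simp [hx, hy]
  | smul c x _ hx => simp [hx, smul_comm c]

lemma operatorHarmonic.differentiable {D m : ℕ} {V : Type*} [NormedAddCommGroup V]
    [NormedSpace ℂ V] {f : (Fin D → ℂ) → Module.End ℂ V} (hf : f ∈ operatorHarmonic D m V)
    (Ψ : V) : Differentiable ℂ fun z => f z Ψ := by
  induction hf using Submodule.span_induction with
  | mem x hx =>
    obtain ⟨h, hh, a, rfl⟩ := hx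
    have h1 : Differentiable ℂ fun z : Fin D → ℂ => MvPolynomial.eval z h := by
      simp only [MvPolynomial.eval_eq]
      fun_prop
    simpa using h1.smul_const (a Ψ)
  | zero => simp
  | add x y _ _ hx hy => exact hx.add hy
  | smul c x _ hx => exact hx.const_smul c

/-! ### Homogeneous components of a field -/

section Comp

variable {D : ℕ} {V : Type*} [AddCommGroup V] [Module ℂ V]

lemma comp_eq_sum {φ : ℤ → ℕ → (Fin D → ℂ) → Module.End ℂ V} {z : Fin D → ℂ} {Ψ : V} {N : ℤ}
    (hN : ∀ n ≤ -N, ∀ m, φ n m z Ψ = 0) (k : ℤ) :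
    comp φ k z Ψ =
      ∑ n ∈ Finset.Icc (-N) (k / 2), sq z ^ n • φ n (k - 2 * n).toNat z Ψ := by
  have h1 : comp φ k z Ψ = ∑ᶠ p ∈ {p : ℤ × ℕ | 2 * p.1 + (p.2 : ℤ) = k},
      sq z ^ p.1 • φ p.1 p.2 z Ψ :=
    finsum_set_coe_eq_finsum_mem (f := fun p : ℤ × ℕ => sq z ^ p.1 • φ p.1 p.2 z Ψ)
      {p : ℤ × ℕ | 2 * p.1 + (p.2 : ℤ) = k}
  have h2 : {p : ℤ × ℕ | 2 * p.1 + (p.2 : ℤ) = k} =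
      (fun n : ℤ => (n, (k - 2 * n).toNat)) '' {n | 2 * n ≤ k} := by
    ext ⟨n, m⟩
    simp only [mem_ofPred_eq, mem_image, Prod.mk.injEq]
    constructor
    · intro h
      exact ⟨n, by omega, rfl, by omega⟩
    · rintro ⟨n', h, rfl, rfl⟩
      omega
  rw [h1, h2, finsum_mem_image fun a _ b _ h => congrArg Prod.fst h]
  refine finsum_mem_eq_sum_of_inter_support_eq _ ?_
  ext n
  simp only [mem_inter_iff, mem_ofPred_eq, Function.mem_support, Finset.coe_Icc, mem_Icc]
  constructor
  · rintro ⟨h, h'⟩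
    refine ⟨⟨?_, by omega⟩, h'⟩
    by_contra hn
    exact h' (by rw [hN n (by omega), smul_zero])
  · rintro ⟨h, h'⟩
    exact ⟨by omega, h'⟩

lemma comp_eq_zero_of_lt {φ : ℤ → ℕ → (Fin D → ℂ) → Module.End ℂ V} {z : Fin D → ℂ} {Ψ : V}
    {N : ℤ} (hN : ∀ n ≤ -N, ∀ m, φ n m z Ψ = 0) {k : ℤ} (hk : k < -2 * N) : comp φ k z Ψ = 0 := by
  rw [comp_eq_sum hN, Finset.Icc_eq_empty (by omega), Finset.sum_empty]

lemma sqPoly_ne_zero (D : ℕ) [NeZero D] : sqPoly D ≠ 0 := by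
  intro h
  have h1 := eval_sqPoly (Pi.single (⟨0, NeZero.pos D⟩ : Fin D) (1 : ℂ))
  rw [h, map_zero] at h1
  simp [sq, dot, Pi.single_apply] at h1

/-- A linear functional that kills the component of degree `k` of a field at all points kills the
modes which contribute to it. -/
lemma functional_mode_eq_zero [NeZero D] {φ : ℤ → ℕ → (Fin D → ℂ) → Module.End ℂ V}
    (hφ : ∀ n m, φ n m ∈ operatorHarmonic D m V) {Ψ : V} {N : ℕ}
    (hN : ∀ n ≤ -(N : ℤ), ∀ m z, φ n m z Ψ = 0) (ℓ : V →ₗ[ℂ] ℂ) (k : ℤ)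
    (h0 : ∀ z, sq z ≠ 0 → ℓ (comp φ k z Ψ) = 0) (n : ℤ) (m : ℕ) (hk : 2 * n + m = k)
    (z : Fin D → ℂ) : ℓ (φ n m z Ψ) = 0 := by
  have hex : ∀ n m, ∃ h ∈ harmonic D m, ∀ z, ℓ (φ n m z Ψ) = MvPolynomial.eval z h := fun n m =>
    operatorHarmonic.exists_eval (hφ n m) (ℓ ∘ₗ LinearMap.applyₗ Ψ)
  choose h hh hval using hex
  rcases le_or_gt n (-(N : ℤ)) with hn | hn
  · rw [hN n hn, map_zero]
  set K : ℕ := (k / 2 + N).toNat + 1 with hK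
  set g : ℕ → MvPolynomial (Fin D) ℂ := fun i =>
    if 2 * ((i : ℤ) - N) ≤ k then h (i - N) (k - 2 * (i - N)).toNat else 0 with hg
  have hcomp : ∀ z, sq z ≠ 0 →
      MvPolynomial.eval z (∑ i ∈ Finset.range K, sqPoly D ^ i * g i) = 0 := by
    intro z hz
    have h1 := h0 z hz
    rw [comp_eq_sum (N := N) (fun n hn m => hN n hn m z), map_sum] at h1
    rw [map_sum]
    have h2 : ∑ i ∈ Finset.range K, MvPolynomial.eval z (sqPoly D ^ i * g i) =
        sq z ^ N * ∑ n ∈ Finset.Icc (-(N : ℤ)) (k / 2),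
          ℓ (sq z ^ n • φ n (k - 2 * n).toNat z Ψ) := by
      rw [Finset.mul_sum]
      symm
      refine Finset.sum_bij_ne_zero (fun n _ _ => (n + N).toNat) ?_ ?_ ?_ ?_
      · intro n hn _
        simp only [Finset.mem_Icc] at hn
        simp only [Finset.mem_range]
        omega
      · intro a ha _ b hb _ hab
        simp only [Finset.mem_Icc] at ha hb
        omega
      · intro i hi hne
        have hi' : 2 * ((i : ℤ) - N) ≤ k := by
          by_contra hcon
          exact hne (by simp [hg, hcon])
        refine ⟨i - N, by simp only [Finset.mem_Icc]; omega, ?_, by simp⟩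
        intro hz0
        apply hne
        rw [map_mul, map_pow, eval_sqPoly]
        simp only [hg, hi', if_true]
        rw [← hval]
        have := (mul_eq_zero.1 hz0).resolve_left (pow_ne_zero _ hz)
        rw [map_smul, smul_eq_mul] at this
        rw [(mul_eq_zero.1 this).resolve_left (zpow_ne_zero _ hz), mul_zero]
      · intro n hn _
        simp only [Finset.mem_Icc] at hn
        have e1 : (((n + N).toNat : ℕ) : ℤ) = n + N := by omega
        rw [map_mul, map_pow, eval_sqPoly]
        simp only [hg, e1, add_sub_cancel_right]
        rw [if_pos (by omega), ← hval, map_smul, smul_eq_mul, ← mul_assoc]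
        congr 1
        rw [← zpow_natCast, ← zpow_natCast, ← zpow_add₀ hz, e1, add_comm]
    rw [h2, h1, mul_zero]
  have hpoly : ∑ i ∈ Finset.range K, sqPoly D ^ i * g i = 0 := by
    have h3 : sqPoly D * ∑ i ∈ Finset.range K, sqPoly D ^ i * g i = 0 := by
      refine MvPolynomial.funext fun z => ?_
      rw [map_mul, map_zero, eval_sqPoly]
      by_cases hz : sq z = 0
      · rw [hz, zero_mul]
      · rw [hcomp z hz, mul_zero]
    exact (mul_eq_zero.1 h3).resolve_left (sqPoly_ne_zero D)
  have hu := harmonic_unique K g (fun i => (k - 2 * ((i : ℤ) - N)).toNat) (fun i _ => by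
    simp only [hg]
    split_ifs
    · exact hh _ _
    · exact Submodule.zero_mem _) hpoly (n + N).toNat (by omega)
  have e1 : (((n + N).toNat : ℕ) : ℤ) = n + N := by omega
  simp only [hg, e1, add_sub_cancel_right] at hu
  rw [if_pos (by omega), show (k - 2 * n).toNat = m by omega] at hu
  rw [hval, hu, map_zero]

/-- Two-variable series whose powers of the second variable are bounded below are not killed by
`(z - w)²`. -/
lemma eq_zero_of_mulInterval_iterate {z w : Fin D → ℂ} (hz : sq z ≠ 0) (X : ℤ → ℤ → V) (K : ℤ)
    (hX : ∀ k, ∀ l < K, X k l = 0) (M : ℕ) (h : (mulInterval z w)^[M] X = 0) : X = 0 := by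
  induction M generalizing X with
  | zero => exact h
  | succ M ih =>
    have h1 : mulInterval z w X = 0 := by
      refine ih _ (fun k l hl => ?_) h
      simp only [mulInterval, hX _ _ hl, hX _ _ (show l - 1 < K by omega),
        hX _ _ (show l - 2 < K by omega), smul_zero, sub_self, add_zero]
    have h2 : ∀ j : ℕ, ∀ k, ∀ l < K + j, X k l = 0 := by
      intro j
      induction j with
      | zero => simpa using hX
      | succ j ihj =>
        intro k l hl
        have h3 := congrFun (congrFun h1 (k + 2)) l
        simp only [mulInterval, Pi.zero_apply, ihj _ (l - 1) (by push_cast at hl; omega),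
          ihj _ (l - 2) (by push_cast at hl; omega), smul_zero, sub_zero, add_zero,
          add_sub_cancel_right] at h3
        exact (smul_eq_zero.1 h3).resolve_left hz
    funext k l
    exact h2 (l - K + 1).toNat k l (by omega)

lemma sq_smul (t : ℂ) (z : Fin D → ℂ) : sq (t • z) = t ^ 2 * sq z := by
  simp only [sq, dot, Pi.smul_apply, smul_eq_mul, Finset.mul_sum]
  exact Finset.sum_congr rfl fun _ _ => by ring

lemma sq_toC (u : USphere D) : sq (toC u) = 1 := by
  have h : ‖(u : EuclideanSpace ℝ (Fin D))‖ = 1 := by simp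
  rw [EuclideanSpace.norm_eq, Real.sqrt_eq_one] at h
  simp only [Real.norm_eq_abs, sq_abs] at h
  simp only [sq, dot, toC, ← pow_two]
  exact_mod_cast h

end Comp

section Fields

variable {D : ℕ} [NeZero D] {𝓗 : Type*} [NormedAddCommGroup 𝓗] [InnerProductSpace ℂ 𝓗]
  {I : Type*} [Fintype I] [DecidableEq I] (Q : Theory D 𝓗 I)

/-- The component of degree `k` of the field `φ_A` at `z`, as an operator on the domain. -/
def Theory.field (A : I) (k : ℤ) (z : Fin D → ℂ) : Module.End ℂ Q.dom where
  toFun := comp (Q.mode A) k z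
  map_add' Ψ Φ := by
    obtain ⟨N₁, h₁⟩ := Q.mode_bounded A Ψ
    obtain ⟨N₂, h₂⟩ := Q.mode_bounded A Φ
    have h₁' : ∀ n ≤ -((max N₁ N₂ : ℕ) : ℤ), ∀ m, Q.mode A n m z Ψ = 0 := fun n hn m =>
      h₁ n (by omega) m z
    have h₂' : ∀ n ≤ -((max N₁ N₂ : ℕ) : ℤ), ∀ m, Q.mode A n m z Φ = 0 := fun n hn m =>
      h₂ n (by omega) m z
    rw [comp_eq_sum h₁', comp_eq_sum h₂', comp_eq_sum (N := ((max N₁ N₂ : ℕ) : ℤ))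
      (fun n hn m => by rw [map_add, h₁' n hn, h₂' n hn, add_zero]), ← Finset.sum_add_distrib]
    simp only [map_add, smul_add]
  map_smul' c Ψ := by
    obtain ⟨N, h⟩ := Q.mode_bounded A Ψ
    have h' : ∀ n ≤ -(N : ℤ), ∀ m, Q.mode A n m z Ψ = 0 := fun n hn m => h n hn m z
    rw [comp_eq_sum h', comp_eq_sum (N := N) (fun n hn m => by rw [map_smul, h' n hn, smul_zero]),
      RingHom.id_apply, Finset.smul_sum]
    simp only [map_smul, smul_comm c]

lemma Theory.field_apply (A : I) (k : ℤ) (z : Fin D → ℂ) (Ψ : Q.dom) :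
    Q.field A k z Ψ = comp (Q.mode A) k z Ψ := rfl

lemma Theory.exists_field_eq_zero (A : I) (Ψ : Q.dom) :
    ∃ K : ℤ, ∀ k < K, ∀ z, Q.field A k z Ψ = 0 := by
  obtain ⟨N, h⟩ := Q.mode_bounded A Ψ
  exact ⟨-2 * N, fun k hk z => comp_eq_zero_of_lt (fun n hn m => h n hn m z) hk⟩

lemma Theory.field_smul (A : I) (k : ℤ) {t : ℂ} (ht : t ≠ 0) (z : Fin D → ℂ) :
    Q.field A k (t • z) = t ^ k • Q.field A k z := by
  ext1 Ψ
  obtain ⟨N, h⟩ := Q.mode_bounded A Ψ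
  rw [LinearMap.smul_apply, Q.field_apply, Q.field_apply,
    comp_eq_sum (N := N) (fun n hn m => h n hn m _), comp_eq_sum (N := N) (fun n hn m => h n hn m _),
    Finset.smul_sum]
  refine Finset.sum_congr rfl fun n hn => ?_
  rw [(operatorHarmonic.smul_apply (Q.mode_harmonic A _ _) t z), sq_smul, mul_zpow,
    LinearMap.smul_apply, smul_smul, smul_smul]
  congr 1
  rw [Finset.mem_Icc] at hn
  have e : (2 : ℤ) * n + ((k - 2 * n).toNat : ℤ) = k := by omega
  calc (t ^ 2) ^ n * sq z ^ n * t ^ (k - 2 * n).toNat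
      = (t ^ (2 * n) * t ^ (((k - 2 * n).toNat : ℕ) : ℤ)) * sq z ^ n := by
        rw [zpow_mul, zpow_natCast]
        norm_cast
        ring
    _ = _ := by rw [← zpow_add₀ ht, e]

lemma Theory.comm_H_field (A : I) (k : ℤ) (z : Fin D → ℂ) :
    ⁅Q.H, Q.field A k z⁆ = ((Q.dim A : ℂ) + k) • Q.field A k z := by
  ext1 Ψ
  obtain ⟨N, h⟩ := Q.mode_bounded A Ψ
  obtain ⟨N', h'⟩ := Q.mode_bounded A (Q.H Ψ)
  have h₁ : ∀ n ≤ -((max N N' : ℕ) : ℤ), ∀ m, Q.mode A n m z Ψ = 0 := fun n hn m =>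
    h n (by omega) m z
  have h₂ : ∀ n ≤ -((max N N' : ℕ) : ℤ), ∀ m, Q.mode A n m z (Q.H Ψ) = 0 := fun n hn m =>
    h' n (by omega) m z
  rw [Ring.lie_def, LinearMap.sub_apply, Module.End.mul_apply, Module.End.mul_apply,
    LinearMap.smul_apply, Q.field_apply, Q.field_apply, comp_eq_sum h₁, comp_eq_sum h₂, map_sum,
    ← Finset.sum_sub_distrib, Finset.smul_sum]
  refine Finset.sum_congr rfl fun n hn => ?_
  rw [Finset.mem_Icc] at hn
  have e : (2 : ℤ) * n + ((k - 2 * n).toNat : ℤ) = k := by omega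
  have h3 := LinearMap.congr_fun (Q.cov_H A n (k - 2 * n).toNat z) Ψ
  rw [Ring.lie_def, LinearMap.sub_apply, Module.End.mul_apply, Module.End.mul_apply,
    LinearMap.smul_apply] at h3
  rw [map_smul, ← smul_sub, h3, smul_comm]
  have e' : (2 : ℂ) * n + ((k - 2 * n).toNat : ℂ) = k := by exact_mod_cast e
  rw [add_assoc, e']

lemma Theory.differentiableAt_field (A : I) (k : ℤ) {z : Fin D → ℂ} (hz : sq z ≠ 0) (Ψ : Q.dom) :
    DifferentiableAt ℂ (fun z => Q.field A k z Ψ) z := by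
  obtain ⟨N, h⟩ := Q.mode_bounded A Ψ
  have e : (fun z => Q.field A k z Ψ) = fun z => ∑ n ∈ Finset.Icc (-(N : ℤ)) (k / 2),
      sq z ^ n • Q.mode A n (k - 2 * n).toNat z Ψ := by
    funext z
    exact comp_eq_sum (N := N) (fun n hn m => h n hn m z) k
  rw [e]
  refine DifferentiableAt.fun_sum fun n _ => ?_
  refine DifferentiableAt.smul (DifferentiableAt.zpow ?_ (Or.inl hz))
    (operatorHarmonic.differentiable (Q.mode_harmonic A _ _) Ψ z)
  unfold sq dot
  fun_prop

/-- Strong locality in terms of the homogeneous components of the fields. -/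
lemma Theory.locality_field (A B : I) : ∃ M : ℕ, ∀ M' ≥ M, ∀ (z w : Fin D → ℂ) (Ψ : Q.dom),
    sq z ≠ 0 → sq w ≠ 0 → (mulInterval z w)^[M'] (fun k l =>
      Q.field A k z (Q.field B l w Ψ) - (-1 : ℂ) ^ ((Q.parity A : ℕ) * (Q.parity B : ℕ)) •
        Q.field B l w (Q.field A k z Ψ)) = 0 := by
  obtain ⟨M, -, hM⟩ := Q.locality A B
  refine ⟨M, fun M' hM' z w Ψ hz hw => ?_⟩
  obtain ⟨j, rfl⟩ := Nat.exists_eq_add_of_le hM'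
  rw [add_comm, Function.iterate_add_apply, show ((mulInterval z w)^[M] (fun k l =>
      Q.field A k z (Q.field B l w Ψ) - (-1 : ℂ) ^ ((Q.parity A : ℕ) * (Q.parity B : ℕ)) •
        Q.field B l w (Q.field A k z Ψ))) = 0 from hM z w Ψ hz hw]
  refine Function.iterate_fixed ?_ j
  funext k l
  simp [mulInterval]

/-- The vacuum is separating: a field that kills the vacuum vanishes. -/
lemma Theory.exists_field_vac_ne_zero (A : I) :
    ∃ k z, sq z ≠ 0 ∧ Q.field A k z Q.vac ≠ 0 := by
  by_contra! hcon
  have hmode : ∀ Ψ : Q.dom, (∀ k z, sq z ≠ 0 → Q.field A k z Ψ = 0) →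
      ∀ (B : I) n m w k z, sq z ≠ 0 → Q.field A k z (Q.mode B n m w Ψ) = 0 := by
    intro Ψ hΨ B n m w k z hz
    obtain ⟨M, hM⟩ := Q.locality_field A B
    obtain ⟨K, hK⟩ := Q.exists_field_eq_zero B Ψ
    have hX : ∀ w, sq w ≠ 0 → ∀ l, Q.field A k z (Q.field B l w Ψ) = 0 := by
      intro w hw l
      have h1 := hM M le_rfl z w Ψ hz hw
      have h2 := eq_zero_of_mulInterval_iterate hz _ K (fun k l hl => by
        simp [hK l hl w, hΨ k z hz]) M h1
      simpa [hΨ k z hz] using congrFun (congrFun h2 k) l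
    obtain ⟨N, hN⟩ := Q.mode_bounded B Ψ
    refine (Module.forall_dual_apply_eq_zero_iff ℂ _).1 fun ℓ => ?_
    exact functional_mode_eq_zero (φ := Q.mode B) (fun n m => Q.mode_harmonic B n m) hN
      (ℓ ∘ₗ Q.field A k z) (2 * n + m) (fun w hw => by
        have := hX w hw (2 * n + m)
        rw [Q.field_apply B] at this
        rw [LinearMap.comp_apply, this, map_zero]) n m rfl w
  have hall : ∀ (Ψ : Q.dom), ∀ k z, sq z ≠ 0 → Q.field A k z Ψ = 0 := by
    intro Ψ
    have hΨ : Ψ ∈ Submodule.span ℂ {Ψ : Q.dom | ∃ L : List (I × ℤ × ℕ × (Fin D → ℂ)),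
        Ψ = (L.map fun x => Q.mode x.1 x.2.1 x.2.2.1 x.2.2.2).prod Q.vac} := by
      rw [Q.complete]; trivial
    induction hΨ using Submodule.span_induction with
    | mem x hx =>
      obtain ⟨L, rfl⟩ := hx
      induction L with
      | nil => exact fun k z hz => hcon k z hz
      | cons a L ih => exact fun k z hz => hmode _ ih _ _ _ _ k z hz
    | zero => simp
    | add x y _ _ hx hy => exact fun k z hz => by rw [map_add, hx k z hz, hy k z hz, add_zero]
    | smul c x _ hx => exact fun k z hz => by rw [map_smul, hx k z hz, smul_zero]
  obtain ⟨n, m, z, hne⟩ := Q.mode_ne_zero A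
  apply hne
  ext1 Ψ
  obtain ⟨N, hN⟩ := Q.mode_bounded A Ψ
  refine (Module.forall_dual_apply_eq_zero_iff ℂ _).1 fun ℓ => ?_
  refine functional_mode_eq_zero (φ := Q.mode A) (fun n m => Q.mode_harmonic A n m) hN ℓ
    (2 * n + m) (fun w hw => ?_) n m rfl z
  have := hall Ψ (2 * n + m) w hw
  rw [Q.field_apply] at this
  rw [this, map_zero]

end Fields

/-! ### The spin–statistics relation -/

section Sequences

lemma fwdDiff_iterate_comp_intCast (f : ℂ → ℂ) (m : ℕ) :
    (fwdDiff (1 : ℤ))^[m] (fun l : ℤ => f l) = fun l : ℤ => (fwdDiff (1 : ℂ))^[m] f l := by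
  induction m generalizing f with
  | zero => rfl
  | succ m ih =>
    rw [Function.iterate_succ_apply, Function.iterate_succ_apply, ← ih]
    congr 1
    funext l
    simp [fwdDiff]

lemma eq_zero_of_fwdDiff_iterate {z : ℤ → ℂ} {m : ℕ} (h : (fwdDiff (1 : ℤ))^[m] z = 0)
    (hz : ∀ l : ℤ, 0 ≤ l → z l = 0) : z = 0 := by
  induction m generalizing z with
  | zero => exact h
  | succ m ih =>
    have h1 : fwdDiff (1 : ℤ) z = 0 := ih h fun l hl => by
      rw [fwdDiff, hz l hl, hz (l + 1) (by omega), sub_zero]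
    have h2 : ∀ j : ℕ, ∀ l : ℤ, -(j : ℤ) ≤ l → z l = 0 := by
      intro j
      induction j with
      | zero => simpa using hz
      | succ j ihj =>
        intro l hl
        have h3 := congrFun h1 l
        rw [fwdDiff, ihj (l + 1) (by push_cast at hl; omega), Pi.zero_apply, zero_sub,
          neg_eq_zero] at h3
        exact h3
    funext l
    exact h2 l.natAbs l (by omega)

/-- A polynomial sequence which satisfies the recursion of the binomial coefficients
`(d + l - 1 choose l)` is a multiple of `(l + 1) ⋯ (l + d - 1)`, hence has parity `d - 1` under
`l ↦ -d - l`. -/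
lemma apply_neg_of_recursion {y : ℤ → ℂ} {d m : ℕ} (hd : 0 < d)
    (hrec : ∀ l : ℤ, ((l : ℂ) + 1) * y (l + 1) = (d + l) * y l)
    (hy : (fwdDiff (1 : ℤ))^[m] y = 0) : y (-d) = -(-1) ^ d * y 0 := by
  obtain ⟨d, rfl⟩ : ∃ e, d = e + 1 := ⟨d - 1, by omega⟩
  set P : Polynomial ℂ := ∏ i ∈ Finset.range d, (Polynomial.X + Polynomial.C ((i : ℂ) + 1)) with hP
  have hPe : ∀ x : ℂ, P.eval x = ∏ i ∈ Finset.range d, (x + (i + 1)) := fun x => by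
    simp [hP, Polynomial.eval_prod]
  have hPrec : ∀ x : ℂ, (x + 1) * P.eval (x + 1) = (d + 1 + x) * P.eval x := by
    intro x
    have h1 := Finset.prod_range_succ' (fun i : ℕ => x + ((i : ℂ) + 1)) d
    have h2 := Finset.prod_range_succ (fun i : ℕ => x + ((i : ℂ) + 1)) d
    rw [h2] at h1
    rw [hPe, hPe]
    rw [show ∏ i ∈ Finset.range d, (x + 1 + ((i : ℂ) + 1)) =
      ∏ i ∈ Finset.range d, (x + (((i + 1 : ℕ) : ℂ) + 1)) from
      Finset.prod_congr rfl fun i _ => by push_cast; ring]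
    push_cast at h1 ⊢
    linear_combination -h1
  have hPdeg : P.natDegree ≤ d := by
    refine (Polynomial.natDegree_prod_le _ _).trans ?_
    refine (Finset.sum_le_card_nsmul _ _ 1 fun i _ => ?_).trans (by simp)
    exact (Polynomial.natDegree_X_add_C _).le
  have hP0 : P.eval 0 ≠ 0 := by
    rw [hPe]
    refine Finset.prod_ne_zero_iff.2 fun i _ => ?_
    rw [zero_add]
    exact_mod_cast i.succ_ne_zero
  have hPneg : P.eval (-(d + 1 : ℂ)) = (-1) ^ d * P.eval 0 := by
    rw [hPe, hPe]
    rw [← Finset.prod_range_reflect, Finset.prod_congr rfl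
      (g := fun i : ℕ => (-1) * (0 + ((i : ℂ) + 1))) fun i hi => by
        rw [Finset.mem_range] at hi
        rw [show d - 1 - i = d - (i + 1) by omega, Nat.cast_sub (by omega)]
        push_cast
        ring]
    rw [Finset.prod_mul_distrib]
    simp
  set z : ℤ → ℂ := fun l => P.eval 0 * y l - y 0 * P.eval (l : ℂ) with hz
  have hznn : ∀ j : ℕ, z j = 0 := by
    intro j
    induction j with
    | zero => simp only [hz]; push_cast; ring
    | succ j ih =>
      have h1 := hrec j
      have h2 := hPrec j
      simp only [hz] at ih ⊢
      push_cast at h1 h2 ih ⊢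
      have h3 : ((j : ℂ) + 1) ≠ 0 := by exact_mod_cast j.succ_ne_zero
      refine (mul_eq_zero.1 (?_ : ((j : ℂ) + 1) * _ = 0)).resolve_left h3
      linear_combination P.eval 0 * h1 - y 0 * h2 + (d + 1 + j) * ih
  have hz0 : z = 0 := by
    refine eq_zero_of_fwdDiff_iterate (m := max m (d + 1)) ?_ fun l hl => by
      lift l to ℕ using hl
      exact hznn l
    have e1 : (fwdDiff (1 : ℤ))^[max m (d + 1)] y = 0 := by
      obtain ⟨j, hj⟩ := Nat.exists_eq_add_of_le (le_max_left m (d + 1))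
      rw [hj, add_comm, Function.iterate_add_apply, hy]
      refine Function.iterate_fixed ?_ j
      funext l
      simp [fwdDiff]
    have e2 : (fwdDiff (1 : ℤ))^[max m (d + 1)] (fun l : ℤ => P.eval (l : ℂ)) = 0 := by
      rw [fwdDiff_iterate_comp_intCast (fun x => P.eval x)]
      have := Polynomial.fwdDiff_iter_eq_zero_of_degree_lt (P := P) (n := max m (d + 1))
        (lt_of_lt_of_le (Nat.lt_succ_of_le hPdeg) (le_max_right _ _))
      funext l
      exact congrFun this l
    have e3 : z = P.eval 0 • y + (-y 0) • (fun l : ℤ => P.eval (l : ℂ)) := by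
      funext l
      simp [hz]
      ring
    rw [e3, fwdDiff_iter_add, fwdDiff_iter_const_smul, fwdDiff_iter_const_smul, e1, e2]
    simp
  have h1 := congrFun hz0 (-((d + 1 : ℕ) : ℤ))
  simp only [hz, Pi.zero_apply] at h1
  push_cast at h1 ⊢
  rw [hPneg] at h1
  refine mul_left_cancel₀ hP0 ?_
  rw [pow_succ]
  linear_combination h1

end Sequences

section Interval

variable {D : ℕ} {V W : Type*} [AddCommGroup V] [Module ℂ V] [AddCommGroup W] [Module ℂ W]

lemma map_mulInterval_iterate (ℓ : V →ₗ[ℂ] W) (z w : Fin D → ℂ) (M : ℕ) (X : ℤ → ℤ → V) (k l : ℤ) :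
    ℓ ((mulInterval z w)^[M] X k l) = (mulInterval z w)^[M] (fun k l => ℓ (X k l)) k l := by
  induction M generalizing X with
  | zero => rfl
  | succ M ih =>
    rw [Function.iterate_succ_apply, Function.iterate_succ_apply, ih,
      show (fun k l => ℓ (mulInterval z w X k l)) = mulInterval z w (fun k l => ℓ (X k l)) from by
        funext k l
        simp [mulInterval]]

lemma mulInterval_iterate_sum {ι : Type*} (s : Finset ι) (c : ι → ℂ) (z w : Fin D → ℂ) (M : ℕ)
    (X : ι → ℤ → ℤ → V) : (mulInterval z w)^[M] (fun k l => ∑ i ∈ s, c i • X i k l) =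
      fun k l => ∑ i ∈ s, c i • (mulInterval z w)^[M] (X i) k l := by
  induction M generalizing X with
  | zero => rfl
  | succ M ih =>
    simp only [Function.iterate_succ_apply]
    rw [← ih]
    congr 1
    funext k l
    simp only [mulInterval, Finset.smul_sum, ← Finset.sum_sub_distrib, ← Finset.sum_add_distrib]
    refine Finset.sum_congr rfl fun i _ => ?_
    simp only [smul_add, smul_sub, smul_comm (c i)]

/-- On a line of fixed total degree, multiplication by `(x - y)²` is a second difference. -/
lemma mulInterval_iterate_diag {e : Fin D → ℂ} (he : sq e = 1) (M : ℕ) (X : ℤ → ℤ → ℂ) (c l : ℤ) :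
    (mulInterval e e)^[M] X (c + 2 * M - l) l =
      (fwdDiff (1 : ℤ))^[2 * M] (fun l => X (c - l) l) (l - 2 * M) := by
  induction M generalizing X c with
  | zero => simp
  | succ M ih =>
    rw [Function.iterate_succ_apply, show 2 * (M + 1) = 2 * M + 2 by ring,
      Function.iterate_add_apply,
      show c + 2 * ((M + 1 : ℕ) : ℤ) - l = (c + 2) + 2 * M - l by push_cast; ring, ih]
    have h1 : (fun l => mulInterval e e X (c + 2 - l) l) =
        fun l => (fwdDiff (1 : ℤ))^[2] (fun l => X (c - l) l) (l + (-2)) := by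
      funext l
      simp only [mulInterval, show dot e e = 1 from he, he, Function.iterate_succ_apply,
        Function.iterate_zero, id, fwdDiff, smul_eq_mul]
      ring_nf
    rw [h1, fwdDiff_iter_comp_add, show l - 2 * (M : ℤ) + -2 = l - 2 * ((M + 1 : ℕ) : ℤ) by
      push_cast; ring]

end Interval

section SpinStatistics

variable {D : ℕ} [NeZero D] {𝓗 : Type*} [NormedAddCommGroup 𝓗] [InnerProductSpace ℂ 𝓗]
  {I : Type*} [Fintype I] [DecidableEq I] (Q : Theory D 𝓗 I)

/-- The last coordinate direction. -/
def lastIdx (D : ℕ) [NeZero D] : Fin D := ⟨D - 1, Nat.sub_lt (NeZero.pos D) one_pos⟩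

lemma toC_lastVec : toC (lastVec D) = Pi.single (lastIdx D) 1 := by
  funext α
  simp only [toC, lastVec, lastIdx, Pi.single_apply, PiLp.single_apply]
  split_ifs <;> simp

lemma hasDerivAt_field_smul (A : I) (k : ℤ) (z : Fin D → ℂ) (Ψ : Q.dom) :
    HasDerivAt (fun t : ℂ => Q.field A k (z + t • z) Ψ) ((k : ℂ) • Q.field A k z Ψ) 0 := by
  have h1 : HasDerivAt (fun t : ℂ => (1 + t) ^ k) ((k : ℂ) * (1 + 0) ^ (k - 1) * 1) 0 :=
    (hasDerivAt_zpow k (1 + 0) (Or.inl (by simp))).comp 0 ((hasDerivAt_id (0 : ℂ)).const_add 1)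
  have h2 := h1.smul_const (Q.field A k z Ψ)
  simp only [add_zero, one_zpow, mul_one] at h2
  refine h2.congr_of_eventuallyEq ?_
  have h3 : ∀ᶠ t : ℂ in 𝓝 0, 1 + t ≠ 0 :=
    (by fun_prop : ContinuousAt (fun t : ℂ => 1 + t) 0).eventually_ne (by simp)
  filter_upwards [h3] with t ht
  rw [show z + t • z = (1 + t) • z by rw [add_smul, one_smul], Q.field_smul A k ht]
  rfl

lemma Theory.comm_T_field_last (A : I) (k : ℤ) (Ψ : Q.dom) :
    Q.T (lastIdx D) (Q.field A k (toC (lastVec D)) Ψ) -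
      Q.field A k (toC (lastVec D)) (Q.T (lastIdx D) Ψ) =
      ((k : ℂ) + 1) • Q.field A (k + 1) (toC (lastVec D)) Ψ := by
  have h1 := Q.cov_T A k (lastIdx D) (toC (lastVec D)) Ψ (by rw [sq_toC]; exact one_ne_zero)
  have h2 := hasDerivAt_field_smul Q A (k + 1) (toC (lastVec D)) Ψ
  rw [← toC_lastVec] at h1
  have := h1.unique h2
  push_cast at this
  exact this

/-- Below degree zero the field annihilates the vacuum, on the last coordinate axis. -/
lemma Theory.field_last_vac_eq_zero (A : I) (k : ℤ) (hk : k < 0) :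
    Q.field A k (toC (lastVec D)) Q.vac = 0 := by
  obtain ⟨K, hK⟩ := Q.exists_field_eq_zero A Q.vac
  have h : ∀ j : ℕ, ∀ k < K + j, k < 0 → Q.field A k (toC (lastVec D)) Q.vac = 0 := by
    intro j
    induction j with
    | zero => exact fun k hk _ => hK k (by simpa using hk) _
    | succ j ih =>
      intro k hk hk0
      have h1 := Q.comm_T_field_last A (k - 1) Q.vac
      rw [ih (k - 1) (by push_cast at hk; omega) (by omega), Q.vac_invariant.1, map_zero,
        map_zero, sub_zero, sub_add_cancel] at h1
      push_cast at h1
      rw [sub_add_cancel] at h1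
      exact (smul_eq_zero.1 h1.symm).resolve_left (by exact_mod_cast hk0.ne)
  exact h (k + 1 - K).toNat k (by omega) hk

/-- If a component of a field annihilates the vacuum, the next one, applied to the vacuum, has derivative zero. -/
lemma Theory.hasFDerivAt_field_vac (A : I) (k : ℤ)
    (h : ∀ z, sq z ≠ 0 → Q.field A k z Q.vac = 0) {z : Fin D → ℂ} (hz : sq z ≠ 0) :
    HasFDerivAt (fun z => Q.field A (k + 1) z Q.vac) (0 : (Fin D → ℂ) →L[ℂ] Q.dom) z := by
  have h1 := (Q.differentiableAt_field A (k + 1) hz Q.vac).hasFDerivAt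
  have h2 : fderiv ℂ (fun z => Q.field A (k + 1) z Q.vac) z = 0 := by
    ext1 v
    have hbase : ∀ α, fderiv ℂ (fun z => Q.field A (k + 1) z Q.vac) z (Pi.single α 1) = 0 := by
      intro α
      have h3 := Q.cov_T A k α z Q.vac hz
      have h3' : HasDerivAt (fun t : ℂ => Q.field A (k + 1) (z + t • Pi.single α 1) Q.vac)
          (0 : Q.dom) 0 := by
        rw [← Q.field_apply, ← Q.field_apply, h z hz, Q.vac_invariant.1, map_zero, map_zero,
          sub_zero] at h3
        exact h3
      have h4 : HasDerivAt (fun t : ℂ => z + t • (Pi.single α 1 : Fin D → ℂ)) (Pi.single α 1) 0 := by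
        simpa using ((hasDerivAt_id (0 : ℂ)).smul_const (Pi.single α 1 : Fin D → ℂ)).const_add z
      have h5 := HasFDerivAt.comp_hasDerivAt_of_eq (0 : ℂ) h1 h4 (by simp)
      exact h5.unique h3'
    rw [show v = ∑ α, v α • (Pi.single α 1 : Fin D → ℂ) by
      simpa using (pi_eq_sum_univ' v), map_sum]
    simp [hbase]
  rwa [h2] at h1

/-- The lowest component of a field takes the vacuum to a nonzero vector, on the last coordinate
axis. -/
lemma Theory.field_zero_last_vac_ne_zero (A : I) : Q.field A 0 (toC (lastVec D)) Q.vac ≠ 0 := by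
  intro h0
  have hstep : ∀ k, (∀ z, sq z ≠ 0 → Q.field A k z Q.vac = 0) →
      ∀ z, sq z ≠ 0 → Q.field A (k + 1) z Q.vac = 0 := by
    intro k hk z hz
    by_cases hk1 : k + 1 = 0
    · set e := toC (lastVec D) with he
      set v := z - e with hv
      set P : Polynomial ℂ := Polynomial.C (1 : ℂ) + Polynomial.C (2 * dot e v) * Polynomial.X +
        Polynomial.C (sq v) * Polynomial.X ^ 2 with hP
      have hPe : ∀ t, P.eval t = sq (e + t • v) := by
        intro t
        have h1 : sq (e + t • v) = sq e + 2 * dot e v * t + sq v * t ^ 2 := by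
          simp only [sq, dot, Pi.add_apply, Pi.smul_apply, smul_eq_mul, Finset.mul_sum,
            Finset.sum_mul, ← Finset.sum_add_distrib]
          exact Finset.sum_congr rfl fun _ _ => by ring
        rw [h1, he, sq_toC, ← he]
        simp [hP]
      have hP0 : P ≠ 0 := by
        intro h
        have := hPe 0
        rw [h, zero_smul, add_zero, he, sq_toC] at this
        simp at this
      have hfin : {t | P.IsRoot t}.Finite := Polynomial.finite_setOfPred_isRoot hP0
      have hconn : IsPreconnected ({t | P.IsRoot t}ᶜ) :=
        (hfin.countable.isConnected_compl_of_one_lt_rank (by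
          rw [Complex.rank_real_complex]; norm_num)).isPreconnected
      have hopen : IsOpen ({t | P.IsRoot t}ᶜ) := hfin.isClosed.isOpen_compl
      have hmem : ∀ t, t ∈ ({t | P.IsRoot t}ᶜ) ↔ sq (e + t • v) ≠ 0 := fun t => by
        rw [← hPe]; rfl
      have hderiv : ∀ t ∈ ({t | P.IsRoot t}ᶜ),
          HasDerivAt (fun t : ℂ => Q.field A (k + 1) (e + t • v) Q.vac) 0 t := by
        intro t ht
        have h4 : HasDerivAt (fun t : ℂ => e + t • v) v t := by
          simpa using ((hasDerivAt_id t).smul_const v).const_add e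
        exact (Q.hasFDerivAt_field_vac A k hk ((hmem t).1 ht)).comp_hasDerivAt t h4
      have h5 := hopen.is_const_of_deriv_eq_zero hconn
        (fun t ht => (hderiv t ht).differentiableAt.differentiableWithinAt)
        (fun t ht => (hderiv t ht).deriv)
        (show (1 : ℂ) ∈ _ by rw [hmem]; simpa [hv] using hz)
        (show (0 : ℂ) ∈ _ by rw [hmem, zero_smul, add_zero, he, sq_toC]; exact one_ne_zero)
      simp only [one_smul, zero_smul, add_zero, hv, add_sub_cancel] at h5
      rw [h5, hk1]
      exact h0
    · have h1 := hasDerivAt_field_smul Q A (k + 1) z Q.vac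
      have h4 : HasDerivAt (fun t : ℂ => z + t • z) z 0 := by
        simpa using ((hasDerivAt_id (0 : ℂ)).smul_const z).const_add z
      have h5 := HasFDerivAt.comp_hasDerivAt_of_eq (0 : ℂ)
        (Q.hasFDerivAt_field_vac A k hk hz) h4 (by simp)
      have h6 := h1.unique h5
      exact (smul_eq_zero.1 h6).resolve_left (by exact_mod_cast hk1)
  obtain ⟨K, hK⟩ := Q.exists_field_eq_zero A Q.vac
  have hall : ∀ j : ℕ, ∀ k < K + j, ∀ z, sq z ≠ 0 → Q.field A k z Q.vac = 0 := by
    intro j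
    induction j with
    | zero => exact fun k hk z _ => hK k (by simpa using hk) z
    | succ j ih =>
      intro k hk
      have := hstep (k - 1) (ih (k - 1) (by push_cast at hk; omega))
      rwa [sub_add_cancel] at this
  obtain ⟨k, z, hz, hne⟩ := Q.exists_field_vac_ne_zero A
  exact hne (hall (k + 1 - K).toNat k (by omega) z hz)

/-- The dimensions are half-integers, because the square of `-1 ∈ Spin(D)` acts trivially. -/
lemma Theory.exists_two_mul_dim (A : I) : ∃ d : ℕ, 0 < d ∧ 2 * Q.dim A = d := by
  have hneg : (-1 : CliffordAlgebra (euclForm D)) ∈ spinGroup (euclForm D) := by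
    have h1 := ι_mul_mem (lastVec D) (-lastVec D)
    have h2 := ι_sq (lastVec D)
    have h3 : ((-lastVec D : USphere D) : EuclideanSpace ℝ (Fin D)) = -(lastVec D : _) := rfl
    rw [h3, map_neg, mul_neg, h2] at h1
    exact h1
  set s : Spin D := ⟨-1, hneg⟩ with hs
  have hss : s * s = 1 := by
    apply Subtype.ext
    simp [hs]
  have h1 := Q.rep_neg_one s rfl
  have h2 : Q.rep s * Q.rep s = 1 := by rw [← map_mul, hss, map_one]
  rw [h1, Matrix.diagonal_mul_diagonal] at h2
  have h3 := congrFun (congrFun h2 A) A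
  rw [Matrix.diagonal_apply_eq, Matrix.one_apply_eq, ← Complex.exp_add] at h3
  obtain ⟨n, hn⟩ := Complex.exp_eq_one_iff.1 h3
  have hpi : (2 * Real.pi * Complex.I : ℂ) ≠ 0 := by
    simp [Real.pi_ne_zero]
  have h4 : ((2 * Q.dim A : ℝ) : ℂ) = n := by
    refine mul_left_cancel₀ hpi ?_
    push_cast
    linear_combination hn
  have h5 : 2 * Q.dim A = n := by exact_mod_cast h4
  have h6 := Q.dim_pos A
  have h7 : 0 < n := by
    have : (0 : ℝ) < n := by linarith
    exact_mod_cast this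
  refine ⟨n.toNat, by omega, ?_⟩
  rw [h5]
  have : ((n.toNat : ℤ) : ℝ) = n := by rw [Int.toNat_of_nonneg h7.le]
  exact_mod_cast this.symm

/-- The conjugate field `φ_A^*` on the last coordinate axis. -/
def Theory.conjField (A : I) (k : ℤ) : Module.End ℂ Q.dom :=
  ∑ B, Q.conj B A • Q.field B k (toC (lastVec D))

lemma Theory.conjField_apply (A : I) (k : ℤ) (Ψ : Q.dom) :
    Q.conjField A k Ψ = ∑ B, Q.conj B A • Q.field B k (toC (lastVec D)) Ψ := by
  simp [Theory.conjField]

/-- At the point `e_D` the conjugation law has no `Spin` factor, because `e_D e_D = 1`. -/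
lemma Theory.inner_field_last (A : I) (k k' : ℤ) (h : (k : ℝ) + k' + 2 * Q.dim A = 0)
    (Φ Ψ : Q.dom) :
    inner ℂ Φ (Q.field A k (toC (lastVec D)) Ψ) = inner ℂ (Q.conjField A k' Φ) Ψ := by
  have h1 : spinPair (lastVec D) (lastVec D) = 1 := Subtype.ext (ι_sq (lastVec D))
  have h2 := Q.conj_law A k k' h (lastVec D) Φ Ψ
  rw [h1, map_one, one_mul] at h2
  rw [Q.conjField_apply]
  exact h2

/-- The spin–statistics relation.  On a coordinate axis, translation covariance determines the two
point functions of `φ_A` and `φ_A^*` in both orders up to their values on the lowest components,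
which are positive; locality identifies one with the other up to the sign `(-1)^{2 d_A}`. -/
theorem Theory.spin_statistics (A : I) {d : ℕ} (hd : 2 * Q.dim A = d) :
    (-1 : ℂ) ^ (Q.parity A : ℕ) = (-1) ^ d := by
  set e := toC (lastVec D) with he
  have hsq : sq e = 1 := sq_toC _
  have hd0 : 0 < d := by
    have := Q.dim_pos A
    have h : (0 : ℝ) < d := by linarith
    exact_mod_cast h
  set s : ℂ := (-1 : ℂ) ^ ((Q.parity A : ℕ) * (Q.parity A : ℕ)) with hs
  set ℓ : Q.dom →ₗ[ℂ] ℂ := (innerSL ℂ Q.vac).toLinearMap with hℓ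
  have hℓa : ∀ Ψ, ℓ Ψ = inner ℂ Q.vac Ψ := fun Ψ => rfl
  have hℓT : ∀ Ψ, ℓ (Q.T (lastIdx D) Ψ) = 0 := fun Ψ => by
    rw [hℓa, Q.adj_T, Q.vac_invariant.2.1, inner_zero_left, neg_zero]
  have hTvac : Q.T (lastIdx D) Q.vac = 0 := Q.vac_invariant.1 _
  have hTc : ∀ k Ψ, Q.T (lastIdx D) (Q.conjField A k Ψ) - Q.conjField A k (Q.T (lastIdx D) Ψ) =
      ((k : ℂ) + 1) • Q.conjField A (k + 1) Ψ := by
    intro k Ψ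
    simp only [Q.conjField_apply, map_sum, ← Finset.sum_sub_distrib, Finset.smul_sum, map_smul]
    refine Finset.sum_congr rfl fun B _ => ?_
    rw [← smul_sub, Q.comm_T_field_last, smul_comm]
  set X : ℤ → ℤ → ℂ := fun k l => ℓ (Q.conjField A k (Q.field A l e Q.vac)) -
    s * ℓ (Q.field A l e (Q.conjField A k Q.vac)) with hX
  have hloc : ∃ M, (mulInterval e e)^[M] X = 0 := by
    choose M hM using fun B => Q.locality_field B A
    refine ⟨Finset.univ.sup M, ?_⟩
    have h1 : X = fun k l => ∑ B, Q.conj B A • ℓ (Q.field B k e (Q.field A l e Q.vac) -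
        (-1 : ℂ) ^ ((Q.parity B : ℕ) * (Q.parity A : ℕ)) •
          Q.field A l e (Q.field B k e Q.vac)) := by
      funext k l
      simp only [hX, Q.conjField_apply, map_sum, map_smul, map_sub, smul_eq_mul, Finset.mul_sum,
        ← Finset.sum_sub_distrib]
      refine Finset.sum_congr rfl fun B _ => ?_
      by_cases hB : Q.conj B A = 0
      · simp [hB]
      · rw [Q.conj_parity A B hB, ← he, ← hs]
        ring
    rw [h1, mulInterval_iterate_sum]
    funext k l
    refine Finset.sum_eq_zero fun B _ => ?_
    rw [← map_mulInterval_iterate, hM B _ (Finset.le_sup (Finset.mem_univ B)) e e Q.vac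
      (by rw [hsq]; exact one_ne_zero) (by rw [hsq]; exact one_ne_zero)]
    simp
  obtain ⟨M, hM⟩ := hloc
  set y : ℤ → ℂ := fun l => X (-(d : ℤ) - l) l with hy
  have hyΔ : (fwdDiff (1 : ℤ))^[2 * M] y = 0 := by
    funext l
    have := mulInterval_iterate_diag hsq M X (-(d : ℤ)) (l + 2 * M)
    rw [hM, add_sub_cancel_right] at this
    exact this.symm
  have hrec : ∀ l : ℤ, ((l : ℂ) + 1) * y (l + 1) = (d + l) * y l := by
    intro l
    have h1 := Q.comm_T_field_last A l
    have h2 := hTc (-(d : ℤ) - (l + 1))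
    rw [show -(d : ℤ) - (l + 1) + 1 = -(d : ℤ) - l by ring] at h2
    have a1 := congrArg ℓ (h2 (Q.field A l e Q.vac))
    have a2 := congrArg (fun v => ℓ (Q.conjField A (-(d : ℤ) - (l + 1)) v)) (h1 Q.vac)
    have b1 := congrArg ℓ (h1 (Q.conjField A (-(d : ℤ) - (l + 1)) Q.vac))
    have b2 := congrArg (fun v => ℓ (Q.field A l e v)) (h2 Q.vac)
    simp only [hTvac, map_zero, sub_zero, map_sub, hℓT, zero_sub, map_smul, smul_eq_mul, ← he]
      at a1 a2 b1 b2
    push_cast at a1 b2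
    simp only [hy, hX]
    linear_combination -a1 - a2 + s * b1 + s * b2
  have hfin := apply_neg_of_recursion hd0 hrec hyΔ
  have hcneg : ∀ k < 0, Q.conjField A k Q.vac = 0 := fun k hk => by
    rw [Q.conjField_apply]
    exact Finset.sum_eq_zero fun B _ => by rw [Q.field_last_vac_eq_zero B k hk, smul_zero]
  have hy0 : y 0 = ((‖Q.field A 0 e Q.vac‖ ^ 2 : ℝ) : ℂ) := by
    have h1 := Q.inner_field_last A 0 (-(d : ℤ)) (by push_cast; linarith)
      (Q.field A 0 e Q.vac) Q.vac
    rw [← he, inner_self_eq_norm_sq_to_K] at h1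
    have h2 := congrArg (starRingEnd ℂ) h1
    rw [inner_conj_symm] at h2
    simp only [hy, hX, sub_zero, hcneg (-(d : ℤ)) (by omega), map_zero, hℓa]
    rw [← h2]
    simp
  have hyd : y (-d) = -s * ((‖Q.conjField A 0 Q.vac‖ ^ 2 : ℝ) : ℂ) := by
    have h1 := Q.inner_field_last A (-(d : ℤ)) 0 (by push_cast; linarith)
      Q.vac (Q.conjField A 0 Q.vac)
    rw [← he, inner_self_eq_norm_sq_to_K] at h1
    simp only [hy, hX, sub_neg_eq_add, neg_add_cancel, he,
      Q.field_last_vac_eq_zero A (-(d : ℤ)) (by omega), map_zero, zero_sub]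
    rw [← he, hℓa, h1]
    simp
  rw [hy0, hyd] at hfin
  have hpos : 0 < ‖Q.field A 0 e Q.vac‖ ^ 2 :=
    pow_pos (norm_pos_iff.2 (Q.field_zero_last_vac_ne_zero A)) 2
  have hnn : 0 ≤ ‖Q.conjField A 0 Q.vac‖ ^ 2 := by positivity
  have hsp : s = (-1) ^ (Q.parity A : ℕ) := by
    have := (Q.parity A).isLt
    rw [hs]
    interval_cases (Q.parity A : ℕ) <;> simp
  rw [← hsp]
  have hs1 : s = 1 ∨ s = -1 := neg_one_pow_eq_or ℂ _
  have hd1 : ((-1 : ℂ) ^ d = 1) ∨ (-1 : ℂ) ^ d = -1 := neg_one_pow_eq_or ℂ _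
  rcases hs1 with h1 | h1 <;> rcases hd1 with h2 | h2 <;> rw [h1, h2] at hfin ⊢
  · exfalso
    simp only [neg_mul, one_mul, neg_neg] at hfin
    have : -‖Q.conjField A 0 Q.vac‖ ^ 2 = ‖Q.field A 0 e Q.vac‖ ^ 2 := by exact_mod_cast hfin
    linarith
  · exfalso
    simp only [neg_mul, one_mul, neg_neg] at hfin
    have : ‖Q.conjField A 0 Q.vac‖ ^ 2 = -‖Q.field A 0 e Q.vac‖ ^ 2 := by exact_mod_cast hfin
    linarith

end SpinStatistics

/-! ### Coefficients of thermal mean values -/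

section ThermalCoeff

variable {D : ℕ} [NeZero D] {𝓗 : Type*} [NormedAddCommGroup 𝓗] [InnerProductSpace ℂ 𝓗]
  {I : Type*} [Fintype I] [DecidableEq I] (Q : Theory D 𝓗 I) (hQ : Q.FiniteDegeneracy)

lemma Theory.levelTrace_add (j : ℕ) (X Y : Module.End ℂ Q.dom) :
    Q.levelTrace hQ j (X + Y) = Q.levelTrace hQ j X + Q.levelTrace hQ j Y := by
  simp [Theory.levelTrace, Finset.sum_add_distrib]

lemma Theory.levelTrace_smul (j : ℕ) (c : ℂ) (X : Module.End ℂ Q.dom) :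
    Q.levelTrace hQ j (c • X) = c * Q.levelTrace hQ j X := by
  simp [Theory.levelTrace, Finset.mul_sum]

lemma Theory.H_apply_of_comm {X : Module.End ℂ Q.dom} {ν : ℂ} (hX : ⁅Q.H, X⁆ = ν • X) {μ : ℂ}
    {Ψ : Q.dom} (hΨ : Q.H Ψ = μ • Ψ) : Q.H (X Ψ) = (μ + ν) • X Ψ := by
  have h := LinearMap.congr_fun hX Ψ
  rw [Ring.lie_def, LinearMap.sub_apply, Module.End.mul_apply, Module.End.mul_apply, hΨ, map_smul,
    LinearMap.smul_apply, sub_eq_iff_eq_add] at h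
  rw [h, add_smul, add_comm]

lemma Theory.mem_level {j : ℕ} {Ψ : Q.dom} : Ψ ∈ Q.level j ↔ Q.H Ψ = ((j : ℂ) / 2) • Ψ := by
  rw [Theory.level, Module.End.mem_eigenspace_iff]

lemma Theory.inner_H_comm {X : Module.End ℂ Q.dom} {ν : ℂ} (hX : ⁅Q.H, X⁆ = ν • X) (hν : ν ≠ 0)
    {j : ℕ} {Ψ Φ : Q.dom} (hΨ : Ψ ∈ Q.level j) (hΦ : Φ ∈ Q.level j) : inner ℂ Φ (X Ψ) = 0 := by
  rw [Q.mem_level] at hΨ hΦ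
  have h1 := Q.adj_H Φ (X Ψ)
  rw [Q.H_apply_of_comm hX hΨ, hΦ, inner_smul_right, inner_smul_left] at h1
  have h2 : (starRingEnd ℂ) ((j : ℂ) / 2) = (j : ℂ) / 2 := by
    rw [show (j : ℂ) / 2 = ((j / 2 : ℝ) : ℂ) by push_cast; rfl, Complex.conj_ofReal]
  rw [h2, add_mul, add_eq_left] at h1
  exact (mul_eq_zero.1 h1).resolve_left hν

lemma Theory.levelTrace_eq_zero_of_comm {X : Module.End ℂ Q.dom} {ν : ℂ}
    (hX : ⁅Q.H, X⁆ = ν • X) (hν : ν ≠ 0) (j : ℕ) : Q.levelTrace hQ j X = 0 := by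
  have : FiniteDimensional ℂ (Q.level j) := hQ _
  exact Finset.sum_eq_zero fun σ _ => Q.inner_H_comm hX hν (Subtype.mem _) (Subtype.mem _)

/-- The eigenvalues of `H` are nonnegative. -/
lemma Theory.eq_zero_of_H_neg {Ψ : Q.dom} {μ : ℝ} (hμ : μ < 0) (hΨ : Q.H Ψ = (μ : ℂ) • Ψ) :
    Ψ = 0 := by
  have h := Q.H_nonneg Ψ
  rw [hΨ, inner_smul_right, inner_self_eq_norm_sq_to_K] at h
  have h2 : (((μ : ℂ) * ((‖Ψ‖ : ℂ)) ^ 2)).re = μ * ‖Ψ‖ ^ 2 := by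
    rw [Complex.re_ofReal_mul]
    norm_cast
  rw [show ((RCLike.ofReal ‖Ψ‖ : ℂ)) = (‖Ψ‖ : ℂ) from rfl, h2] at h
  by_contra hne
  have : 0 < ‖Ψ‖ := norm_pos_iff.2 hne
  nlinarith [pow_pos this 2]

/-- Cyclicity of the trace for operators that shift the energy. -/
lemma Theory.levelTrace_mul_comm {X φ : Module.End ℂ Q.dom} {a : ℕ}
    (hφ : ⁅Q.H, φ⁆ = ((a : ℂ) / 2) • φ) (hX : ⁅Q.H, X⁆ = (-(a : ℂ) / 2) • X) (j : ℕ) :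
    Q.levelTrace hQ (j + a) (φ * X) = Q.levelTrace hQ j (X * φ) := by
  have : FiniteDimensional ℂ (Q.level j) := hQ _
  have : FiniteDimensional ℂ (Q.level (j + a)) := hQ _
  set b := stdOrthonormalBasis ℂ (Q.level j)
  set b' := stdOrthonormalBasis ℂ (Q.level (j + a))
  have h1 : ∀ Ψ ∈ Q.level j, φ Ψ = ∑ ρ, inner ℂ (b' ρ : Q.dom) (φ Ψ) • (b' ρ : Q.dom) := by
    intro Ψ hΨ
    have hm : φ Ψ ∈ Q.level (j + a) := by
      rw [Q.mem_level] at hΨ ⊢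
      rw [Q.H_apply_of_comm hφ hΨ]
      congr 1
      push_cast
      ring
    have := congrArg Subtype.val (b'.sum_repr' ⟨φ Ψ, hm⟩)
    rw [AddSubmonoidClass.coe_finsetSum] at this
    exact this.symm
  have h2 : ∀ Ψ ∈ Q.level (j + a), X Ψ = ∑ σ, inner ℂ (b σ : Q.dom) (X Ψ) • (b σ : Q.dom) := by
    intro Ψ hΨ
    have hm : X Ψ ∈ Q.level j := by
      rw [Q.mem_level] at hΨ ⊢
      rw [Q.H_apply_of_comm hX hΨ]
      congr 1
      push_cast
      ring
    have := congrArg Subtype.val (b.sum_repr' ⟨X Ψ, hm⟩)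
    rw [AddSubmonoidClass.coe_finsetSum] at this
    exact this.symm
  have e1 : Q.levelTrace hQ j (X * φ) =
      ∑ σ, ∑ ρ, inner ℂ (b' ρ : Q.dom) (φ (b σ)) * inner ℂ (b σ : Q.dom) (X (b' ρ)) := by
    refine Finset.sum_congr rfl fun σ _ => ?_
    change inner ℂ (b σ : Q.dom) (X (φ (b σ))) = _
    conv_lhs => rw [h1 _ (b σ).2, map_sum, inner_sum]
    refine Finset.sum_congr rfl fun ρ _ => ?_
    rw [map_smul, inner_smul_right]
  have e2 : Q.levelTrace hQ (j + a) (φ * X) =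
      ∑ ρ, ∑ σ, inner ℂ (b σ : Q.dom) (X (b' ρ)) * inner ℂ (b' ρ : Q.dom) (φ (b σ)) := by
    refine Finset.sum_congr rfl fun ρ _ => ?_
    change inner ℂ (b' ρ : Q.dom) (φ (X (b' ρ))) = _
    conv_lhs => rw [h2 _ (b' ρ).2, map_sum, inner_sum]
    refine Finset.sum_congr rfl fun σ _ => ?_
    rw [map_smul, inner_smul_right]
  rw [e1, e2, Finset.sum_comm]
  exact Finset.sum_congr rfl fun σ _ => Finset.sum_congr rfl fun ρ _ => mul_comm _ _

/-- Below energy `a/2` the trace vanishes, because `X` lowers the energy by `a/2`. -/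
lemma Theory.levelTrace_mul_eq_zero {X φ : Module.End ℂ Q.dom} {a : ℕ}
    (hX : ⁅Q.H, X⁆ = (-(a : ℂ) / 2) • X) {j : ℕ} (hj : j < a) :
    Q.levelTrace hQ j (φ * X) = 0 := by
  have : FiniteDimensional ℂ (Q.level j) := hQ _
  refine Finset.sum_eq_zero fun σ _ => ?_
  set Ψ := (stdOrthonormalBasis ℂ (Q.level j) σ : Q.dom)
  have hΨ : Ψ ∈ Q.level j := Subtype.mem _
  have h1 : X Ψ = 0 := by
    rw [Q.mem_level] at hΨ
    refine Q.eq_zero_of_H_neg (μ := ((j : ℝ) - a) / 2) ?_ ?_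
    · have : (j : ℝ) < a := by exact_mod_cast hj
      linarith
    · rw [Q.H_apply_of_comm hX hΨ]
      congr 1
      push_cast
      ring
  change inner ℂ Ψ (φ (X Ψ)) = 0
  rw [h1, map_zero, inner_zero_right]

/-- Cyclicity of the trace for an operator raising the energy by `a/2`. -/
lemma Theory.thermalMean_mul_comm {X φ : Module.End ℂ Q.dom} {a : ℕ}
    (hφ : ⁅Q.H, φ⁆ = ((a : ℂ) / 2) • φ) (hX : ⁅Q.H, X⁆ = (-(a : ℂ) / 2) • X) :
    Q.thermalMean hQ (φ * X) = PowerSeries.X ^ a * Q.thermalMean hQ (X * φ) := by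
  have h : Q.thermalTrace hQ (φ * X) = PowerSeries.X ^ a * Q.thermalTrace hQ (X * φ) := by
    ext j
    rw [PowerSeries.coeff_X_pow_mul']
    split_ifs with h
    · obtain ⟨i, rfl⟩ := Nat.exists_eq_add_of_le' h
      rw [Nat.add_sub_cancel]
      simp only [Theory.thermalTrace, PowerSeries.coeff_mk]
      exact Q.levelTrace_mul_comm hQ hφ hX i
    · simp only [Theory.thermalTrace, PowerSeries.coeff_mk]
      exact Q.levelTrace_mul_eq_zero hQ hX (by omega)
  rw [Theory.thermalMean, Theory.thermalMean, h, mul_left_comm]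

/-- The coefficient of `q^{j/2}` in the thermal mean value, zero for negative `j`. -/
def Theory.thermalCoeff (j : ℤ) : Module.End ℂ Q.dom →ₗ[ℂ] ℂ where
  toFun X := if j < 0 then 0 else PowerSeries.coeff j.toNat (Q.thermalMean hQ X)
  map_add' X Y := by
    split_ifs
    · simp
    · rw [← map_add]
      congr 1
      rw [Theory.thermalMean, Theory.thermalMean, Theory.thermalMean, ← mul_add]
      congr 1
      ext i
      simp [Theory.thermalTrace, Q.levelTrace_add]
  map_smul' c X := by
    split_ifs
    · simp
    · rw [RingHom.id_apply, ← map_smul]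
      congr 1
      rw [Theory.thermalMean, Theory.thermalMean, ← mul_smul_comm]
      congr 1
      ext i
      simp [Theory.thermalTrace, Q.levelTrace_smul]

lemma Theory.thermalCoeff_natCast (j : ℕ) (X : Module.End ℂ Q.dom) :
    Q.thermalCoeff hQ j X = PowerSeries.coeff j (Q.thermalMean hQ X) := by
  simp [Theory.thermalCoeff]

lemma Theory.thermalCoeff_of_neg {j : ℤ} (hj : j < 0) (X : Module.End ℂ Q.dom) :
    Q.thermalCoeff hQ j X = 0 := by
  simp [Theory.thermalCoeff, hj]

lemma Theory.thermalCoeff_eq_zero_of_levelTrace {X : Module.End ℂ Q.dom} {j : ℤ}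
    (h : ∀ i : ℕ, (i : ℤ) ≤ j → Q.levelTrace hQ i X = 0) : Q.thermalCoeff hQ j X = 0 := by
  rcases lt_or_ge j 0 with hj | hj
  · exact Q.thermalCoeff_of_neg hQ hj X
  · lift j to ℕ using hj
    rw [Q.thermalCoeff_natCast, Theory.thermalMean, PowerSeries.coeff_mul]
    refine Finset.sum_eq_zero fun x hx => ?_
    rw [Finset.HasAntidiagonal.mem_antidiagonal] at hx
    rw [show PowerSeries.coeff x.2 (Q.thermalTrace hQ X) = Q.levelTrace hQ x.2 X from
      PowerSeries.coeff_mk _ _, h _ (by omega), mul_zero]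

/-- Mean values of operators that change the energy vanish. -/
lemma Theory.thermalCoeff_eq_zero_of_comm {X : Module.End ℂ Q.dom} {ν : ℂ}
    (hX : ⁅Q.H, X⁆ = ν • X) (hν : ν ≠ 0) (j : ℤ) : Q.thermalCoeff hQ j X = 0 :=
  Q.thermalCoeff_eq_zero_of_levelTrace hQ fun i _ => Q.levelTrace_eq_zero_of_comm hQ hX hν i

/-- A coefficient of the thermal mean value only involves the action of an operator on finitely
many vectors. -/
lemma Theory.exists_finset_thermalCoeff (j : ℤ) :
    ∃ S : Finset Q.dom, ∀ X : Module.End ℂ Q.dom, (∀ Ψ ∈ S, X Ψ = 0) →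
      Q.thermalCoeff hQ j X = 0 := by
  classical
  have h : ∀ i : ℕ, ∃ S : Finset Q.dom, ∀ X : Module.End ℂ Q.dom, (∀ Ψ ∈ S, X Ψ = 0) →
      Q.levelTrace hQ i X = 0 := by
    intro i
    have : FiniteDimensional ℂ (Q.level i) := hQ _
    refine ⟨Finset.univ.image fun σ => (stdOrthonormalBasis ℂ (Q.level i) σ : Q.dom),
      fun X hX => Finset.sum_eq_zero fun σ _ => ?_⟩
    rw [hX _ (Finset.mem_image_of_mem _ (Finset.mem_univ σ)), inner_zero_right]
  choose S hS using h
  refine ⟨(Finset.range (j.toNat + 1)).biUnion S, fun X hX =>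
    Q.thermalCoeff_eq_zero_of_levelTrace hQ fun i hi => hS i X fun Ψ hΨ => hX Ψ ?_⟩
  exact Finset.mem_biUnion.2 ⟨i, Finset.mem_range.2 (by omega), hΨ⟩

lemma Theory.comm_H_mul {X Y : Module.End ℂ Q.dom} {μ ν : ℂ} (hX : ⁅Q.H, X⁆ = μ • X)
    (hY : ⁅Q.H, Y⁆ = ν • Y) : ⁅Q.H, X * Y⁆ = (μ + ν) • (X * Y) := by
  have : ⁅Q.H, X * Y⁆ = ⁅Q.H, X⁆ * Y + X * ⁅Q.H, Y⁆ := by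
    simp only [Ring.lie_def, sub_mul, mul_sub, mul_assoc]
    abel
  rw [this, hX, hY, smul_mul_assoc, mul_smul_comm, add_smul]

/-- The KMS condition, for coefficients. -/
lemma Theory.thermalCoeff_mul_comm {X φ : Module.End ℂ Q.dom} {a b : ℤ}
    (hφ : ⁅Q.H, φ⁆ = ((a : ℂ) / 2) • φ) (hX : ⁅Q.H, X⁆ = ((b : ℂ) / 2) • X) (j : ℤ) :
    Q.thermalCoeff hQ j (X * φ) = Q.thermalCoeff hQ (j + a) (φ * X) := by
  by_cases hab : a + b = 0
  · obtain rfl : b = -a := by omega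
    have key : ∀ (a : ℕ) (X φ : Module.End ℂ Q.dom), ⁅Q.H, φ⁆ = ((a : ℂ) / 2) • φ →
        ⁅Q.H, X⁆ = (-(a : ℂ) / 2) • X → ∀ j : ℤ,
        Q.thermalCoeff hQ j (X * φ) = Q.thermalCoeff hQ (j + a) (φ * X) := by
      intro a X φ hφ hX j
      have h := Q.thermalMean_mul_comm hQ hφ hX
      rcases lt_or_ge (j + a) 0 with h1 | h1
      · rw [Q.thermalCoeff_of_neg hQ h1, Q.thermalCoeff_of_neg hQ (by omega)]
      obtain ⟨i, hi⟩ := Int.eq_ofNat_of_zero_le h1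
      rw [hi, Q.thermalCoeff_natCast, h, PowerSeries.coeff_X_pow_mul']
      split_ifs with h2
      · rw [show j = ((i - a : ℕ) : ℤ) by omega, Q.thermalCoeff_natCast]
      · rw [Q.thermalCoeff_of_neg hQ (by omega)]
    rcases le_or_gt 0 a with h | h
    · lift a to ℕ using h
      push_cast at hφ hX
      exact key a X φ hφ hX j
    · obtain ⟨c, hc⟩ := Int.eq_ofNat_of_zero_le (show 0 ≤ -a by omega)
      obtain rfl : a = -(c : ℤ) := by omega
      push_cast at hφ hX
      rw [neg_neg] at hX
      have := key c φ X hX hφ (j + -(c : ℤ))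
      rw [this]
      congr 1
      congr 1
      omega
  · have hne : (a : ℂ) / 2 + b / 2 ≠ 0 := by
      rw [← add_div]
      exact div_ne_zero (by exact_mod_cast hab) two_ne_zero
    rw [Q.thermalCoeff_eq_zero_of_comm hQ (Q.comm_H_mul hφ hX) hne,
      Q.thermalCoeff_eq_zero_of_comm hQ (Q.comm_H_mul hX hφ) (by rwa [add_comm])]

end ThermalCoeff

/-! ### Coefficients of thermal correlation functions -/

/-- Ordered products which differ in two neighbouring factors only. -/
lemma exists_prod_ofFn_eq {R : Type*} [Monoid R] {n : ℕ} (i : Fin n) (F : Fin (n + 1) → R) :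
    ∃ X Y : R, ∀ G : Fin (n + 1) → R, (∀ l, l ≠ i.castSucc → l ≠ i.succ → G l = F l) →
      (List.ofFn G).prod = X * (G i.castSucc * G i.succ) * Y := by
  refine ⟨((List.ofFn F).take i).prod, ((List.ofFn F).drop (i + 2)).prod, fun G hG => ?_⟩
  have h1 : (List.ofFn G).take i = (List.ofFn F).take i := by
    apply List.ext_getElem
    · simp
    · intro l h1 h2
      simp only [List.length_take, List.length_ofFn] at h1
      simp only [List.getElem_take, List.getElem_ofFn]
      exact hG _ (by simp [Fin.ext_iff]; omega) (by simp [Fin.ext_iff]; omega)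
  have h2 : (List.ofFn G).drop (i + 2) = (List.ofFn F).drop (i + 2) := by
    apply List.ext_getElem
    · simp
    · intro l h1 h2
      simp only [List.getElem_drop, List.getElem_ofFn]
      exact hG _ (by simp [Fin.ext_iff]; omega) (by simp [Fin.ext_iff]; omega)
  rw [← h1, ← h2]
  conv_lhs => rw [← List.prod_take_mul_prod_drop (List.ofFn G) i,
    List.drop_eq_getElem_cons (by simp), List.drop_eq_getElem_cons (by simp), List.prod_cons,
    List.prod_cons]
  simp only [List.getElem_ofFn, mul_assoc]
  rfl

/-- The monomial `e^{π i (∑ (δ_k + 2 n_k) ζ_k + j τ)}`. -/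
def expTerm {n : ℕ} (δ : Fin n → ℤ) (p : (Fin n → ℂ) × ℂ) (y : (Fin n → ℤ) × ℤ) : ℂ :=
  Complex.exp (Real.pi * Complex.I * (∑ i, ((δ i + 2 * y.1 i : ℤ) : ℂ) * p.1 i + y.2 * p.2))

section Correlators

variable {D : ℕ} [NeZero D] {𝓗 : Type*} [NormedAddCommGroup 𝓗] [InnerProductSpace ℂ 𝓗]
  {I : Type*} [Fintype I] [DecidableEq I] (Q : Theory D 𝓗 I) (hQ : Q.FiniteDegeneracy)

/-- Twice the dimension of `φ_A`. -/
def Theory.twiceDim (A : I) : ℤ := ((Q.exists_two_mul_dim A).choose : ℤ)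

lemma Theory.two_mul_dim (A : I) : 2 * Q.dim A = Q.twiceDim A := by
  have := (Q.exists_two_mul_dim A).choose_spec.2
  rw [Theory.twiceDim]
  exact_mod_cast this

lemma Theory.dim_eq (A : I) : (Q.dim A : ℂ) = (Q.twiceDim A : ℂ) / 2 := by
  rw [eq_div_iff two_ne_zero, mul_comm]
  exact_mod_cast congrArg (fun x : ℝ => (x : ℂ)) (Q.two_mul_dim A)

lemma Theory.neg_one_pow_parity (A : I) :
    (-1 : ℂ) ^ (Q.parity A : ℕ) = (-1) ^ (Q.twiceDim A) := by
  rw [Theory.twiceDim, zpow_natCast]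
  exact Q.spin_statistics A (Q.exists_two_mul_dim A).choose_spec.2

variable {n : ℕ}

/-- The product `φ_{A_1,k_1}(u_1) ⋯ φ_{A_n,k_n}(u_n)` of homogeneous components. -/
def Theory.word (A : Fin n → I) (u : Fin n → USphere D) (k : Fin n → ℤ) : Module.End ℂ Q.dom :=
  (List.ofFn fun i => Q.field (A i) (k i) (toC (u i))).prod

/-- The coefficient of the monomial `expTerm (k, j)` in the thermal correlation function. -/
def Theory.coef (A : Fin n → I) (u : Fin n → USphere D) (y : (Fin n → ℤ) × ℤ) : ℂ :=
  Q.thermalCoeff hQ y.2 (Q.word A u y.1)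

lemma Theory.comm_H_field_int (A : I) (k : ℤ) (z : Fin D → ℂ) :
    ⁅Q.H, Q.field A k z⁆ = (((Q.twiceDim A + 2 * k : ℤ) : ℂ) / 2) • Q.field A k z := by
  rw [Q.comm_H_field, Q.dim_eq]
  congr 1
  push_cast
  ring

lemma Theory.word_succ (A : Fin (n + 1) → I) (u : Fin (n + 1) → USphere D)
    (k : Fin (n + 1) → ℤ) : Q.word A u k = Q.field (A 0) (k 0) (toC (u 0)) *
      Q.word (A ∘ Fin.succ) (u ∘ Fin.succ) (k ∘ Fin.succ) := by
  simp [Theory.word, List.ofFn_succ]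

lemma Theory.word_last (A : Fin (n + 1) → I) (u : Fin (n + 1) → USphere D)
    (k : Fin (n + 1) → ℤ) : Q.word A u k =
      Q.word (A ∘ Fin.castSucc) (u ∘ Fin.castSucc) (k ∘ Fin.castSucc) *
        Q.field (A (Fin.last n)) (k (Fin.last n)) (toC (u (Fin.last n))) := by
  rw [Theory.word, List.ofFn_succ', List.concat_eq_append, List.prod_append, List.prod_singleton]
  rfl

lemma Theory.comm_H_word (A : Fin n → I) (u : Fin n → USphere D) (k : Fin n → ℤ) :
    ⁅Q.H, Q.word A u k⁆ = (((∑ i, (Q.twiceDim (A i) + 2 * k i) : ℤ) : ℂ) / 2) • Q.word A u k := by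
  induction n with
  | zero => simp [Theory.word, Ring.lie_def]
  | succ n ih =>
    rw [Q.word_succ, Q.comm_H_mul (Q.comm_H_field_int _ _ _) (ih _ _ _), Fin.sum_univ_succ]
    congr 1
    push_cast
    simp only [Function.comp_apply]
    ring

/-- Only terms of total energy zero contribute to thermal correlation functions. -/
lemma Theory.coef_eq_zero_of_sum_ne (A : Fin n → I) (u : Fin n → USphere D)
    {y : (Fin n → ℤ) × ℤ} (hy : ∑ i, (Q.twiceDim (A i) + 2 * y.1 i) ≠ 0) :
    Q.coef hQ A u y = 0 :=
  Q.thermalCoeff_eq_zero_of_comm hQ (Q.comm_H_word A u y.1)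
    (div_ne_zero (by exact_mod_cast hy) two_ne_zero) _

lemma Theory.coef_eq_zero_of_neg (A : Fin n → I) (u : Fin n → USphere D)
    {y : (Fin n → ℤ) × ℤ} (hy : y.2 < 0) : Q.coef hQ A u y = 0 :=
  Q.thermalCoeff_of_neg hQ hy _

/-- The degrees of the last field that contribute to a given power of `q` are bounded below. -/
lemma Theory.exists_coef_eq_zero_of_last_lt (A : Fin (n + 1) → I) (u : Fin (n + 1) → USphere D)
    (j : ℤ) : ∃ K : ℤ, ∀ k : Fin (n + 1) → ℤ, k (Fin.last n) < K → Q.coef hQ A u (k, j) = 0 := by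
  obtain ⟨S, hS⟩ := Q.exists_finset_thermalCoeff hQ j
  choose K hK using fun Ψ => Q.exists_field_eq_zero (A (Fin.last n)) Ψ
  obtain ⟨K₀, hK₀⟩ : ∃ K₀ : ℤ, ∀ Ψ ∈ S, K₀ ≤ K Ψ := by
    classical
    obtain ⟨b, hb⟩ := (S.image K).bddBelow
    exact ⟨b, fun Ψ hΨ => hb (Finset.mem_coe.2 (Finset.mem_image_of_mem K hΨ))⟩
  refine ⟨K₀, fun k hk => hS _ fun Ψ hΨ => ?_⟩
  rw [Q.word_last, Module.End.mul_apply, hK Ψ _ (lt_of_lt_of_le hk (hK₀ Ψ hΨ)), map_zero]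

/-- The KMS condition: the last field can be moved to the front, shifting the power of `q`. -/
lemma Theory.coef_rotate (A : Fin (n + 1) → I) (u : Fin (n + 1) → USphere D)
    (k : Fin (n + 1) → ℤ) (j : ℤ) :
    Q.coef hQ A u (k, j) = Q.coef hQ (A ∘ (finRotate (n + 1)).symm) (u ∘ (finRotate (n + 1)).symm)
      (k ∘ (finRotate (n + 1)).symm,
        j + (Q.twiceDim (A (Fin.last n)) + 2 * k (Fin.last n))) := by
  have h0 : (finRotate (n + 1)).symm 0 = Fin.last n := by
    rw [Equiv.symm_apply_eq, finRotate_last]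
  have hs : ⇑(finRotate (n + 1)).symm ∘ Fin.succ = Fin.castSucc := by
    funext i
    rw [Function.comp_apply, Equiv.symm_apply_eq]
    ext
    rw [coe_finRotate_of_ne_last (Fin.castSucc_lt_last i).ne]
    simp
  rw [Theory.coef, Theory.coef, Q.word_last, Q.word_succ]
  simp only [Function.comp_assoc, hs, Function.comp_apply, h0]
  exact Q.thermalCoeff_mul_comm hQ (Q.comm_H_field_int _ _ _) (Q.comm_H_word _ _ _) j

/-- Locality, for the coefficients of thermal correlation functions. -/
lemma Theory.coef_locality (A : Fin (n + 1) → I) (u : Fin (n + 1) → USphere D) (i : Fin n)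
    {M : ℕ} (hM : ∀ (z w : Fin D → ℂ) (Ψ : Q.dom), sq z ≠ 0 → sq w ≠ 0 →
      (mulInterval z w)^[M] (fun k l =>
        Q.field (A i.castSucc) k z (Q.field (A i.succ) l w Ψ) -
          (-1 : ℂ) ^ ((Q.parity (A i.castSucc) : ℕ) * (Q.parity (A i.succ) : ℕ)) •
            Q.field (A i.succ) l w (Q.field (A i.castSucc) k z Ψ)) = 0)
    (k : Fin (n + 1) → ℤ) (j : ℤ) :
    (mulInterval (toC (u i.castSucc)) (toC (u i.succ)))^[M] (fun a b =>
      Q.coef hQ A u (Function.update (Function.update k i.castSucc a) i.succ b, j) -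
        (-1 : ℂ) ^ ((Q.parity (A i.castSucc) : ℕ) * (Q.parity (A i.succ) : ℕ)) *
          Q.coef hQ (A ∘ Equiv.swap i.castSucc i.succ) (u ∘ Equiv.swap i.castSucc i.succ)
            (Function.update (Function.update k i.castSucc a) i.succ b ∘
              Equiv.swap i.castSucc i.succ, j)) = 0 := by
  obtain ⟨X, Y, hXY⟩ := exists_prod_ofFn_eq i
    (fun l => Q.field (A l) (k l) (toC (u l)))
  have hne : i.castSucc ≠ i.succ := (Fin.castSucc_lt_succ).ne
  set s : ℂ := (-1 : ℂ) ^ ((Q.parity (A i.castSucc) : ℕ) * (Q.parity (A i.succ) : ℕ)) with hs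
  set ℓ : Module.End ℂ Q.dom →ₗ[ℂ] ℂ := Q.thermalCoeff hQ j ∘ₗ
    (LinearMap.mulRight ℂ Y ∘ₗ LinearMap.mulLeft ℂ X) with hℓ
  have h1 : (fun a b => Q.coef hQ A u (Function.update (Function.update k i.castSucc a) i.succ b, j)
      - s * Q.coef hQ (A ∘ Equiv.swap i.castSucc i.succ) (u ∘ Equiv.swap i.castSucc i.succ)
            (Function.update (Function.update k i.castSucc a) i.succ b ∘
              Equiv.swap i.castSucc i.succ, j)) = fun a b =>
      ℓ (Q.field (A i.castSucc) a (toC (u i.castSucc)) * Q.field (A i.succ) b (toC (u i.succ)) -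
        s • (Q.field (A i.succ) b (toC (u i.succ)) *
          Q.field (A i.castSucc) a (toC (u i.castSucc)))) := by
    funext a b
    rw [map_sub, map_smul, smul_eq_mul]
    congr 1
    · simp only [Theory.coef, Theory.word, hℓ, LinearMap.comp_apply, LinearMap.mulLeft_apply,
        LinearMap.mulRight_apply]
      rw [hXY _ fun l h1 h2 => by
        rw [Function.update_of_ne h2, Function.update_of_ne h1]]
      rw [Function.update_of_ne hne, Function.update_self, Function.update_self]
    · congr 1
      simp only [Theory.coef, Theory.word, hℓ, LinearMap.comp_apply, LinearMap.mulLeft_apply,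
        LinearMap.mulRight_apply]
      rw [hXY _ fun l h1 h2 => by
        simp only [Function.comp_apply]
        rw [Equiv.swap_apply_of_ne_of_ne h1 h2, Function.update_of_ne h2, Function.update_of_ne h1]]
      simp only [Function.comp_apply, Equiv.swap_apply_left, Equiv.swap_apply_right]
      rw [Function.update_of_ne hne, Function.update_self, Function.update_self]
  rw [h1]
  funext a b
  rw [← map_mulInterval_iterate]
  refine (congrArg ℓ (?_ : _ = (0 : Module.End ℂ Q.dom))).trans (map_zero ℓ)
  ext1 Ψ
  have h2 := congrFun (congrFun (hM (toC (u i.castSucc)) (toC (u i.succ)) Ψ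
    (by rw [sq_toC]; exact one_ne_zero) (by rw [sq_toC]; exact one_ne_zero)) a) b
  have h3 := map_mulInterval_iterate (LinearMap.applyₗ Ψ) (toC (u i.castSucc)) (toC (u i.succ)) M
    (fun a b => Q.field (A i.castSucc) a (toC (u i.castSucc)) *
      Q.field (A i.succ) b (toC (u i.succ)) - s • (Q.field (A i.succ) b (toC (u i.succ)) *
          Q.field (A i.castSucc) a (toC (u i.castSucc)))) a b
  exact h3.trans h2

/-! ### Grouping the thermal series by homogeneous degrees -/

lemma Theory.exists_finset_field (A : I) (k : ℤ) (u : USphere D) (Ψ : Q.dom) :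
    ∃ R : Finset (ℤ × ℕ), (∀ p ∈ R, 2 * p.1 + (p.2 : ℤ) = k) ∧
      (∀ p : ℤ × ℕ, 2 * p.1 + (p.2 : ℤ) = k → p ∉ R → Q.mode A p.1 p.2 (toC u) Ψ = 0) ∧
      Q.field A k (toC u) Ψ = ∑ p ∈ R, Q.mode A p.1 p.2 (toC u) Ψ := by
  classical
  obtain ⟨N, hN⟩ := Q.mode_bounded A Ψ
  refine ⟨(Finset.Icc (-(N : ℤ)) (k / 2)).image fun n => (n, (k - 2 * n).toNat), ?_, ?_, ?_⟩
  · intro p hp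
    obtain ⟨n, hn, rfl⟩ := Finset.mem_image.1 hp
    rw [Finset.mem_Icc] at hn
    simp only
    omega
  · rintro ⟨n, m⟩ hp hpR
    refine hN n ?_ m _
    simp only at hp
    by_contra hcon
    exact hpR (Finset.mem_image.2 ⟨n, Finset.mem_Icc.2 (by omega), by ext <;> simp; omega⟩)
  · rw [Finset.sum_image fun a _ b _ h => congrArg Prod.fst h, Q.field_apply,
      comp_eq_sum (N := N) (fun n hn m => hN n hn m _)]
    simp [sq_toC]

/-- Applied to one vector, the product of given components of fields involves finitely many modes. -/
lemma Theory.exists_finset_word_apply (A : Fin n → I) (u : Fin n → USphere D) (k : Fin n → ℤ)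
    (Ψ : Q.dom) : ∃ S : Finset (Fin n → ℤ × ℕ), (∀ x ∈ S, ∀ i, 2 * (x i).1 + ((x i).2 : ℤ) = k i) ∧
      (∀ x : Fin n → ℤ × ℕ, (∀ i, 2 * (x i).1 + ((x i).2 : ℤ) = k i) → x ∉ S →
        (List.ofFn fun i => Q.mode (A i) (x i).1 (x i).2 (toC (u i))).prod Ψ = 0) ∧
      Q.word A u k Ψ =
        ∑ x ∈ S, (List.ofFn fun i => Q.mode (A i) (x i).1 (x i).2 (toC (u i))).prod Ψ := by
  classical
  induction n with
  | zero =>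
    refine ⟨{Fin.elim0}, fun x _ i => i.elim0, fun x _ hx => ?_, by simp [Theory.word]⟩
    exact absurd (Finset.mem_singleton.2 (Subsingleton.elim _ _)) hx
  | succ n ih =>
    obtain ⟨S, h1, h2, h3⟩ := ih (A ∘ Fin.succ) (u ∘ Fin.succ) (k ∘ Fin.succ)
    choose R r1 r2 r3 using fun x : Fin n → ℤ × ℕ => Q.exists_finset_field (A 0) (k 0) (u 0)
      ((List.ofFn fun i => Q.mode (A (Fin.succ i)) (x i).1 (x i).2 (toC (u (Fin.succ i)))).prod Ψ)
    have hcons : ∀ x : Fin (n + 1) → ℤ × ℕ,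
        (List.ofFn fun i => Q.mode (A i) (x i).1 (x i).2 (toC (u i))).prod Ψ =
          Q.mode (A 0) (x 0).1 (x 0).2 (toC (u 0))
            ((List.ofFn fun i => Q.mode (A (Fin.succ i)) (x (Fin.succ i)).1 (x (Fin.succ i)).2
              (toC (u (Fin.succ i)))).prod Ψ) := fun x => by
      rw [List.ofFn_succ, List.prod_cons, Module.End.mul_apply]
    refine ⟨(S.sigma R).image fun q => Fin.cons q.2 q.1, ?_, ?_, ?_⟩
    · intro x hx i
      obtain ⟨⟨x', p⟩, hq, rfl⟩ := Finset.mem_image.1 hx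
      rw [Finset.mem_sigma] at hq
      refine Fin.cases ?_ (fun i => ?_) i
      · simpa using r1 _ _ hq.2
      · simpa using h1 _ hq.1 i
    · intro x hx hxS
      rw [hcons]
      by_cases hS : (fun i => x (Fin.succ i)) ∈ S
      · refine r2 (fun i => x (Fin.succ i)) (x 0) (hx 0) fun hR => hxS ?_
        refine Finset.mem_image.2 ⟨⟨_, x 0⟩, Finset.mem_sigma.2 ⟨hS, hR⟩, ?_⟩
        exact Fin.cons_self_tail x
      · have := h2 (fun i => x (Fin.succ i)) (fun i => hx i.succ) hS
        simp only [Function.comp_apply] at this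
        rw [this, map_zero]
    · rw [Finset.sum_image, Finset.sum_sigma, Q.word_succ, Module.End.mul_apply, h3, map_sum]
      · refine Finset.sum_congr rfl fun x _ => ?_
        rw [show (List.ofFn fun i => Q.mode ((A ∘ Fin.succ) i) (x i).1 (x i).2
          (toC ((u ∘ Fin.succ) i))).prod Ψ = (List.ofFn fun i => Q.mode (A (Fin.succ i)) (x i).1
          (x i).2 (toC (u (Fin.succ i)))).prod Ψ from rfl, r3 x]
        refine Finset.sum_congr rfl fun p _ => ?_
        rw [hcons]
        simp
      · rintro ⟨x, p⟩ _ ⟨x', p'⟩ _ h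
        obtain ⟨rfl, rfl⟩ := Fin.cons_inj.1 h
        rfl

lemma Theory.exists_finset_thermalCoeff_word (A : Fin n → I) (u : Fin n → USphere D)
    (k : Fin n → ℤ) (j : ℤ) :
    ∃ S : Finset (Fin n → ℤ × ℕ), (∀ x ∈ S, ∀ i, 2 * (x i).1 + ((x i).2 : ℤ) = k i) ∧
      (∀ x : Fin n → ℤ × ℕ, (∀ i, 2 * (x i).1 + ((x i).2 : ℤ) = k i) → x ∉ S →
        Q.thermalCoeff hQ j
          (List.ofFn fun i => Q.mode (A i) (x i).1 (x i).2 (toC (u i))).prod = 0) ∧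
      Q.coef hQ A u (k, j) = ∑ x ∈ S, Q.thermalCoeff hQ j
        (List.ofFn fun i => Q.mode (A i) (x i).1 (x i).2 (toC (u i))).prod := by
  classical
  obtain ⟨V, hV⟩ := Q.exists_finset_thermalCoeff hQ j
  choose S h1 h2 h3 using fun Ψ => Q.exists_finset_word_apply A u k Ψ
  refine ⟨V.biUnion S, fun x hx => ?_, fun x hx hxS => hV _ fun Ψ hΨ => ?_, ?_⟩
  · obtain ⟨Ψ, -, hΨ⟩ := Finset.mem_biUnion.1 hx
    exact h1 Ψ x hΨ
  · exact h2 Ψ x hx fun h => hxS (Finset.mem_biUnion.2 ⟨Ψ, hΨ, h⟩)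
  · rw [Theory.coef, ← map_sum, ← sub_eq_zero, ← map_sub]
    refine hV _ fun Ψ hΨ => ?_
    rw [LinearMap.sub_apply, LinearMap.sum_apply, h3 Ψ, sub_eq_zero]
    refine Finset.sum_subset (Finset.subset_biUnion_of_mem S hΨ) fun x hx hxS => ?_
    obtain ⟨Φ, -, hΦ⟩ := Finset.mem_biUnion.1 hx
    exact h2 Ψ x (h1 Φ x hΦ) hxS

/-- In the thermal domain the correlation function is the absolutely convergent sum of the series
of its coefficients. -/
lemma Theory.ConvergesToMeromorphic.hasSum_coef {A : Fin n → I} {u : Fin n → USphere D}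
    {f : (Fin n → ℂ) × ℂ → ℂ} (hf : Q.ConvergesToMeromorphic hQ A u f) {p : (Fin n → ℂ) × ℂ}
    (hp : p ∈ thermalDomain n) :
    Summable (fun y => ‖Q.coef hQ A u y * expTerm (fun i => Q.twiceDim (A i)) p y‖) ∧
      HasSum (fun y => Q.coef hQ A u y * expTerm (fun i => Q.twiceDim (A i)) p y) (f p) := by
  classical
  obtain ⟨hs, hsum⟩ := hf.2 p hp
  set g := Q.thermalTerm hQ A u p with hg
  set π : (Fin n → ℤ × ℕ) × ℕ → (Fin n → ℤ) × ℤ := fun x =>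
    (fun i => 2 * (x.1 i).1 + ((x.1 i).2 : ℤ), (x.2 : ℤ)) with hπ
  have hterm : ∀ x, g x = Q.thermalCoeff hQ (x.2 : ℤ)
      (List.ofFn fun i => Q.mode (A i) (x.1 i).1 (x.1 i).2 (toC (u i))).prod *
        expTerm (fun i => Q.twiceDim (A i)) p (π x) := by
    intro x
    rw [hg, Theory.thermalTerm, Q.thermalCoeff_natCast, mul_assoc, ← Complex.exp_add, expTerm]
    congr 2
    simp only [hπ, Q.dim_eq]
    push_cast
    rw [mul_add, add_comm, Finset.mul_sum, Finset.mul_sum]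
    congr 1
    · exact Finset.sum_congr rfl fun i _ => by ring
    · ring
  have hfib : ∀ y, HasSum (fun x : {x // π x = y} => g x)
      (Q.coef hQ A u y * expTerm (fun i => Q.twiceDim (A i)) p y) := by
    rintro ⟨k, j⟩
    refine (hasSum_subtype_iff_indicator (f := g) (s := {x | π x = (k, j)})).2 ?_
    rcases lt_or_ge j 0 with hj | hj
    · rw [Q.coef_eq_zero_of_neg hQ A u hj, zero_mul]
      have h0 : indicator {x | π x = (k, j)} g = fun _ => 0 := by
        funext x
        refine indicator_of_notMem (fun h => ?_) g
        have : ((x.2 : ℕ) : ℤ) = j := congrArg Prod.snd h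
        omega
      rw [h0]
      exact hasSum_zero
    · lift j to ℕ using hj
      obtain ⟨S, h1, h2, h3⟩ := Q.exists_finset_thermalCoeff_word hQ A u k j
      have hmem : ∀ x, π (x, j) = (k, (j : ℤ)) ↔ ∀ i, 2 * (x i).1 + ((x i).2 : ℤ) = k i := by
        intro x
        simp [hπ, funext_iff]
      have h4 : Q.coef hQ A u (k, (j : ℤ)) * expTerm (fun i => Q.twiceDim (A i)) p (k, (j : ℤ)) =
          ∑ x ∈ S.image fun x => (x, j), indicator {x | π x = (k, (j : ℤ))} g x := by
        rw [Finset.sum_image fun a _ b _ h => congrArg Prod.fst h, h3, Finset.sum_mul]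
        refine Finset.sum_congr rfl fun x hx => ?_
        have hx' := (hmem x).2 (h1 x hx)
        rw [indicator_of_mem (show (x, j) ∈ {x | π x = (k, (j : ℤ))} from hx'), hterm, hx']
      rw [h4]
      refine hasSum_sum_of_ne_finset_zero fun x hx => ?_
      by_cases hxm : π x = (k, (j : ℤ))
      · rw [indicator_of_mem (show x ∈ {x | π x = (k, (j : ℤ))} from hxm), hterm]
        obtain ⟨x, j'⟩ := x
        have : j' = j := by
          have : (j' : ℤ) = j := congrArg Prod.snd hxm
          exact_mod_cast this
        subst this
        rw [h2 x ((hmem x).1 hxm) fun h => hx (Finset.mem_image_of_mem _ h), zero_mul]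
      · exact indicator_of_notMem (s := {x | π x = (k, (j : ℤ))}) hxm g
  have hsig := ((Equiv.sigmaFiberEquiv π).hasSum_iff.2 hsum).sigma fun y => hfib y
  refine ⟨?_, hsig⟩
  have hns := (Equiv.sigmaFiberEquiv π).summable_iff.2 hs
  refine Summable.of_nonneg_of_le (fun y => norm_nonneg _) (fun y => ?_) hns.sigma
  rw [← (hfib y).tsum_eq]
  exact norm_tsum_le_tsum_norm (hns.sigma_factor y)

end Correlators

/-! ### Multiplication of multi-variable series by Laurent polynomials -/

section Laurent

variable {n : ℕ}

/-- Laurent polynomials in `z_k = e^{2π i ζ_k}`, `k = 1, …, n`. -/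
abbrev Laurent (n : ℕ) : Type := AddMonoidAlgebra ℂ (Fin n → ℤ)

/-- Multiplication of a series, given by its coefficients, by a monomial. -/
def shiftHom (n : ℕ) :
    Multiplicative (Fin n → ℤ) →* Module.End ℂ ((Fin n → ℤ) × ℤ → ℂ) where
  toFun v :=
    { toFun := fun c y => c (y.1 - v.toAdd, y.2)
      map_add' := fun _ _ => rfl
      map_smul' := fun _ _ => rfl }
  map_one' := by ext; simp
  map_mul' v w := by
    ext c y
    simp [sub_sub]

/-- Multiplication of a series, given by its coefficients, by a Laurent polynomial. -/
def act (n : ℕ) : Laurent n →ₐ[ℂ] Module.End ℂ ((Fin n → ℤ) × ℤ → ℂ) :=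
  AddMonoidAlgebra.lift ℂ _ _ (shiftHom n)

lemma act_single (v : Fin n → ℤ) (a : ℂ) (c : (Fin n → ℤ) × ℤ → ℂ) (y : (Fin n → ℤ) × ℤ) :
    act n (AddMonoidAlgebra.single v a) c y = a * c (y.1 - v, y.2) := by
  rw [act, AddMonoidAlgebra.lift_single]
  rfl

/-- The value of a Laurent polynomial at `z_k = e^{2π i ζ_k}`. -/
def evalAt (ζ : Fin n → ℂ) : Laurent n →ₐ[ℂ] ℂ :=
  AddMonoidAlgebra.lift ℂ _ _
    { toFun := fun v => Complex.exp (2 * Real.pi * Complex.I * ∑ i, (v.toAdd i : ℂ) * ζ i)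
      map_one' := by simp
      map_mul' := fun v w => by
        rw [← Complex.exp_add, ← mul_add, ← Finset.sum_add_distrib]
        simp [add_mul] }

lemma evalAt_single (ζ : Fin n → ℂ) (v : Fin n → ℤ) (a : ℂ) :
    evalAt ζ (AddMonoidAlgebra.single v a) =
      a * Complex.exp (2 * Real.pi * Complex.I * ∑ i, (v i : ℂ) * ζ i) := by
  rw [evalAt, AddMonoidAlgebra.lift_single]
  rfl

lemma expTerm_add (δ : Fin n → ℤ) (p : (Fin n → ℂ) × ℂ) (k v : Fin n → ℤ) (j : ℤ) :
    expTerm δ p (k + v, j) = expTerm δ p (k, j) *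
      Complex.exp (2 * Real.pi * Complex.I * ∑ i, (v i : ℂ) * p.1 i) := by
  rw [expTerm, expTerm, ← Complex.exp_add]
  congr 1
  have : ∑ i, ((δ i + 2 * (k + v) i : ℤ) : ℂ) * p.1 i =
      ∑ i, ((δ i + 2 * k i : ℤ) : ℂ) * p.1 i + 2 * ∑ i, (v i : ℂ) * p.1 i := by
    rw [Finset.mul_sum, ← Finset.sum_add_distrib]
    refine Finset.sum_congr rfl fun i _ => ?_
    push_cast [Pi.add_apply]
    ring
  simp only [this]
  ring

/-- Multiplying an absolutely convergent series by a Laurent polynomial multiplies its sum. -/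
lemma hasSum_act (δ : Fin n → ℤ) (p : (Fin n → ℂ) × ℂ) {c : (Fin n → ℤ) × ℤ → ℂ} {S : ℂ}
    (hs : Summable fun y => ‖c y * expTerm δ p y‖) (hS : HasSum (fun y => c y * expTerm δ p y) S)
    (r : Laurent n) : (Summable fun y => ‖act n r c y * expTerm δ p y‖) ∧
      HasSum (fun y => act n r c y * expTerm δ p y) (evalAt p.1 r * S) := by
  induction r using AddMonoidAlgebra.induction_linear with
  | zero => simp
  | add f g hf hg =>
    simp only [map_add, LinearMap.add_apply, Pi.add_apply, add_mul]
    exact ⟨Summable.of_nonneg_of_le (fun _ => norm_nonneg _) (fun _ => norm_add_le _ _)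
      (hf.1.add hg.1), hf.2.add hg.2⟩
  | single v a =>
    set e : (Fin n → ℤ) × ℤ ≃ (Fin n → ℤ) × ℤ := (Equiv.addRight v).prodCongr (Equiv.refl ℤ)
    set E := Complex.exp (2 * Real.pi * Complex.I * ∑ i, (v i : ℂ) * p.1 i) with hE
    have h1 : ∀ y, act n (AddMonoidAlgebra.single v a) c (e y) * expTerm δ p (e y) =
        a * E * (c y * expTerm δ p y) := by
      rintro ⟨k, j⟩
      have : e (k, j) = (k + v, j) := rfl
      rw [this, act_single, expTerm_add, ← hE]
      simp only [add_sub_cancel_right]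
      ring
    rw [evalAt_single, ← hE]
    refine ⟨e.summable_iff.1 ?_, e.hasSum_iff.1 ?_⟩
    · simp only [Function.comp_def, h1, norm_mul (a * E)]
      exact hs.mul_left _
    · simp only [Function.comp_def, h1]
      exact hS.mul_left _

/-- The Laurent polynomial `z_a / z_b - 2 g + z_b / z_a`. -/
def link (a b : Fin n) (g : ℂ) : Laurent n :=
  AddMonoidAlgebra.single (Pi.single a 1 - Pi.single b 1) 1 +
    AddMonoidAlgebra.single (Pi.single b 1 - Pi.single a 1) 1 -
      AddMonoidAlgebra.single 0 (2 * g)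

lemma link_comm (a b : Fin n) (g : ℂ) : link a b g = link b a g := by
  rw [link, link, add_comm (AddMonoidAlgebra.single (Pi.single a 1 - Pi.single b 1) _)]

lemma act_link (a b : Fin n) (g : ℂ) (c : (Fin n → ℤ) × ℤ → ℂ) (k : Fin n → ℤ) (j : ℤ) :
    act n (link a b g) c (k, j) = c (k - (Pi.single a 1 - Pi.single b 1), j) +
      c (k - (Pi.single b 1 - Pi.single a 1), j) - 2 * g * c (k, j) := by
  rw [link, map_sub, map_add]
  simp only [LinearMap.sub_apply, LinearMap.add_apply, Pi.sub_apply, Pi.add_apply, act_single,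
    one_mul, sub_zero]

lemma evalAt_link (a b : Fin n) (g : ℂ) (ζ : Fin n → ℂ) :
    evalAt ζ (link a b g) = Complex.exp (2 * Real.pi * Complex.I * (ζ a - ζ b)) +
      Complex.exp (-(2 * Real.pi * Complex.I * (ζ a - ζ b))) - 2 * g := by
  have h : ∀ a b : Fin n, ∑ i, (((Pi.single a 1 - Pi.single b 1 : Fin n → ℤ) i : ℤ) : ℂ) * ζ i =
      ζ a - ζ b := by
    intro a b
    simp [Pi.single_apply, sub_mul, Finset.sum_sub_distrib]
  rw [link, map_sub, map_add, evalAt_single, evalAt_single, evalAt_single, h, h]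
  simp only [one_mul, Pi.zero_apply, Int.cast_zero, zero_mul, Finset.sum_const_zero, mul_zero,
    Complex.exp_zero, mul_one]
  congr 3
  ring

/-- A series annihilated by a power of `(z_a - z_b)²`, where `z_a`, `z_b` run over the complex lines
through two unit vectors, is annihilated by the corresponding Laurent polynomial. -/
lemma act_link_pow_eq_zero {D : ℕ} (u v : USphere D) {a b : Fin n} (hab : a ≠ b) (M : ℕ)
    (y : (Fin n → ℤ) × ℤ → ℂ)
    (h : ∀ k j, (mulInterval (toC u) (toC v))^[M] (fun x x' =>
      y (Function.update (Function.update k a x) b x', j)) = 0) :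
    act n (link a b (dot (toC u) (toC v)) ^ M) y = 0 := by
  have hshift : ∀ (M : ℕ) (X : ℤ → ℤ → ℂ) (x x' : ℤ),
      (mulInterval (toC u) (toC v))^[M] (fun x x' => X (x + 1) (x' + 1)) x x' =
        (mulInterval (toC u) (toC v))^[M] X (x + 1) (x' + 1) := by
    intro M
    induction M with
    | zero => exact fun _ _ _ => rfl
    | succ M ih =>
      intro X x x'
      have h : (mulInterval (toC u) (toC v) fun x x' => X (x + 1) (x' + 1)) =
          fun x x' => mulInterval (toC u) (toC v) X (x + 1) (x' + 1) := by
        funext x x'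
        simp only [mulInterval]
        ring_nf
      rw [Function.iterate_succ_apply, Function.iterate_succ_apply, ← ih, h]
  have key : ∀ (M : ℕ) (y : (Fin n → ℤ) × ℤ → ℂ) (k : Fin n → ℤ) (j x x' : ℤ),
      act n (link a b (dot (toC u) (toC v)) ^ M) y
        (Function.update (Function.update k a x) b x', j) =
        (mulInterval (toC u) (toC v))^[M] (fun x x' =>
          y (Function.update (Function.update k a x) b x', j)) (x + M) (x' + M) := by
    intro M
    induction M with
    | zero => intro y k j x x'; simp
    | succ M ih =>
      intro y k j x x'
      rw [pow_succ, map_mul, Module.End.mul_apply, ih, Function.iterate_succ_apply]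
      have h1 : (fun x x' => act n (link a b (dot (toC u) (toC v))) y
          (Function.update (Function.update k a x) b x', j)) = fun x x' =>
          mulInterval (toC u) (toC v) (fun x x' =>
            y (Function.update (Function.update k a x) b x', j)) (x + 1) (x' + 1) := by
        funext x x'
        rw [act_link]
        have e1 : Function.update (Function.update k a x) b x' -
            (Pi.single a 1 - Pi.single b 1) =
              Function.update (Function.update k a (x - 1)) b (x' + 1) := by
          funext i
          by_cases hb : i = b
          · subst hb; simp [hab.symm]
          · by_cases ha : i = a
            · subst ha; simp [hab]
            · simp [hb, ha]
        have e2 : Function.update (Function.update k a x) b x' -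
            (Pi.single b 1 - Pi.single a 1) =
              Function.update (Function.update k a (x + 1)) b (x' - 1) := by
          funext i
          by_cases hb : i = b
          · subst hb; simp [hab.symm]
          · by_cases ha : i = a
            · subst ha; simp [hab]
            · simp [hb, ha]
        rw [e1, e2]
        simp only [mulInterval, sq_toC, smul_eq_mul, add_sub_cancel_right,
          show x + 1 - 2 = x - 1 by ring, show x' + 1 - 2 = x' - 1 by ring]
        ring
      rw [h1, hshift]
      push_cast
      rw [add_assoc, add_assoc]
  funext ⟨k, j⟩
  have := key M y k j (k a) (k b)
  rw [Function.update_eq_self, Function.update_eq_self, h k j] at this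
  exact this

/-- The product `∏_{a < b} (z_a / z_b - 2 u_a · u_b + z_b / z_a)^N`. -/
def links {D : ℕ} (u : Fin n → USphere D) (N : ℕ) : Laurent n :=
  ∏ x : Fin n × Fin n with x.1 < x.2, link x.1 x.2 (dot (toC (u x.1)) (toC (u x.2))) ^ N

lemma dot_comm {D : ℕ} (z w : Fin D → ℂ) : dot z w = dot w z :=
  Finset.sum_congr rfl fun _ _ => mul_comm _ _

lemma link_pow_dvd_links {D : ℕ} (u : Fin n → USphere D) (N : ℕ) {a b : Fin n} (hab : a ≠ b) :
    link a b (dot (toC (u a)) (toC (u b))) ^ N ∣ links u N := by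
  have key : ∀ x ∈ Finset.univ.filter (fun x : Fin n × Fin n => x.1 < x.2),
      link x.1 x.2 (dot (toC (u x.1)) (toC (u x.2))) ^ N ∣ links u N := fun x hx => by
    rw [links]
    exact Finset.dvd_prod_of_mem _ hx
  rcases lt_or_gt_of_ne hab with h | h
  · exact key (a, b) (Finset.mem_filter.2 ⟨Finset.mem_univ _, h⟩)
  · rw [link_comm, dot_comm]
    exact key (b, a) (Finset.mem_filter.2 ⟨Finset.mem_univ _, h⟩)

/-- A property of series which is stable under multiplication by one interval is stable under
multiplication by `links`. -/
lemma act_links_induction {D : ℕ} (u : Fin n → USphere D) (N : ℕ)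
    (P : ((Fin n → ℤ) × ℤ → ℂ) → Prop) (hP : ∀ a b g c, P c → P (act n (link a b g) c))
    {c : (Fin n → ℤ) × ℤ → ℂ} (hc : P c) : P (act n (links u N) c) := by
  classical
  rw [links]
  induction (Finset.univ.filter fun x : Fin n × Fin n => x.1 < x.2) using Finset.induction_on with
  | empty => simpa using hc
  | insert x s hx ih =>
    rw [Finset.prod_insert hx, map_mul, Module.End.mul_apply]
    generalize act n (∏ x ∈ s, link x.1 x.2 (dot (toC (u x.1)) (toC (u x.2))) ^ N) c = c' at ih
    induction N with
    | zero => simpa using ih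
    | succ N ihN =>
      rw [pow_succ', map_mul, Module.End.mul_apply]
      exact hP _ _ _ _ ihN

end Laurent

/-! ### Permutations of the fields -/

/-- The statistical sign changes by the sign of the exchanged pair under an exchange of neighbours. -/
lemma permSign_mul_swap {n : ℕ} (p : Fin (n + 1) → Fin 2) (σ : Equiv.Perm (Fin (n + 1)))
    (i : Fin n) : (-1 : ℂ) ^ permSign p (σ * Equiv.swap i.castSucc i.succ) =
      (-1) ^ ((p (σ i.castSucc) : ℕ) * (p (σ i.succ) : ℕ)) * (-1) ^ permSign p σ := by
  classical
  set s := Equiv.swap i.castSucc i.succ with hs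
  have hlt : i.castSucc < i.succ := Fin.castSucc_lt_succ
  set F : Equiv.Perm (Fin (n + 1)) → Fin (n + 1) × Fin (n + 1) → ℕ := fun σ x =>
    if σ x.2 < σ x.1 then (p (σ x.1) : ℕ) * (p (σ x.2) : ℕ) else 0 with hF
  have h1 : ∀ σ, permSign p σ = F σ (i.castSucc, i.succ) +
      ∑ x ∈ (Finset.univ.filter fun x : Fin (n + 1) × Fin (n + 1) => x.1 < x.2).erase
        (i.castSucc, i.succ), F σ x := by
    intro σ
    rw [Finset.add_sum_erase _ _ (by simp), permSign, ← Finset.filter_filter,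
      Finset.sum_filter]
  have hord : ∀ a b : Fin (n + 1), a < b → (a, b) ≠ (i.castSucc, i.succ) → s a < s b := by
    intro a b hab hne
    rw [hs, Equiv.swap_apply_def, Equiv.swap_apply_def]
    simp only [ne_eq, Prod.mk.injEq, Fin.ext_iff, Fin.val_castSucc, Fin.val_succ] at hne
    rw [Fin.lt_def] at hab
    split_ifs with c1 c2 c3 c4 c5 c6 <;>
      simp only [Fin.ext_iff, Fin.lt_def, Fin.val_castSucc, Fin.val_succ] at * <;> omega
  have h2 : ∑ x ∈ (Finset.univ.filter fun x : Fin (n + 1) × Fin (n + 1) => x.1 < x.2).erase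
        (i.castSucc, i.succ), F (σ * s) x =
      ∑ x ∈ (Finset.univ.filter fun x : Fin (n + 1) × Fin (n + 1) => x.1 < x.2).erase
        (i.castSucc, i.succ), F σ x := by
    refine Finset.sum_nbij' (fun x => (s x.1, s x.2)) (fun x => (s x.1, s x.2)) ?_ ?_ ?_ ?_ ?_
    all_goals
      rintro ⟨a, b⟩ hx
      simp only [Finset.mem_erase, Finset.mem_filter, Finset.mem_univ, true_and] at hx
    · simp only [Finset.mem_erase, Finset.mem_filter, Finset.mem_univ, true_and]
      refine ⟨fun h => ?_, hord a b hx.2 hx.1⟩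
      rw [Prod.mk.injEq] at h
      have e1 : a = i.succ := by
        rw [← Equiv.swap_apply_left i.castSucc i.succ, ← hs, ← h.1, hs, Equiv.swap_apply_self]
      have e2 : b = i.castSucc := by
        rw [← Equiv.swap_apply_right i.castSucc i.succ, ← hs, ← h.2, hs, Equiv.swap_apply_self]
      rw [e1, e2] at hx
      exact absurd hx.2 hlt.not_gt
    · simp only [Finset.mem_erase, Finset.mem_filter, Finset.mem_univ, true_and]
      refine ⟨fun h => ?_, hord a b hx.2 hx.1⟩
      rw [Prod.mk.injEq] at h
      have e1 : a = i.succ := by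
        rw [← Equiv.swap_apply_left i.castSucc i.succ, ← hs, ← h.1, hs, Equiv.swap_apply_self]
      have e2 : b = i.castSucc := by
        rw [← Equiv.swap_apply_right i.castSucc i.succ, ← hs, ← h.2, hs, Equiv.swap_apply_self]
      rw [e1, e2] at hx
      exact absurd hx.2 hlt.not_gt
    · simp [hs]
    · simp [hs]
    · rfl
  rw [h1, h1 σ, h2, pow_add, pow_add, ← mul_assoc]
  congr 1
  have hval : F (σ * s) (i.castSucc, i.succ) = if σ i.castSucc < σ i.succ then
      (p (σ i.castSucc) : ℕ) * (p (σ i.succ) : ℕ) else 0 := by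
    simp only [hF, hs, Equiv.Perm.mul_apply, Equiv.swap_apply_left, Equiv.swap_apply_right]
    rw [mul_comm]
  rw [hval]
  simp only [hF]
  have hne : σ i.castSucc ≠ σ i.succ := fun h => hlt.ne (σ.injective h)
  rcases lt_or_gt_of_ne hne with h | h
  · rw [if_pos h, if_neg h.not_gt, pow_zero, mul_one]
  · rw [if_neg h.not_gt, if_pos h, pow_zero, ← pow_add, ← two_mul, pow_mul]
    simp

section PermCoef

variable {D : ℕ} [NeZero D] {𝓗 : Type*} [NormedAddCommGroup 𝓗] [InnerProductSpace ℂ 𝓗]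
  {I : Type*} [Fintype I] [DecidableEq I] (Q : Theory D 𝓗 I) (hQ : Q.FiniteDegeneracy)

/-- `N` is an exponent of locality for all pairs of fields. -/
def Theory.IsLocalityExponent (N : ℕ) : Prop :=
  ∀ A B, ∀ (z w : Fin D → ℂ) (Ψ : Q.dom),
    sq z ≠ 0 → sq w ≠ 0 → (mulInterval z w)^[N] (fun k l =>
      Q.field A k z (Q.field B l w Ψ) - (-1 : ℂ) ^ ((Q.parity A : ℕ) * (Q.parity B : ℕ)) •
        Q.field B l w (Q.field A k z Ψ)) = 0

lemma Theory.exists_isLocalityExponent : ∃ N : ℕ, Q.IsLocalityExponent N := by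
  choose M hM using fun x : I × I => Q.locality_field x.1 x.2
  exact ⟨Finset.univ.sup M, fun A B => hM (A, B) _ (Finset.le_sup (Finset.mem_univ (A, B)))⟩

variable {n : ℕ}

/-- The coefficients of the correlation function of the permuted fields, with the degrees labelled
by the original fields. -/
def Theory.permCoef (A : Fin n → I) (u : Fin n → USphere D) (σ : Equiv.Perm (Fin n))
    (y : (Fin n → ℤ) × ℤ) : ℂ := Q.coef hQ (A ∘ σ) (u ∘ σ) (y.1 ∘ σ, y.2)

/-- After multiplication by enough intervals, the series of permuted correlation functions agree up
to the statistical sign. -/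
lemma Theory.act_links_permCoef {N : ℕ} (hN : Q.IsLocalityExponent N)
    (A : Fin n → I) (u : Fin n → USphere D) (σ : Equiv.Perm (Fin n)) :
    act n (links u N) (Q.permCoef hQ A u σ) =
      (-1 : ℂ) ^ permSign (Q.parity ∘ A) σ • act n (links u N) (Q.coef hQ A u) := by
  have hone : ∀ (n : ℕ) (A : Fin n → I) (u : Fin n → USphere D),
      act n (links u N) (Q.permCoef hQ A u 1) =
      (-1 : ℂ) ^ permSign (Q.parity ∘ A) 1 • act n (links u N) (Q.coef hQ A u) := by
    intro n A u
    have : permSign (Q.parity ∘ A) 1 = 0 := by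
      rw [permSign, Finset.filter_false_of_mem, Finset.sum_empty]
      rintro x - ⟨h1, h2⟩
      exact absurd h1 h2.not_gt
    rw [this, pow_zero, one_smul]
    rfl
  rcases n with _ | n
  · rw [Subsingleton.elim σ 1]
    exact hone _ _ _
  have hσ : σ ∈ Submonoid.closure
      (Set.range fun i : Fin n ↦ Equiv.swap i.castSucc i.succ) := by
    rw [Equiv.Perm.mclosure_swap_castSucc_succ]
    trivial
  induction hσ using Submonoid.closure_induction_right with
  | one => exact hone _ _ _
  | mul_right σ _ s hs ih =>
    obtain ⟨i, rfl⟩ := hs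
    simp only
    set τ : ℂ := (-1) ^ ((Q.parity (A (σ i.castSucc)) : ℕ) * (Q.parity (A (σ i.succ)) : ℕ)) with hτ
    have hττ : τ * τ = 1 := by
      rw [hτ, ← pow_add, ← two_mul, pow_mul]
      simp
    have hne : σ i.castSucc ≠ σ i.succ := fun h => (Fin.castSucc_lt_succ).ne (σ.injective h)
    have h1 : act (n + 1) (links u N) (Q.permCoef hQ A u σ -
        τ • Q.permCoef hQ A u (σ * Equiv.swap i.castSucc i.succ)) = 0 := by
      obtain ⟨r, hr⟩ := link_pow_dvd_links u N hne
      rw [hr, mul_comm, map_mul, Module.End.mul_apply,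
        act_link_pow_eq_zero (u (σ i.castSucc)) (u (σ i.succ)) hne N _ ?_, map_zero]
      intro k j
      have h2 := Q.coef_locality hQ (A ∘ σ) (u ∘ σ) i (hN _ _) (k ∘ σ) j
      have h3 : ∀ x x' : ℤ, Function.update (Function.update (k ∘ σ) i.castSucc x) i.succ x' =
          Function.update (Function.update k (σ i.castSucc) x) (σ i.succ) x' ∘ σ := fun x x' => by
        rw [Function.update_comp_eq_of_injective _ σ.injective,
          Function.update_comp_eq_of_injective _ σ.injective]
      simp only [h3] at h2
      exact h2
    rw [map_sub, map_smul, sub_eq_zero] at h1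
    have h4 := congrArg (fun c => τ • c) h1
    simp only [smul_smul, hττ, one_smul] at h4
    rw [← h4, ih, smul_smul, permSign_mul_swap]
    rfl

/-- Only modes of total energy zero contribute. -/
lemma Theory.coef_mem_energy (A : Fin n → I) (u : Fin n → USphere D) (N : ℕ)
    (y : (Fin n → ℤ) × ℤ) (hy : ∑ i, (Q.twiceDim (A i) + 2 * y.1 i) ≠ 0) :
    act n (links u N) (Q.coef hQ A u) y = 0 := by
  refine act_links_induction u N (fun c => ∀ y : (Fin n → ℤ) × ℤ,
    ∑ i, (Q.twiceDim (A i) + 2 * y.1 i) ≠ 0 → c y = 0) ?_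
    (fun y hy => Q.coef_eq_zero_of_sum_ne hQ A u hy) y hy
  rintro a b g c hc ⟨k, j⟩ hy
  have h : ∀ a b : Fin n, ∑ i, (Q.twiceDim (A i) + 2 * (k - (Pi.single a 1 - Pi.single b 1) : Fin n → ℤ) i) =
      ∑ i, (Q.twiceDim (A i) + 2 * k i) := by
    intro a b
    have : ∑ i, (Pi.single a 1 - Pi.single b 1 : Fin n → ℤ) i = 0 := by
      simp [Finset.sum_sub_distrib]
    rw [← sub_eq_zero, ← Finset.sum_sub_distrib]
    calc _ = ∑ i, (-2) * (Pi.single a 1 - Pi.single b 1 : Fin n → ℤ) i :=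
          Finset.sum_congr rfl fun i _ => by simp only [Pi.sub_apply]; ring
      _ = 0 := by rw [← Finset.mul_sum, this, mul_zero]
  rw [act_link, hc (_, j) (by rw [h]; exact hy), hc (_, j) (by rw [h]; exact hy), hc _ hy]
  ring

lemma Theory.act_coef_eq_zero_of_neg (A : Fin n → I) (u : Fin n → USphere D) (N : ℕ)
    (y : (Fin n → ℤ) × ℤ) (hy : y.2 < 0) : act n (links u N) (Q.coef hQ A u) y = 0 := by
  refine act_links_induction u N (fun c => ∀ y : (Fin n → ℤ) × ℤ, y.2 < 0 → c y = 0) ?_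
    (fun y hy => Q.coef_eq_zero_of_neg hQ A u hy) y hy
  rintro a b g c hc ⟨k, j⟩ hy
  have hj : j < 0 := hy
  rw [act_link, hc (_, j) hj, hc (_, j) hj, hc (k, j) hj]
  ring

/-- After multiplication by enough intervals, each power of `q` has a Laurent polynomial as
coefficient: the degree of each field is bounded below, because that field can be moved to the right
of all others, and the sum of all degrees is fixed. -/
lemma Theory.finite_support_act_coef {N : ℕ} (hN : Q.IsLocalityExponent N)
    (A : Fin n → I) (u : Fin n → USphere D) (j : ℤ) :
    {k : Fin n → ℤ | act n (links u N) (Q.coef hQ A u) (k, j) ≠ 0}.Finite := by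
  have hlow : ∀ a : Fin n, ∃ K : ℤ, ∀ k : Fin n → ℤ, k a < K →
      act n (links u N) (Q.coef hQ A u) (k, j) = 0 := by
    intro a
    rcases n with _ | n
    · exact a.elim0
    set σ := Equiv.swap (Fin.last n) a with hσ
    have hσa : σ (Fin.last n) = a := Equiv.swap_apply_left _ _
    have h1 : ∃ K : ℤ, ∀ k : Fin (n + 1) → ℤ, k a < K →
        act (n + 1) (links u N) (Q.permCoef hQ A u σ) (k, j) = 0 := by
      refine act_links_induction u N (fun c => ∃ K : ℤ, ∀ k : Fin (n + 1) → ℤ, k a < K →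
        c (k, j) = 0) ?_ ?_
      · rintro b b' g c ⟨K, hK⟩
        refine ⟨K - 1, fun k hk => ?_⟩
        have h : ∀ b b' : Fin (n + 1), (k - (Pi.single b 1 - Pi.single b' 1) : Fin (n + 1) → ℤ) a
            < K := by
          intro b b'
          simp only [Pi.sub_apply, Pi.single_apply]
          split_ifs <;> omega
        rw [act_link, hK _ (h _ _), hK _ (h _ _), hK _ (by omega)]
        ring
      · obtain ⟨K, hK⟩ := Q.exists_coef_eq_zero_of_last_lt hQ (A ∘ σ) (u ∘ σ) j
        exact ⟨K, fun k hk => hK _ (by simpa [hσa] using hk)⟩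
    obtain ⟨K, hK⟩ := h1
    refine ⟨K, fun k hk => ?_⟩
    have h2 := hK k hk
    rw [Q.act_links_permCoef hQ hN, Pi.smul_apply, smul_eq_mul] at h2
    exact (mul_eq_zero.1 h2).resolve_left (pow_ne_zero _ (by norm_num))
  choose K hK using hlow
  set S := ∑ i, Q.twiceDim (A i) with hS
  refine (Set.finite_Icc K fun _ : Fin n => |S| + 2 * ∑ b, |K b|).subset fun k hk => ?_
  have hge : ∀ a, K a ≤ k a := fun a => by
    by_contra h
    exact hk (hK a k (by omega))
  have hsum : S + 2 * ∑ i, k i = 0 := by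
    by_contra h
    refine hk (Q.coef_mem_energy hQ A u N (k, j) ?_)
    rwa [Finset.sum_add_distrib, ← Finset.mul_sum]
  refine ⟨hge, fun a => ?_⟩
  have h1 : k a + ∑ i ∈ Finset.univ.erase a, k i = ∑ i, k i :=
    Finset.add_sum_erase _ _ (Finset.mem_univ a)
  have h2 : ∑ i ∈ Finset.univ.erase a, -|K i| ≤ ∑ i ∈ Finset.univ.erase a, k i :=
    Finset.sum_le_sum fun i _ => (neg_abs_le (K i)).trans (hge i)
  have h3 : ∑ i ∈ Finset.univ.erase a, |K i| ≤ ∑ i, |K i| :=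
    Finset.sum_le_sum_of_subset_of_nonneg (Finset.erase_subset _ _) fun _ _ _ => abs_nonneg _
  have h4 : 0 ≤ ∑ i ∈ Finset.univ.erase a, |K i| := Finset.sum_nonneg fun _ _ => abs_nonneg _
  rw [Finset.sum_neg_distrib] at h2
  have h5 := neg_abs_le S
  have h6 := abs_nonneg S
  change k a ≤ |S| + 2 * ∑ b, |K b|
  omega

end PermCoef

/-! ### The tube around equal imaginary times -/

section Tube

variable {n : ℕ}

/-- The tube `|Im ζ_{jk}| < Im τ`, the interior of the closure of the union of the images of the
thermal domain under all permutations. -/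
def tube (n : ℕ) : Set ((Fin n → ℂ) × ℂ) :=
  {p | 0 < p.2.im ∧ ∀ j k : Fin n, (p.1 j).im - (p.1 k).im < p.2.im}

lemma isOpen_tube : IsOpen (tube n) := by
  simp only [tube, ofPred_and, ofPred_forall]
  refine IsOpen.inter (isOpen_lt (by fun_prop) (by fun_prop)) ?_
  exact isOpen_iInter_of_finite fun j => isOpen_iInter_of_finite fun k =>
    isOpen_lt (by fun_prop) (by fun_prop)

lemma convex_tube : Convex ℝ (tube n) := by
  rintro p ⟨hp, hp'⟩ q ⟨hq, hq'⟩ a b ha hb hab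
  have key : ∀ x y s t : ℝ, x < s → y < t → a * x + b * y < a * s + b * t := by
    intro x y s t h1 h2
    rcases ha.eq_or_lt with rfl | ha
    · have : b = 1 := by linarith
      subst this
      linarith
    · nlinarith [mul_lt_mul_of_pos_left h1 ha, mul_le_mul_of_nonneg_left h2.le hb]
  constructor
  · have := key _ _ _ _ hp hq
    simpa using this
  · intro j k
    have := key _ _ _ _ (hp' j k) (hq' j k)
    simp only [Prod.fst_add, Prod.smul_fst, Pi.add_apply, Pi.smul_apply, Complex.add_im,
      Complex.smul_im, smul_eq_mul, Prod.snd_add, Prod.smul_snd]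
    linarith

lemma tube_subset_timeDomain : tube n ⊆ timeDomain n := fun _ hp => hp.1

lemma isOpen_timeDomain : IsOpen (timeDomain n) := isOpen_lt (by fun_prop) (by fun_prop)

lemma convex_timeDomain : Convex ℝ (timeDomain n) := by
  have : timeDomain n = (Complex.imLm ∘ₗ LinearMap.snd ℝ (Fin n → ℂ) ℂ) ⁻¹' Ioi 0 := rfl
  rw [this]
  exact (convex_Ioi 0).linear_preimage _

lemma isOpen_thermalDomain : IsOpen (thermalDomain n) := by
  simp only [thermalDomain, ofPred_and, ofPred_forall]
  refine IsOpen.inter (isOpen_lt (by fun_prop) (by fun_prop)) ?_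
  exact isOpen_iInter_of_finite fun j => isOpen_iInter_of_finite fun k =>
    isOpen_iInter_of_finite fun _ => (isOpen_lt (by fun_prop) (by fun_prop)).inter
      (isOpen_lt (by fun_prop) (by fun_prop))

lemma thermalDomain_subset_timeDomain : thermalDomain n ⊆ timeDomain n := fun _ hp => hp.1

lemma thermalDomain_nonempty : (thermalDomain n).Nonempty := by
  refine ⟨(fun k => (k : ℂ) * Complex.I, (n + 1 : ℝ) * Complex.I), ?_, fun j k hjk => ?_⟩
  · simp only [Complex.im_ofReal_mul, Complex.I_im, mul_one]
    positivity
  · have h1 : ((j : ℕ) : ℝ) < (k : ℕ) := by exact_mod_cast hjk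
    have h2 : ((k : ℕ) : ℝ) < n := by exact_mod_cast k.2
    have h3 : (0 : ℝ) ≤ (j : ℕ) := by positivity
    have h4 : (-(((j : ℕ) : ℂ) * Complex.I - (k : ℕ) * Complex.I).im) = ((k : ℕ) : ℝ) - (j : ℕ) := by
      simp
    have h5 : (((n + 1 : ℝ) : ℂ) * Complex.I).im = n + 1 := by simp
    simp only [h4, h5]
    exact ⟨by linarith, by linarith⟩

/-- Permutation of the times, `(ζ, τ) ↦ (ζ ∘ σ, τ)`. -/
def permTimes (σ : Equiv.Perm (Fin n)) : ((Fin n → ℂ) × ℂ) ≃L[ℂ] ((Fin n → ℂ) × ℂ) :=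
  ((LinearEquiv.funCongrLeft ℂ ℂ σ).prodCongr (LinearEquiv.refl ℂ ℂ)).toContinuousLinearEquiv

@[simp] lemma permTimes_apply (σ : Equiv.Perm (Fin n)) (p : (Fin n → ℂ) × ℂ) :
    permTimes σ p = (p.1 ∘ σ, p.2) := rfl

lemma IsMeromorphic.comp_permTimes {f : (Fin n → ℂ) × ℂ → ℂ}
    (hf : IsMeromorphic f (timeDomain n)) (σ : Equiv.Perm (Fin n)) :
    IsMeromorphic (fun p => f (p.1 ∘ σ, p.2)) (timeDomain n) :=
  hf.comp_homeomorph (permTimes σ).toHomeomorph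
    ((permTimes σ : ((Fin n → ℂ) × ℂ) →L[ℂ] ((Fin n → ℂ) × ℂ)).analyticOnNhd univ)

/-- Points of the tube with different imaginary times lie in a permuted thermal domain. -/
lemma exists_perm_mem_thermalDomain {p : (Fin n → ℂ) × ℂ} (hp : p ∈ tube n)
    (hinj : Function.Injective fun k => (p.1 k).im) :
    ∃ σ : Equiv.Perm (Fin n), (p.1 ∘ σ, p.2) ∈ thermalDomain n := by
  refine ⟨Tuple.sort fun k => (p.1 k).im, hp.1, fun j k hjk => ?_⟩
  have h1 := (Tuple.monotone_sort fun k => (p.1 k).im).strictMono_of_injective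
    (hinj.comp (Equiv.injective _)) hjk
  simp only [Function.comp_apply, Complex.sub_im, neg_sub] at h1 ⊢
  exact ⟨by linarith, hp.2 _ _⟩

/-- Points with different imaginary times are generic. -/
lemma exists_perturbation {p : (Fin n → ℂ) × ℂ} (hp : p ∈ tube n) : ∃ v : Fin n → ℂ,
    ∀ s ∈ ({1, -1} : Set ℂ), (p.1 + s • v, p.2) ∈ tube n ∧
      Function.Injective fun k => ((p.1 + s • v) k).im := by
  have h1 : ∀ s : ℂ, ∀ᶠ ε : ℝ in 𝓝[>] 0,
      (p.1 + s • fun k : Fin n => (ε * (k : ℕ) : ℂ) * Complex.I, p.2) ∈ tube n := by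
    intro s
    refine nhdsWithin_le_nhds ?_
    have : ContinuousAt (fun ε : ℝ =>
      (p.1 + s • fun k : Fin n => (ε * (k : ℕ) : ℂ) * Complex.I, p.2)) 0 := by fun_prop
    refine this.eventually_mem (isOpen_tube.mem_nhds ?_)
    have : (fun k : Fin n => (((0 : ℝ) : ℂ) * (k : ℕ)) * Complex.I) = 0 := by funext; simp
    rw [this, smul_zero, add_zero]
    exact hp
  have h2 : ∀ s : ℝ, s ≠ 0 → ∀ᶠ ε : ℝ in 𝓝[>] 0, ∀ j k : Fin n, j ≠ k →
      (p.1 j).im - (p.1 k).im + ε * (s * ((j : ℕ) - (k : ℕ))) ≠ 0 := by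
    intro s hs
    rw [eventually_all]
    intro j
    rw [eventually_all]
    intro k
    rw [eventually_imp_distrib_left]
    intro hjk
    by_cases h0 : (p.1 j).im - (p.1 k).im = 0
    · filter_upwards [self_mem_nhdsWithin] with ε hε
      rw [h0, zero_add]
      refine mul_ne_zero (ne_of_gt hε) (mul_ne_zero hs (sub_ne_zero.2 ?_))
      exact_mod_cast fun h => hjk (Fin.ext h)
    · refine nhdsWithin_le_nhds ?_
      have : ContinuousAt (fun ε : ℝ =>
        (p.1 j).im - (p.1 k).im + ε * (s * ((j : ℕ) - (k : ℕ)))) 0 := by fun_prop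
      exact this.eventually_ne (by simpa using h0)
  obtain ⟨ε, h3, h4, h5, h6⟩ := ((h1 1).and ((h1 (-1)).and ((h2 1 one_ne_zero).and
    (h2 (-1) (by norm_num))))).exists
  refine ⟨fun k : Fin n => (ε * (k : ℕ) : ℂ) * Complex.I, fun s hs => ?_⟩
  rcases hs with rfl | rfl
  · refine ⟨h3, fun j k hjk => ?_⟩
    by_contra hne
    refine h5 j k hne ?_
    simp only [Pi.add_apply, one_smul, Complex.add_im] at hjk
    rw [← Complex.ofReal_natCast, ← Complex.ofReal_natCast, ← Complex.ofReal_mul,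
      ← Complex.ofReal_mul, Complex.im_ofReal_mul, Complex.im_ofReal_mul, Complex.I_im] at hjk
    linarith
  · refine ⟨h4, fun j k hjk => ?_⟩
    by_contra hne
    refine h6 j k hne ?_
    simp only [Pi.add_apply, neg_smul, one_smul, Pi.neg_apply, Complex.add_im,
      Complex.neg_im] at hjk
    rw [← Complex.ofReal_natCast, ← Complex.ofReal_natCast, ← Complex.ofReal_mul,
      ← Complex.ofReal_mul, Complex.im_ofReal_mul, Complex.im_ofReal_mul, Complex.I_im] at hjk
    linarith

end Tube

/-! ### Exponential series in the times -/

section Series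

variable {n : ℕ}

lemma expTerm_comp (δ : Fin n → ℤ) (p : (Fin n → ℂ) × ℂ) (σ : Equiv.Perm (Fin n))
    (k : Fin n → ℤ) (j : ℤ) :
    expTerm (δ ∘ σ) (p.1 ∘ σ, p.2) (k ∘ σ, j) = expTerm δ p (k, j) := by
  rw [expTerm, expTerm]
  congr 3
  exact Equiv.sum_comp σ fun i => ((δ i + 2 * k i : ℤ) : ℂ) * p.1 i

lemma expTerm_mul_expTerm_neg (δ : Fin n → ℤ) (ζ v : Fin n → ℂ) (τ : ℂ) (y : (Fin n → ℤ) × ℤ) :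
    expTerm δ (ζ + v, τ) y * expTerm δ (ζ + -v, τ) y = expTerm δ (ζ, τ) y ^ 2 := by
  rw [expTerm, expTerm, expTerm, ← Complex.exp_add, ← Complex.exp_nat_mul]
  congr 1
  simp only [Pi.add_apply, mul_add, Finset.sum_add_distrib, Pi.neg_apply, mul_neg,
    Finset.sum_neg_distrib]
  push_cast
  ring

/-- Absolute convergence at two points implies absolute convergence at their midpoint. -/
lemma summable_expTerm_midpoint {δ : Fin n → ℤ} {b : (Fin n → ℤ) × ℤ → ℂ} {ζ v : Fin n → ℂ}
    {τ : ℂ} (h₁ : Summable fun y => ‖b y * expTerm δ (ζ + v, τ) y‖)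
    (h₂ : Summable fun y => ‖b y * expTerm δ (ζ + -v, τ) y‖) :
    Summable fun y => ‖b y * expTerm δ (ζ, τ) y‖ := by
  refine Summable.of_nonneg_of_le (fun _ => norm_nonneg _) (fun y => ?_) (h₁.add h₂)
  have h : ‖b y * expTerm δ (ζ, τ) y‖ ^ 2 =
      ‖b y * expTerm δ (ζ + v, τ) y‖ * ‖b y * expTerm δ (ζ + -v, τ) y‖ := by
    rw [← norm_mul, ← norm_pow, mul_mul_mul_comm, expTerm_mul_expTerm_neg, mul_pow, pow_two (b y)]
  refine abs_le_of_sq_le_sq' ?_ (by positivity) |>.2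
  rw [h]
  nlinarith [norm_nonneg (b y * expTerm δ (ζ + v, τ) y),
    norm_nonneg (b y * expTerm δ (ζ + -v, τ) y),
    mul_nonneg (norm_nonneg (b y * expTerm δ (ζ + v, τ) y))
      (norm_nonneg (b y * expTerm δ (ζ + -v, τ) y))]

/-- The linear function `π i (∑ a_k ζ_k + b τ)`. -/
def phase (a : Fin n → ℤ) (b : ℤ) : ((Fin n → ℂ) × ℂ) →L[ℂ] ℂ :=
  (Real.pi * Complex.I : ℂ) • (∑ i, ((a i : ℤ) : ℂ) •
    (ContinuousLinearMap.proj i ∘L ContinuousLinearMap.fst ℂ (Fin n → ℂ) ℂ) +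
      (b : ℂ) • ContinuousLinearMap.snd ℂ (Fin n → ℂ) ℂ)

lemma phase_apply (a : Fin n → ℤ) (b : ℤ) (p : (Fin n → ℂ) × ℂ) :
    phase a b p = Real.pi * Complex.I * (∑ i, (a i : ℂ) * p.1 i + b * p.2) := by
  simp [phase, mul_add]

lemma norm_le_sum_basis (L : ((Fin n → ℂ) × ℂ) →L[ℂ] ℂ) :
    ‖L‖ ≤ ∑ k : Option (Fin n),
      ‖L (k.elim ((0 : Fin n → ℂ), (1 : ℂ)) fun i => (Pi.single i 1, 0))‖ := by
  refine L.opNorm_le_bound (Finset.sum_nonneg fun _ _ => norm_nonneg _) fun p => ?_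
  have h : p = p.2 • ((0 : Fin n → ℂ), (1 : ℂ)) +
      ∑ i, p.1 i • ((Pi.single i 1, 0) : (Fin n → ℂ) × ℂ) := by
    refine Prod.ext ?_ ?_
    · simp only [Prod.fst_add, Prod.smul_fst, Prod.fst_sum, smul_zero, zero_add]
      funext j
      simp [Finset.sum_apply, Pi.single_apply]
    · simp [Prod.snd_sum]
  have hb : ∀ i, ‖p.1 i‖ ≤ ‖p‖ := fun i => (norm_le_pi_norm p.1 i).trans (norm_fst_le p)
  conv_lhs => rw [h]
  rw [map_add, map_sum, Fintype.sum_option, add_mul, Finset.sum_mul]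
  refine (norm_add_le _ _).trans (add_le_add ?_ ((norm_sum_le _ _).trans
    (Finset.sum_le_sum fun i _ => ?_)))
  · rw [map_smul, norm_smul, mul_comm]
    exact mul_le_mul_of_nonneg_left (norm_snd_le p) (norm_nonneg _)
  · rw [map_smul, norm_smul, mul_comm]
    exact mul_le_mul_of_nonneg_left (hb i) (norm_nonneg _)

/-- An absolutely convergent series of exponentials of the times is holomorphic. -/
lemma analyticOnNhd_tsum_phase {ι : Type*} (c : ι → ℂ) (a : ι → Fin n → ℤ) (b : ι → ℤ)
    {U : Set ((Fin n → ℂ) × ℂ)} (hU : IsOpen U)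
    (hs : ∀ p ∈ U, Summable fun i => ‖c i * Complex.exp (phase (a i) (b i) p)‖) :
    AnalyticOnNhd ℂ (fun p => ∑' i, c i * Complex.exp (phase (a i) (b i) p)) U :=
  analyticOnNhd_tsum_exp _ norm_le_sum_basis c (fun i => phase (a i) (b i)) U hU hs

lemma expTerm_eq_exp_phase (δ : Fin n → ℤ) (p : (Fin n → ℂ) × ℂ) (y : (Fin n → ℤ) × ℤ) :
    expTerm δ p y = Complex.exp (phase (fun i => δ i + 2 * y.1 i) y.2 p) := by
  rw [phase_apply]
  rfl

lemma evalAt_analytic (r : Laurent n) (U : Set ((Fin n → ℂ) × ℂ)) :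
    AnalyticOnNhd ℂ (fun p : (Fin n → ℂ) × ℂ => evalAt p.1 r) U := by
  induction r using AddMonoidAlgebra.induction_linear with
  | zero => simpa using analyticOnNhd_const
  | add f g hf hg => 
    simp only [map_add]
    exact hf.add hg
  | single v a =>
    have : (fun p : (Fin n → ℂ) × ℂ => evalAt p.1 (AddMonoidAlgebra.single v a)) =
        fun p => a * Complex.exp (((2 : ℂ) • phase v 0) p) := by
      funext p
      rw [evalAt_single, smul_apply, phase_apply]
      simp only [Int.cast_zero, zero_mul, add_zero, smul_eq_mul, mul_assoc]
    rw [this]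
    exact analyticOnNhd_const.mul
      ((((2 : ℂ) • phase v 0 : ((Fin n → ℂ) × ℂ) →L[ℂ] ℂ).analyticOnNhd U).cexp)

lemma evalAt_links {D : ℕ} (u : Fin n → USphere D) (N : ℕ) (ζ : Fin n → ℂ) :
    evalAt ζ (links u N) = (∏ x : Fin n × Fin n with x.1 < x.2,
      (Complex.exp (2 * Real.pi * Complex.I * (ζ x.1 - ζ x.2)) +
        Complex.exp (-(2 * Real.pi * Complex.I * (ζ x.1 - ζ x.2))) -
          2 * dot (toC (u x.1)) (toC (u x.2)))) ^ N := by
  rw [links, map_prod, ← Finset.prod_pow]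
  exact Finset.prod_congr rfl fun x _ => by rw [map_pow, evalAt_link]

end Series

lemma dot_toC {D : ℕ} (u v : USphere D) :
    dot (toC u) (toC v) = ((inner ℝ (u : EuclideanSpace ℝ (Fin D)) v : ℝ) : ℂ) := by
  rw [PiLp.inner_apply]
  push_cast
  refine Finset.sum_congr rfl fun i _ => ?_
  simp [toC, mul_comm]

lemma abs_inner_le_one {D : ℕ} (u v : USphere D) :
    |inner ℝ (u : EuclideanSpace ℝ (Fin D)) (v : EuclideanSpace ℝ (Fin D))| ≤ 1 := by
  refine (abs_real_inner_le_norm _ _).trans ?_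
  simp

/-- The product of intervals does not vanish identically. -/
lemma exists_evalAt_links_ne_zero {n D : ℕ} (u : Fin n → USphere D) (N : ℕ) :
    ∃ ζ : Fin n → ℂ, evalAt ζ (links u N) ≠ 0 := by
  refine ⟨fun k => (k : ℕ) * Complex.I, ?_⟩
  rw [evalAt_links]
  refine pow_ne_zero _ (Finset.prod_ne_zero_iff.2 fun x hx => ?_)
  have hx' : ((x.1 : ℕ) : ℝ) < (x.2 : ℕ) := by exact_mod_cast (Finset.mem_filter.1 hx).2
  set t : ℝ := 2 * Real.pi * ((x.2 : ℕ) - (x.1 : ℕ)) with ht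
  have htpos : 0 < t := mul_pos Real.two_pi_pos (by linarith)
  have h1 : 2 * Real.pi * Complex.I * (((x.1 : ℕ) : ℂ) * Complex.I - ((x.2 : ℕ) : ℂ) * Complex.I)
      = (t : ℂ) := by
    rw [ht]
    push_cast
    linear_combination (2 * Real.pi * (((x.1 : ℕ) : ℂ) - ((x.2 : ℕ) : ℂ))) * Complex.I_mul_I
  rw [h1, dot_toC]
  have h2 : (Complex.exp (t : ℂ) + Complex.exp (-(t : ℂ)) - 2 * ((inner ℝ
      (u x.1 : EuclideanSpace ℝ (Fin D)) (u x.2 : EuclideanSpace ℝ (Fin D)) : ℝ) : ℂ)) =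
      ((Real.exp t + Real.exp (-t) - 2 * inner ℝ
        (u x.1 : EuclideanSpace ℝ (Fin D)) (u x.2 : EuclideanSpace ℝ (Fin D)) : ℝ) : ℂ) := by
    push_cast
    rfl
  rw [h2, Complex.ofReal_ne_zero]
  have h3 := (abs_le.1 (abs_inner_le_one (u x.1) (u x.2))).2
  have h4 : 1 < Real.exp t := Real.one_lt_exp_iff.2 htpos
  have h5 : Real.exp t * Real.exp (-t) = 1 := by rw [← Real.exp_add]; simp
  nlinarith [sq_nonneg (Real.exp t - 1), Real.exp_pos (-t), Real.exp_pos t]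

lemma subset_closure_evalAt_links_ne_zero {n D : ℕ} (u : Fin n → USphere D) (N : ℕ) :
    timeDomain n ⊆ closure {p ∈ timeDomain n | evalAt p.1 (links u N) ≠ 0} := by
  obtain ⟨ζ, hζ⟩ := exists_evalAt_links_ne_zero u N
  exact (evalAt_analytic (links u N) (timeDomain n)).subset_closure_ne_zero isOpen_timeDomain
    convex_timeDomain.isPreconnected (x₀ := (ζ, Complex.I)) (by simp [timeDomain]) hζ

lemma IsMeromorphic.mono {E : Type*} [NormedAddCommGroup E] [NormedSpace ℂ E] {f : E → ℂ}
    {U V : Set E} (hf : IsMeromorphic f U) (hV : IsOpen V) (hVU : V ⊆ U) : IsMeromorphic f V := by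
  intro x hx
  obtain ⟨O, hO, hxO, -, g, h, hg, hh, hd, he⟩ := hf x (hVU hx)
  refine ⟨O ∩ V, hO.inter hV, ⟨hxO, hx⟩, inter_subset_right, g, h, hg.mono inter_subset_left,
    hh.mono inter_subset_left, fun y hy => ?_, fun y hy => he y hy.1⟩
  rw [mem_closure_iff]
  intro W hW hyW
  obtain ⟨z, hz, hzO, hz'⟩ := mem_closure_iff.1 (hd hy.1) (W ∩ V) (hW.inter hV) ⟨hyW, hy.2⟩
  exact ⟨z, hz.1, ⟨hzO, hz.2⟩, hz'⟩

/-! ### Convergence in the tube and permutations of the fields -/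

section Symmetry

variable {D : ℕ} [NeZero D] {𝓗 : Type*} [NormedAddCommGroup 𝓗] [InnerProductSpace ℂ 𝓗]
  {I : Type*} [Fintype I] [DecidableEq I] (Q : Theory D 𝓗 I) (hQ : Q.FiniteDegeneracy) {n : ℕ}

/-- The coefficients of the product of the correlation function with `N`-th powers of the compact
picture intervals of all pairs of points. -/
def Theory.redCoef (N : ℕ) (A : Fin n → I) (u : Fin n → USphere D) : (Fin n → ℤ) × ℤ → ℂ :=
  act n (links u N) (Q.coef hQ A u)

/-- The sum of the series with coefficients `Theory.redCoef`. -/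
def Theory.redSum (N : ℕ) (A : Fin n → I) (u : Fin n → USphere D) (p : (Fin n → ℂ) × ℂ) : ℂ :=
  ∑' y, Q.redCoef hQ N A u y * expTerm (fun i => Q.twiceDim (A i)) p y

variable {f : (Fin n → I) → (Fin n → USphere D) → (Fin n → ℂ) × ℂ → ℂ}

lemma Theory.hasSum_permCoef (hf : ∀ A u, Q.ConvergesToMeromorphic hQ A u (f A u))
    (A : Fin n → I) (u : Fin n → USphere D) (σ : Equiv.Perm (Fin n)) {p : (Fin n → ℂ) × ℂ}
    (hp : (p.1 ∘ σ, p.2) ∈ thermalDomain n) :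
    Summable (fun y => ‖Q.permCoef hQ A u σ y * expTerm (fun i => Q.twiceDim (A i)) p y‖) ∧
      HasSum (fun y => Q.permCoef hQ A u σ y * expTerm (fun i => Q.twiceDim (A i)) p y)
        (f (A ∘ σ) (u ∘ σ) (p.1 ∘ σ, p.2)) := by
  set e : (Fin n → ℤ) × ℤ ≃ (Fin n → ℤ) × ℤ :=
    (σ.symm.arrowCongr (Equiv.refl ℤ)).prodCongr (Equiv.refl ℤ)
  have h := (hf (A ∘ σ) (u ∘ σ)).hasSum_coef Q hQ hp
  have key : ∀ y, Q.coef hQ (A ∘ σ) (u ∘ σ) (e y) *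
      expTerm (fun i => Q.twiceDim ((A ∘ σ) i)) (p.1 ∘ σ, p.2) (e y) =
      Q.permCoef hQ A u σ y * expTerm (fun i => Q.twiceDim (A i)) p y := fun y => by
    congr 1
    exact expTerm_comp (fun i => Q.twiceDim (A i)) p σ y.1 y.2
  constructor
  · rw [← e.summable_iff] at h
    refine h.1.congr fun y => ?_
    rw [Function.comp_apply, key]
  · rw [← e.hasSum_iff] at h
    refine h.2.congr_fun fun y => ?_
    rw [Function.comp_apply, key]

/-- The series `Theory.redCoef` converges absolutely in every permuted copy of the thermal domain, to
the product of the intervals with the permuted correlation function. -/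
lemma Theory.hasSum_redCoef (hf : ∀ A u, Q.ConvergesToMeromorphic hQ A u (f A u)) {N : ℕ}
    (hN : Q.IsLocalityExponent N)
    (A : Fin n → I) (u : Fin n → USphere D) (σ : Equiv.Perm (Fin n)) {p : (Fin n → ℂ) × ℂ}
    (hp : (p.1 ∘ σ, p.2) ∈ thermalDomain n) :
    Summable (fun y => ‖Q.redCoef hQ N A u y * expTerm (fun i => Q.twiceDim (A i)) p y‖) ∧
      HasSum (fun y => Q.redCoef hQ N A u y * expTerm (fun i => Q.twiceDim (A i)) p y)
        ((-1) ^ permSign (Q.parity ∘ A) σ *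
          (evalAt p.1 (links u N) * f (A ∘ σ) (u ∘ σ) (p.1 ∘ σ, p.2))) := by
  have h := Q.hasSum_permCoef hQ hf A u σ hp
  have h1 := hasSum_act _ p h.1 h.2 (links u N)
  rw [Q.act_links_permCoef hQ hN] at h1
  have key : ∀ y, Q.redCoef hQ N A u y * expTerm (fun i => Q.twiceDim (A i)) p y =
      (-1) ^ permSign (Q.parity ∘ A) σ * (((-1 : ℂ) ^ permSign (Q.parity ∘ A) σ •
        act n (links u N) (Q.coef hQ A u)) y * expTerm (fun i => Q.twiceDim (A i)) p y) := by
    intro y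
    rw [Pi.smul_apply, smul_eq_mul, ← mul_assoc, ← mul_assoc, ← pow_add, ← two_mul, pow_mul,
      neg_one_sq, one_pow, one_mul]
    rfl
  simp only [key]
  refine ⟨?_, h1.2.mul_left _⟩
  simp only [norm_mul ((-1 : ℂ) ^ _)]
  exact h1.1.mul_left _

/-- The product of the correlation function with sufficiently many intervals converges absolutely in
the whole tube. -/
lemma Theory.summable_redCoef (hf : ∀ A u, Q.ConvergesToMeromorphic hQ A u (f A u)) {N : ℕ}
    (hN : Q.IsLocalityExponent N) (A : Fin n → I) (u : Fin n → USphere D)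
    {p : (Fin n → ℂ) × ℂ} (hp : p ∈ tube n) :
    Summable (fun y => ‖Q.redCoef hQ N A u y * expTerm (fun i => Q.twiceDim (A i)) p y‖) := by
  obtain ⟨v, hv⟩ := exists_perturbation hp
  obtain ⟨h1, h1'⟩ := hv 1 (by simp)
  obtain ⟨h2, h2'⟩ := hv (-1) (by simp)
  obtain ⟨σ, hσ⟩ := exists_perm_mem_thermalDomain h1 h1'
  obtain ⟨σ', hσ'⟩ := exists_perm_mem_thermalDomain h2 h2'
  have s1 := (Q.hasSum_redCoef hQ hf hN A u σ hσ).1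
  have s2 := (Q.hasSum_redCoef hQ hf hN A u σ' hσ').1
  rw [one_smul] at s1
  rw [neg_one_smul] at s2
  exact summable_expTerm_midpoint s1 s2

lemma Theory.analyticOnNhd_redSum (hf : ∀ A u, Q.ConvergesToMeromorphic hQ A u (f A u)) {N : ℕ}
    (hN : Q.IsLocalityExponent N) (A : Fin n → I) (u : Fin n → USphere D) :
    AnalyticOnNhd ℂ (Q.redSum hQ N A u) (tube n) := by
  have h := analyticOnNhd_tsum_phase (Q.redCoef hQ N A u)
    (fun y i => Q.twiceDim (A i) + 2 * y.1 i) (fun y => y.2) isOpen_tube (fun p hp => by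
      simpa only [expTerm_eq_exp_phase] using Q.summable_redCoef hQ hf hN A u hp)
  have he : Q.redSum hQ N A u = fun p => ∑' y, Q.redCoef hQ N A u y *
      Complex.exp (phase (fun i => Q.twiceDim (A i) + 2 * y.1 i) y.2 p) := by
    funext p
    simp only [Theory.redSum, expTerm_eq_exp_phase]
  rwa [he]

/-- In the tube, the permuted correlation functions are continued by the same holomorphic function,
after multiplication by sufficiently many intervals. -/
lemma Theory.meroEq_redSum (hf : ∀ A u, Q.ConvergesToMeromorphic hQ A u (f A u)) {N : ℕ}
    (hN : Q.IsLocalityExponent N) (A : Fin n → I) (u : Fin n → USphere D)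
    (σ : Equiv.Perm (Fin n)) :
    MeroEq (tube n) (fun p => evalAt p.1 (links u N) * f (A ∘ σ) (u ∘ σ) (p.1 ∘ σ, p.2))
      (fun p => (-1) ^ permSign (Q.parity ∘ A) σ * Q.redSum hQ N A u p) := by
  have hsub : permTimes σ ⁻¹' thermalDomain n ⊆ tube n := by
    rintro p ⟨h0, h⟩
    refine ⟨h0, fun j k => ?_⟩
    rcases lt_trichotomy (σ.symm j) (σ.symm k) with hjk | hjk | hjk
    · have := h _ _ hjk
      simp only [permTimes_apply, Function.comp_apply, Equiv.apply_symm_apply, Complex.sub_im]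
        at this h0
      linarith
    · rw [σ.symm.injective hjk, sub_self]
      exact h0
    · have := h _ _ hjk
      simp only [permTimes_apply, Function.comp_apply, Equiv.apply_symm_apply, Complex.sub_im]
        at this h0
      linarith
  have hne : (permTimes σ ⁻¹' thermalDomain n).Nonempty := by
    obtain ⟨p, hp⟩ := thermalDomain_nonempty (n := n)
    exact ⟨(permTimes σ).symm p, by simpa only [mem_preimage, ContinuousLinearEquiv.apply_symm_apply]⟩
  refine IsMeromorphic.meroEq_of_eqOn isOpen_tube convex_tube.isPreconnected
    (IsMeromorphic.analytic_mul (evalAt_analytic _ _)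
      (((hf _ _).1.comp_permTimes σ).mono isOpen_tube tube_subset_timeDomain))
    ((analyticOnNhd_const.mul (Q.analyticOnNhd_redSum hQ hf hN A u)).isMeromorphic isOpen_tube)
    (isOpen_thermalDomain.preimage (permTimes σ).continuous) hne hsub fun p hp => ?_
  have h := (Q.hasSum_redCoef hQ hf hN A u σ hp).2.tsum_eq
  simp only [Theory.redSum]
  rw [h, ← mul_assoc, ← pow_add, ← two_mul, pow_mul, neg_one_sq, one_pow, one_mul]

/-- Symmetry of the correlation functions under permutations, up to the statistical sign. -/
lemma Theory.meroEq_perm (hf : ∀ A u, Q.ConvergesToMeromorphic hQ A u (f A u))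
    (A : Fin n → I) (u : Fin n → USphere D) (σ : Equiv.Perm (Fin n)) :
    MeroEq (timeDomain n) (fun p => f (A ∘ σ) (u ∘ σ) (p.1 ∘ σ, p.2))
      (fun p => (-1 : ℂ) ^ permSign (Q.parity ∘ A) σ * f A u p) := by
  obtain ⟨N, hN⟩ := Q.exists_isLocalityExponent
  obtain ⟨W, hW, hWU, hd, he⟩ := (Q.meroEq_redSum hQ hf hN A u σ).map₂
    (h := fun p => evalAt p.1 (links u N) * f (A ∘ σ) (u ∘ σ) (p.1 ∘ σ, p.2))
    (h' := fun p => evalAt p.1 (links u N) * ((-1 : ℂ) ^ permSign (Q.parity ∘ A) σ * f A u p))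
    (Q.meroEq_redSum hQ hf hN A u 1) fun p _ h1 h2 => by
      have h3 : permSign (Q.parity ∘ A) 1 = 0 := by
        rw [permSign, Finset.filter_false_of_mem, Finset.sum_empty]
        rintro x - ⟨h1, h2⟩
        exact absurd h1 h2.not_gt
      rw [h3, pow_zero, one_mul] at h2
      have h2' : evalAt p.1 (links u N) * f A u p = Q.redSum hQ N A u p := h2
      rw [h1, mul_left_comm, h2']
  have hne : (tube n).Nonempty := by
    refine ⟨(0, Complex.I), ?_, fun j k => ?_⟩ <;> simp
  refine IsMeromorphic.meroEq_of_eqOn isOpen_timeDomain convex_timeDomain.isPreconnected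
    ((hf _ _).1.comp_permTimes σ) (IsMeromorphic.analytic_mul analyticOnNhd_const (hf A u).1)
    (O := W ∩ {p | evalAt p.1 (links u N) ≠ 0})
    (hW.inter (isOpen_ne_fun ((continuousOn_univ).1 (evalAt_analytic _ univ).continuousOn)
      continuous_const)) ?_ (fun p hp => tube_subset_timeDomain (hWU hp.1))
    fun p hp => mul_left_cancel₀ hp.2 (he hp.1)
  obtain ⟨p, hp⟩ := hne
  obtain ⟨q, hq, hqW⟩ := mem_closure_iff.1 (hd hp) univ isOpen_univ trivial
  obtain ⟨r, hr, hr'⟩ := mem_closure_iff.1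
    (subset_closure_evalAt_links_ne_zero u N (tube_subset_timeDomain (hWU hqW))) W hW hqW
  exact ⟨r, hr, hr'.2⟩

end Symmetry

/-! ### Double periodicity of the correlation functions -/

section Shift

variable {n : ℕ}

/-- The translation `ζ_k ↦ ζ_k + l_k (a + b τ)` of the times by periods. -/
def shiftTimes (a b : ℂ) (l : Fin n → ℤ) : ((Fin n → ℂ) × ℂ) ≃ₜ ((Fin n → ℂ) × ℂ) where
  toFun p := (fun k => p.1 k + l k * (a + b * p.2), p.2)
  invFun p := (fun k => p.1 k - l k * (a + b * p.2), p.2)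
  left_inv p := by simp
  right_inv p := by simp
  continuous_toFun := by fun_prop
  continuous_invFun := by fun_prop

lemma shiftTimes_apply (a b : ℂ) (l : Fin n → ℤ) (p : (Fin n → ℂ) × ℂ) :
    shiftTimes a b l p = (fun k => p.1 k + l k * (a + b * p.2), p.2) := rfl

lemma analyticOnNhd_shiftTimes (a b : ℂ) (l : Fin n → ℤ) :
    AnalyticOnNhd ℂ (shiftTimes a b l) univ := by
  have h : ⇑(shiftTimes a b l) = fun p => ((ContinuousLinearMap.id ℂ _ +
      (ContinuousLinearMap.pi fun k => ((l k * b : ℂ) •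
        ContinuousLinearMap.snd ℂ (Fin n → ℂ) ℂ)).prod 0 :
        ((Fin n → ℂ) × ℂ) →L[ℂ] ((Fin n → ℂ) × ℂ)) p) + (fun k => l k * a, 0) := by
    funext p
    refine Prod.ext ?_ ?_
    · funext k
      simp [shiftTimes_apply]
      ring
    · simp [shiftTimes_apply]
  rw [h]
  exact (ContinuousLinearMap.analyticOnNhd _ _).add analyticOnNhd_const

lemma shiftTimes_add (a b : ℂ) (l m : Fin n → ℤ) (p : (Fin n → ℂ) × ℂ) :
    shiftTimes a b (l + m) p = shiftTimes a b l (shiftTimes a b m p) := by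
  simp only [shiftTimes_apply, Pi.add_apply]
  refine Prod.ext (funext fun k => ?_) rfl
  push_cast
  ring

lemma MeroEq.comp_shiftTimes {f g : (Fin n → ℂ) × ℂ → ℂ} (h : MeroEq (timeDomain n) f g)
    (a b : ℂ) (l : Fin n → ℤ) :
    MeroEq (timeDomain n) (f ∘ shiftTimes a b l) (g ∘ shiftTimes a b l) :=
  h.comp_homeomorph (shiftTimes a b l)

lemma MeroEq.comp_permTimes {f g : (Fin n → ℂ) × ℂ → ℂ} (h : MeroEq (timeDomain n) f g)
    (σ : Equiv.Perm (Fin n)) :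
    MeroEq (timeDomain n) (fun p => f (p.1 ∘ σ, p.2)) (fun p => g (p.1 ∘ σ, p.2)) :=
  h.comp_homeomorph (permTimes σ).toHomeomorph

/-- Quasi-periodicity under the generators of a lattice of periods implies quasi-periodicity under
the whole lattice. -/
lemma meroEq_shiftTimes {f : (Fin n → ℂ) × ℂ → ℂ} {a b : ℂ} {q : Fin n → ℤ}
    (h : ∀ m, MeroEq (timeDomain n) (f ∘ shiftTimes a b (Pi.single m 1))
      (fun p => (-1 : ℂ) ^ q m * f p)) (l : Fin n → ℤ) :
    MeroEq (timeDomain n) (f ∘ shiftTimes a b l) (fun p => (-1 : ℂ) ^ (∑ k, l k * q k) * f p) := by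
  set G : AddSubgroup (Fin n → ℤ) :=
    { carrier := {l | MeroEq (timeDomain n) (f ∘ shiftTimes a b l)
        (fun p => (-1 : ℂ) ^ (∑ k, l k * q k) * f p)}
      zero_mem' := by
        refine (MeroEq.refl isOpen_timeDomain f).map fun p _ _ => ?_
        simp [shiftTimes_apply]
      add_mem' := by
        intro l m hl hm
        refine (hl.comp_shiftTimes a b m).map₂ hm fun p _ h1 h2 => ?_
        simp only [Function.comp_apply] at h1 h2 ⊢
        rw [shiftTimes_add, h1, h2]
        simp only [Pi.add_apply, add_mul, Finset.sum_add_distrib]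
        rw [zpow_add₀ (by norm_num), mul_assoc]
      neg_mem' := by
        intro l hl
        refine (hl.comp_shiftTimes a b (-l)).map fun p _ h1 => ?_
        simp only [Function.comp_apply] at h1 ⊢
        rw [← shiftTimes_add, add_neg_cancel] at h1
        have h0 : shiftTimes a b 0 p = p := by simp [shiftTimes_apply]
        rw [h0] at h1
        simp only [Pi.neg_apply, neg_mul, Finset.sum_neg_distrib]
        rw [h1, ← mul_assoc, ← zpow_add₀ (by norm_num), neg_add_cancel, zpow_zero, one_mul] } with hG
  suffices h : l ∈ G from h
  have hl : l = ∑ m, l m • (Pi.single m 1 : Fin n → ℤ) := by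
    funext k
    simp [Finset.sum_apply, Pi.single_apply]
  rw [hl]
  refine G.sum_mem fun m _ => G.zsmul_mem ?_ _
  refine (h m).map fun p _ h1 => ?_
  rw [h1]
  congr 2
  simp [Pi.single_apply]

end Shift

section Periodicity

variable {D : ℕ} [NeZero D] {𝓗 : Type*} [NormedAddCommGroup 𝓗] [InnerProductSpace ℂ 𝓗]
  {I : Type*} [Fintype I] [DecidableEq I] (Q : Theory D 𝓗 I) (hQ : Q.FiniteDegeneracy) {n : ℕ}

lemma expTerm_shift_one (δ : Fin n → ℤ) (p : (Fin n → ℂ) × ℂ) (m : Fin n)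
    (y : (Fin n → ℤ) × ℤ) :
    expTerm δ (p.1 + Pi.single m 1, p.2) y = (-1) ^ δ m * expTerm δ p y := by
  have h : (-1 : ℂ) ^ δ m = Complex.exp (Real.pi * Complex.I * (δ m + 2 * y.1 m)) := by
    rw [mul_add, Complex.exp_add, show Real.pi * Complex.I * (2 * (y.1 m : ℂ)) =
      (y.1 m : ℂ) * (2 * Real.pi * Complex.I) by ring, Complex.exp_int_mul_two_pi_mul_I, mul_one,
      mul_comm, Complex.exp_int_mul, Complex.exp_pi_mul_I]
  rw [h, expTerm, expTerm, ← Complex.exp_add]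
  congr 1
  simp only [Pi.add_apply, mul_add, Finset.sum_add_distrib]
  have : ∑ i, ((δ i + 2 * y.1 i : ℤ) : ℂ) * (Pi.single m (1 : ℂ) : Fin n → ℂ) i =
      δ m + 2 * y.1 m := by
    simp [Pi.single_apply]
  rw [this]
  ring

/-- The translation `ζ_last ↦ ζ_last - τ` is compensated by the corresponding change of the power of
`q^{1/2}`. -/
lemma expTerm_shift_tau (δ : Fin n → ℤ) (p : (Fin n → ℂ) × ℂ) (m : Fin n)
    (k : Fin n → ℤ) (j : ℤ) :
    expTerm δ (p.1 - Pi.single m p.2, p.2) (k, j + (δ m + 2 * k m)) = expTerm δ p (k, j) := by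
  rw [expTerm, expTerm]
  congr 2
  simp only [Pi.sub_apply, mul_sub, Finset.sum_sub_distrib]
  have : ∑ i, ((δ i + 2 * k i : ℤ) : ℂ) * (Pi.single m p.2 : Fin n → ℂ) i =
      (δ m + 2 * k m) * p.2 := by
    simp [Pi.single_apply]
  rw [this]
  push_cast
  ring

lemma shiftTimes_single (a b : ℂ) (m : Fin n) (p : (Fin n → ℂ) × ℂ) :
    shiftTimes a b (Pi.single m 1) p = (p.1 + Pi.single m (a + b * p.2), p.2) := by
  rw [shiftTimes_apply]
  refine Prod.ext (funext fun k => ?_) rfl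
  by_cases h : k = m
  · subst h; simp
  · simp [h]

variable {f : (Fin n → I) → (Fin n → USphere D) → (Fin n → ℂ) × ℂ → ℂ}

lemma Theory.meroEq_shift_one (hf : ∀ A u, Q.ConvergesToMeromorphic hQ A u (f A u))
    (A : Fin n → I) (u : Fin n → USphere D) (m : Fin n) :
    MeroEq (timeDomain n) (fun p => f A u (p.1 + Pi.single m 1, p.2))
        (fun p => (-1 : ℂ) ^ (Q.parity (A m) : ℕ) * f A u p) := by
  have hs : (fun p => f A u (p.1 + Pi.single m 1, p.2)) =
      f A u ∘ shiftTimes 1 0 (Pi.single m 1) := by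
    funext p
    simp [shiftTimes_single]
  refine IsMeromorphic.meroEq_of_eqOn isOpen_timeDomain convex_timeDomain.isPreconnected ?_
    (IsMeromorphic.analytic_mul analyticOnNhd_const (hf A u).1) isOpen_thermalDomain
    thermalDomain_nonempty thermalDomain_subset_timeDomain fun p hp => ?_
  · rw [hs]
    exact (hf A u).1.comp_homeomorph _ (analyticOnNhd_shiftTimes 1 0 _)
  · have hp' : (p.1 + Pi.single m 1, p.2) ∈ thermalDomain n := by
      have him : ∀ k, ((p.1 + Pi.single m 1 : Fin n → ℂ) k).im = (p.1 k).im := fun k => by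
        by_cases h : k = m
        · subst h; simp
        · simp [h]
      refine ⟨hp.1, fun j k hjk => ?_⟩
      have := hp.2 j k hjk
      simpa only [Complex.sub_im, him] using this
    have h1 := ((hf A u).hasSum_coef Q hQ hp').2
    simp only [expTerm_shift_one, mul_left_comm _ ((-1 : ℂ) ^ Q.twiceDim (A m))] at h1
    simp only [Q.neg_one_pow_parity]
    exact h1.unique (((hf A u).hasSum_coef Q hQ hp).2.mul_left _)

lemma finRotate_symm_zero : (finRotate (n + 1)).symm 0 = Fin.last n := by
  rw [Equiv.symm_apply_eq, finRotate_last]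

lemma finRotate_symm_succ (i : Fin n) : (finRotate (n + 1)).symm i.succ = i.castSucc := by
  rw [Equiv.symm_apply_eq]
  ext
  rw [coe_finRotate_of_ne_last (Fin.castSucc_lt_last i).ne]
  simp

lemma permSign_finRotate_symm (p : Fin (n + 1) → Fin 2) :
    permSign p (finRotate (n + 1)).symm =
      (p (Fin.last n) : ℕ) * ∑ i : Fin n, (p i.castSucc : ℕ) := by
  rw [permSign, Finset.sum_filter, Fintype.sum_prod_type, Fin.sum_univ_succ, Fin.sum_univ_succ]
  simp only [Fin.sum_univ_succ, finRotate_symm_zero, finRotate_symm_succ, lt_irrefl, false_and, if_false, zero_add]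
  rw [Finset.mul_sum]
  refine (add_eq_left.2 (Finset.sum_eq_zero fun i _ => ?_)).trans
    (Finset.sum_congr rfl fun i _ => ?_)
  · rw [if_neg (fun h => absurd h.1 (Fin.succ_pos i).not_gt), zero_add]
    refine Finset.sum_eq_zero fun j _ => if_neg ?_
    rintro ⟨h1, h2⟩
    simp only [Fin.lt_def, Fin.val_succ, Fin.val_castSucc] at h1 h2
    omega
  · rw [if_pos ⟨Fin.succ_pos i, Fin.castSucc_lt_last i⟩]

variable {f' : (Fin (n + 1) → I) → (Fin (n + 1) → USphere D) → (Fin (n + 1) → ℂ) × ℂ → ℂ}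

/-- In the thermal domain, the last time can be translated by `-τ` and moved to the first place. -/
lemma rotate_mem_thermalDomain {p : (Fin (n + 1) → ℂ) × ℂ} (hp : p ∈ thermalDomain (n + 1)) :
    ((p.1 - Pi.single (Fin.last n) p.2) ∘ (finRotate (n + 1)).symm, p.2) ∈
      thermalDomain (n + 1) := by
  have h0 : (p.1 - Pi.single (Fin.last n) p.2 : Fin (n + 1) → ℂ) ((finRotate (n + 1)).symm 0) =
      p.1 (Fin.last n) - p.2 := by
    rw [finRotate_symm_zero, Pi.sub_apply, Pi.single_eq_same]
  have hs : ∀ i : Fin n, (p.1 - Pi.single (Fin.last n) p.2 : Fin (n + 1) → ℂ)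
      ((finRotate (n + 1)).symm i.succ) = p.1 i.castSucc := by
    intro i
    rw [finRotate_symm_succ, Pi.sub_apply, Pi.single_eq_of_ne (Fin.castSucc_lt_last i).ne, sub_zero]
  refine ⟨hp.1, fun j k hjk => ?_⟩
  obtain ⟨k, rfl⟩ := Fin.exists_succ_eq.2 (Fin.ne_zero_of_lt hjk)
  induction j using Fin.cases with
  | zero =>
    have := hp.2 k.castSucc (Fin.last n) (Fin.castSucc_lt_last k)
    simp only [Function.comp_apply, h0, hs, Complex.sub_im] at this ⊢
    exact ⟨by linarith [this.2], by linarith [this.1]⟩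
  | succ j =>
    have := hp.2 j.castSucc k.castSucc (Fin.castSucc_lt_castSucc_iff.2 (Fin.succ_lt_succ_iff.1 hjk))
    simp only [Function.comp_apply, hs]
    exact this

/-- The Kubo–Martin–Schwinger property: the last field can be moved to the first place, where it is
translated by `-τ` in imaginary time. -/
lemma Theory.eqOn_rotate (hf : ∀ A u, Q.ConvergesToMeromorphic hQ A u (f' A u))
    (A : Fin (n + 1) → I) (u : Fin (n + 1) → USphere D) :
    EqOn (f' A u) (fun p => f' (A ∘ (finRotate (n + 1)).symm) (u ∘ (finRotate (n + 1)).symm)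
      ((p.1 - Pi.single (Fin.last n) p.2) ∘ (finRotate (n + 1)).symm, p.2))
      (thermalDomain (n + 1)) := by
  intro p hp
  have hp' := rotate_mem_thermalDomain hp
  have hcoef := Q.coef_rotate hQ A u
  generalize (finRotate (n + 1)).symm = ρ at hp' hcoef ⊢
  have h1 := ((hf (A ∘ ρ) (u ∘ ρ)).hasSum_coef Q hQ hp').2
  obtain ⟨e, he⟩ : ∃ e : (Fin (n + 1) → ℤ) × ℤ ≃ (Fin (n + 1) → ℤ) × ℤ, ∀ k j, e (k, j) =
      (k ∘ ρ, j + (Q.twiceDim (A (Fin.last n)) + 2 * k (Fin.last n))) :=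
    ⟨{  toFun := fun y => (y.1 ∘ ρ, y.2 + (Q.twiceDim (A (Fin.last n)) + 2 * y.1 (Fin.last n)))
        invFun := fun y => (y.1 ∘ ρ.symm,
          y.2 - (Q.twiceDim (A (Fin.last n)) + 2 * y.1 (ρ.symm (Fin.last n))))
        left_inv := fun y => by simp [Function.comp_assoc]
        right_inv := fun y => by simp [Function.comp_assoc] }, fun _ _ => rfl⟩
  rw [← e.hasSum_iff] at h1
  refine ((hf A u).hasSum_coef Q hQ hp).2.unique (h1.congr_fun fun y => ?_)
  obtain ⟨k, j⟩ := y
  rw [Function.comp_apply, hcoef k j, he]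
  congr 1
  rw [← expTerm_shift_tau _ p (Fin.last n) k j]
  rw [← expTerm_comp _ _ ρ]
  rfl

/-- Periodicity in the last time: the KMS condition followed by the cyclic permutation that moves the
field back to the last place. -/
lemma Theory.meroEq_shift_tau_last (hf : ∀ A u, Q.ConvergesToMeromorphic hQ A u (f' A u))
    (A : Fin (n + 1) → I) (u : Fin (n + 1) → USphere D) :
    MeroEq (timeDomain (n + 1)) (fun p => f' A u (p.1 + Pi.single (Fin.last n) p.2, p.2))
        (fun p => (-1 : ℂ) ^ (Q.parity (A (Fin.last n)) : ℕ) * f' A u p) := by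
  by_cases hodd : Odd (∑ i, Q.twiceDim (A i))
  -- The correlation function vanishes if the total dimension is not an integer.
  · have h0 : MeroEq (timeDomain (n + 1)) (f' A u) 0 := by
      refine IsMeromorphic.meroEq_of_eqOn isOpen_timeDomain convex_timeDomain.isPreconnected
        (hf A u).1 (analyticOnNhd_const.isMeromorphic isOpen_timeDomain)
        isOpen_thermalDomain thermalDomain_nonempty thermalDomain_subset_timeDomain fun p hp => ?_
      refine ((hf A u).hasSum_coef Q hQ hp).2.unique (hasSum_zero.congr_fun fun y => ?_)
      rw [Q.coef_eq_zero_of_sum_ne hQ A u, zero_mul]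
      intro h
      rw [Finset.sum_add_distrib, ← Finset.mul_sum] at h
      obtain ⟨r, hr⟩ := hodd
      omega
    refine (h0.comp_shiftTimes 0 1 (Pi.single (Fin.last n) 1)).map₂ h0 fun p _ h1 h2 => ?_
    simp only [Function.comp_apply, shiftTimes_single, zero_add, one_mul] at h1
    rw [h1, h2]
    simp
  set ρ := (finRotate (n + 1)).symm with hρ
  have hsign : (-1 : ℂ) ^ permSign (Q.parity ∘ A) ρ = (-1) ^ (Q.parity (A (Fin.last n)) : ℕ) := by
    rw [hρ, permSign_finRotate_symm]
    simp only [Function.comp_apply]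
    have h1 : ∏ i, (-1 : ℂ) ^ (Q.parity (A i) : ℕ) = 1 := by
      simp only [Q.neg_one_pow_parity]
      have h2 : ∀ s : Finset (Fin (n + 1)), ∏ i ∈ s, (-1 : ℂ) ^ Q.twiceDim (A i) =
          (-1) ^ ∑ i ∈ s, Q.twiceDim (A i) := fun s => by
        induction s using Finset.cons_induction with
        | empty => simp
        | cons i s hi ih =>
          rw [Finset.prod_cons, Finset.sum_cons, zpow_add₀ (by norm_num), ih]
      rw [h2]
      exact (Int.not_odd_iff_even.1 hodd).neg_one_zpow
    rw [Fin.prod_univ_castSucc, Finset.prod_pow_eq_pow_sum] at h1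
    generalize (Q.parity (A (Fin.last n))) = a at h1 ⊢
    fin_cases a
    · simp
    · simp only [pow_one, one_mul] at h1 ⊢
      linear_combination -h1
  have hinv : ∀ p : (Fin (n + 1) → ℂ) × ℂ, shiftTimes 0 1 (-Pi.single (Fin.last n) 1) p =
      (p.1 - Pi.single (Fin.last n) p.2, p.2) := by
    intro p
    rw [shiftTimes_apply]
    refine Prod.ext (funext fun k => ?_) rfl
    by_cases h : k = Fin.last n
    · subst h; simp [sub_eq_add_neg]
    · simp [h]
  have h1 : MeroEq (timeDomain (n + 1)) (f' A u) (fun p => f' (A ∘ ρ) (u ∘ ρ)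
      ((p.1 - Pi.single (Fin.last n) p.2) ∘ ρ, p.2)) := by
    refine IsMeromorphic.meroEq_of_eqOn isOpen_timeDomain convex_timeDomain.isPreconnected
      (hf A u).1 ?_ isOpen_thermalDomain thermalDomain_nonempty thermalDomain_subset_timeDomain
      (Q.eqOn_rotate hQ hf A u)
    have := ((hf (A ∘ ρ) (u ∘ ρ)).1.comp_permTimes ρ).comp_homeomorph
      (shiftTimes 0 1 (-Pi.single (Fin.last n) 1)) (analyticOnNhd_shiftTimes 0 1 _)
    simp only [Function.comp_def, hinv] at this
    exact this
  have h2 := (Q.meroEq_perm hQ hf A u ρ).comp_shiftTimes 0 1 (-Pi.single (Fin.last n) 1)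
  have h3 := h1.map₂ (h := f' A u) (h' := fun p => (-1 : ℂ) ^ (Q.parity (A (Fin.last n)) : ℕ) *
    f' A u (p.1 - Pi.single (Fin.last n) p.2, p.2)) h2 fun p _ e1 e2 => by
      simp only [Function.comp_apply, hinv] at e2
      rw [e1, e2, hsign]
  refine (h3.comp_shiftTimes 0 1 (Pi.single (Fin.last n) 1)).map fun p _ e => ?_
  simp only [Function.comp_apply, shiftTimes_single, zero_add, one_mul] at e
  rw [e, add_sub_cancel_right]

lemma Theory.meroEq_shift_tau (hf : ∀ A u, Q.ConvergesToMeromorphic hQ A u (f A u))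
    (A : Fin n → I) (u : Fin n → USphere D) (m : Fin n) :
    MeroEq (timeDomain n) (fun p => f A u (p.1 + Pi.single m p.2, p.2))
        (fun p => (-1 : ℂ) ^ (Q.parity (A m) : ℕ) * f A u p) := by
  rcases n with _ | n
  · exact m.elim0
  set σ := Equiv.swap m (Fin.last n) with hσ
  have h1 := (Q.meroEq_shift_tau_last hQ hf (A ∘ σ) (u ∘ σ)).comp_permTimes σ
  have h2 := Q.meroEq_perm hQ hf A u σ
  have h3 := h2.comp_shiftTimes 0 1 (Pi.single m 1)
  refine (h1.map₂ (h := fun p => (-1 : ℂ) ^ permSign (Q.parity ∘ A) σ *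
    f A u (p.1 + Pi.single m p.2, p.2)) (h' := fun p => (-1 : ℂ) ^ (Q.parity (A m) : ℕ) *
      f (A ∘ σ) (u ∘ σ) (p.1 ∘ σ, p.2)) h3 fun p _ e1 e3 => ?_).map₂ h2 fun p _ e1 e2 => ?_
  · simp only [Function.comp_apply, shiftTimes_single, zero_add, one_mul] at e3
    have h4 : (p.1 + Pi.single m p.2) ∘ σ = p.1 ∘ σ + Pi.single (Fin.last n) p.2 := by
      funext k
      simp only [Function.comp_apply, Pi.add_apply, Pi.single_apply]
      congr 1
      have : σ k = m ↔ k = Fin.last n := by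
        rw [hσ, Equiv.swap_comm]
        constructor
        · intro h
          rw [← Equiv.eq_symm_apply, Equiv.symm_swap, Equiv.swap_apply_right] at h
          exact h
        · rintro rfl
          exact Equiv.swap_apply_left _ _
      simp only [this]
    rw [← e3, h4, e1]
    simp only [Function.comp_apply, hσ, Equiv.swap_apply_right]
  · rw [e2, mul_left_comm] at e1
    exact mul_left_cancel₀ (pow_ne_zero _ (by norm_num)) e1

/-- Quasi-periodicity under all integral translations of the times. -/
lemma Theory.meroEq_shiftTimes_one (hf : ∀ A u, Q.ConvergesToMeromorphic hQ A u (f A u))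
    (A : Fin n → I) (u : Fin n → USphere D) (l : Fin n → ℤ) :
    MeroEq (timeDomain n) (f A u ∘ shiftTimes 1 0 l)
      (fun p => (-1 : ℂ) ^ (∑ k, l k * ((Q.parity (A k) : ℕ) : ℤ)) * f A u p) :=
  meroEq_shiftTimes (fun m => (Q.meroEq_shift_one hQ hf A u m).map fun p _ e => by
    rw [Function.comp_apply, shiftTimes_single, zero_mul, add_zero, e, zpow_natCast]) l

/-- Quasi-periodicity under all translations of the times by integral multiples of `τ`. -/
lemma Theory.meroEq_shiftTimes_tau (hf : ∀ A u, Q.ConvergesToMeromorphic hQ A u (f A u))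
    (A : Fin n → I) (u : Fin n → USphere D) (l : Fin n → ℤ) :
    MeroEq (timeDomain n) (f A u ∘ shiftTimes 0 1 l)
      (fun p => (-1 : ℂ) ^ (∑ k, l k * ((Q.parity (A k) : ℕ) : ℤ)) * f A u p) :=
  meroEq_shiftTimes (fun m => (Q.meroEq_shift_tau hQ hf A u m).map fun p _ e => by
    rw [Function.comp_apply, shiftTimes_single, zero_add, one_mul, e, zpow_natCast]) l

end Periodicity

/-! ### The odd theta function -/

section Theta

/-- The coefficients of the function `kap`. -/
def kapCoef (x : ℕ × ℤ) : ℂ := if |x.2| ≤ x.1 then (-1) ^ x.1 else 0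

/-- The function `κ(z, τ) = ∑_{r ≥ 0} (-1)^r e^{π i (r² + r) τ} ∑_{|m| ≤ r} e^{2π i m z}`. It is the
quotient of `ϑ₁₁(z, τ)` by `-2 e^{π i τ / 4} sin π z`. -/
def kap (z τ : ℂ) : ℂ := ∑' x : ℕ × ℤ, kapCoef x *
  Complex.exp (Real.pi * Complex.I * ((x.1 ^ 2 + x.1) * τ + 2 * x.2 * z))

lemma summable_kap (z : ℂ) {τ : ℂ} (hτ : 0 < τ.im) : Summable fun x : ℕ × ℤ => ‖kapCoef x *
    Complex.exp (Real.pi * Complex.I * ((x.1 ^ 2 + x.1) * τ + 2 * x.2 * z))‖ := by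
  have hτ2 : 0 < (τ / 2).im := by
    have : (τ / 2).im = τ.im / 2 := by simp
    linarith
  have h1 := ((summable_jacobiTheta₂_term_iff 0 (τ / 2)).2 hτ2).norm.comp_injective
    Nat.cast_injective
  have h2 := ((summable_jacobiTheta₂_term_iff z (τ / 2)).2 hτ2).norm
  refine Summable.of_nonneg_of_le (fun _ => norm_nonneg _) (fun x => ?_)
    (h1.mul_of_nonneg h2 (fun _ => norm_nonneg _) fun _ => norm_nonneg _)
  rw [Function.comp_apply, norm_jacobiTheta₂_term, norm_jacobiTheta₂_term, ← Real.exp_add, kapCoef]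
  split_ifs with h
  · rw [norm_mul, norm_pow, norm_neg, norm_one, one_pow, one_mul, Complex.norm_exp,
      Real.exp_le_exp]
    have e1 : (Real.pi * Complex.I * ((x.1 ^ 2 + x.1) * τ + 2 * x.2 * z)).re =
        -Real.pi * (((x.1 : ℝ) ^ 2 + x.1) * τ.im + 2 * x.2 * z.im) := by
      have : Real.pi * Complex.I * (((x.1 : ℂ) ^ 2 + x.1) * τ + 2 * x.2 * z) =
          (Real.pi : ℝ) * (Complex.I * ((((x.1 : ℝ) ^ 2 + x.1 : ℝ) : ℂ) * τ +
            ((2 * x.2 : ℝ) : ℂ) * z)) := by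
        push_cast
        ring
      rw [this, Complex.re_ofReal_mul, Complex.I_mul_re, Complex.add_im, Complex.im_ofReal_mul,
        Complex.im_ofReal_mul]
      ring
    have e2 : (τ / 2).im = τ.im / 2 := by simp
    have h3 : (x.2 : ℝ) ^ 2 ≤ (x.1 : ℝ) ^ 2 := by
      have : |(x.2 : ℝ)| ≤ |(x.1 : ℝ)| := by
        rw [abs_of_nonneg (Nat.cast_nonneg x.1 : (0 : ℝ) ≤ x.1)]
        exact_mod_cast h
      exact sq_le_sq.2 this
    rw [e1, e2]
    simp only [Complex.zero_im, mul_zero, sub_zero, Int.cast_natCast]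
    have h4 : 0 ≤ Real.pi * τ.im * ((x.1 : ℝ) ^ 2 + 2 * x.1 - (x.2 : ℝ) ^ 2) :=
      mul_nonneg (mul_nonneg Real.pi_pos.le hτ.le)
        (by linarith [(Nat.cast_nonneg x.1 : (0 : ℝ) ≤ x.1)])
    nlinarith [h4]
  · rw [zero_mul, norm_zero]
    positivity

/-- The inner sum in `kap` is a Dirichlet kernel. -/
lemma dirichlet_mul (z : ℂ) (r : ℕ) :
    (Complex.exp (Real.pi * Complex.I * z) - Complex.exp (-(Real.pi * Complex.I * z))) *
      ∑ m ∈ Finset.Icc (-(r : ℤ)) r, Complex.exp (2 * Real.pi * Complex.I * m * z) =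
    Complex.exp ((2 * r + 1) * (Real.pi * Complex.I * z)) -
      Complex.exp (-((2 * r + 1) * (Real.pi * Complex.I * z))) := by
  induction r with
  | zero => simp
  | succ r ih =>
    have h : Finset.Icc (-((r + 1 : ℕ) : ℤ)) ((r + 1 : ℕ) : ℤ) =
        insert (-((r : ℤ) + 1)) (insert ((r : ℤ) + 1) (Finset.Icc (-(r : ℤ)) r)) := by
      ext m
      simp only [Finset.mem_Icc, Finset.mem_insert]
      push_cast
      omega
    rw [h, Finset.sum_insert, Finset.sum_insert, mul_add, mul_add, ih]
    · simp only [sub_mul, ← Complex.exp_add]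
      push_cast
      ring_nf
    · simp
    · simp only [Finset.mem_insert, Finset.mem_Icc]
      omega

lemma hasSum_kap_fiber (z τ : ℂ) (r : ℕ) : HasSum (fun m : ℤ => kapCoef (r, m) *
    Complex.exp (Real.pi * Complex.I * ((r ^ 2 + r) * τ + 2 * m * z)))
    ((-1) ^ r * Complex.exp (Real.pi * Complex.I * (r ^ 2 + r) * τ) *
      ∑ m ∈ Finset.Icc (-(r : ℤ)) r, Complex.exp (2 * Real.pi * Complex.I * m * z)) := by
  rw [Finset.mul_sum]
  have h : ∀ m ∈ Finset.Icc (-(r : ℤ)) r, (-1) ^ r *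
      Complex.exp (Real.pi * Complex.I * (r ^ 2 + r) * τ) *
        Complex.exp (2 * Real.pi * Complex.I * m * z) = kapCoef (r, m) *
    Complex.exp (Real.pi * Complex.I * ((r ^ 2 + r) * τ + 2 * m * z)) := by
    intro m hm
    rw [kapCoef, if_pos (abs_le.2 (Finset.mem_Icc.1 hm)), mul_assoc, ← Complex.exp_add]
    congr 2
    ring
  rw [Finset.sum_congr rfl h]
  refine hasSum_sum_of_ne_finset_zero fun m hm => ?_
  rw [kapCoef, if_neg (fun h => hm (Finset.mem_Icc.2 (abs_le.1 h))), zero_mul]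

lemma hasSum_kap (z : ℂ) {τ : ℂ} (hτ : 0 < τ.im) : HasSum (fun r : ℕ =>
    (-1) ^ r * Complex.exp (Real.pi * Complex.I * (r ^ 2 + r) * τ) *
      ∑ m ∈ Finset.Icc (-(r : ℤ)) r, Complex.exp (2 * Real.pi * Complex.I * m * z)) (kap z τ) :=
  (summable_kap z hτ).of_norm.hasSum.prod_fiberwise fun r => hasSum_kap_fiber z τ r

/-- The pairs of opposite terms of the theta series are the terms of `kap`. -/
lemma theta11_eq_kap (z : ℂ) {τ : ℂ} (hτ : 0 < τ.im) : theta11 z τ =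
    -2 * Complex.exp (Real.pi * Complex.I * τ / 4) * Complex.sin (Real.pi * z) * kap z τ := by
  have h1 := ((hasSum_jacobiTheta₂_term (z + (τ + 1) / 2) hτ).mul_left
    (Complex.exp (Real.pi * Complex.I * τ / 4 + Real.pi * Complex.I * (z + 1 / 2)))
      ).nat_add_neg_add_one
  have h2 := (hasSum_kap z hτ).mul_left (Complex.exp (Real.pi * Complex.I * τ / 4) *
    (Complex.I * (Complex.exp (Real.pi * Complex.I * z) - Complex.exp (-(Real.pi * Complex.I * z)))))
  have h3 : -2 * Complex.exp (Real.pi * Complex.I * τ / 4) * Complex.sin (Real.pi * z) * kap z τ =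
      (Complex.exp (Real.pi * Complex.I * τ / 4) *
    (Complex.I * (Complex.exp (Real.pi * Complex.I * z) -
      Complex.exp (-(Real.pi * Complex.I * z))))) * kap z τ := by
    rw [Complex.sin, show -(Real.pi * z) * Complex.I = -(Real.pi * Complex.I * z) by ring,
      show (Real.pi * z) * Complex.I = Real.pi * Complex.I * z by ring]
    ring
  rw [h3, theta11]
  refine h1.unique (h2.congr_fun fun r => ?_)
  have e1 : Complex.exp (Real.pi * Complex.I * τ / 4 + Real.pi * Complex.I * (z + 1 / 2)) *
      jacobiTheta₂_term (r : ℤ) (z + (τ + 1) / 2) τ =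
      Complex.exp (Real.pi * Complex.I * τ / 4) *
        Complex.exp (Real.pi * Complex.I * (r ^ 2 + r) * τ) *
          (((-1) ^ r * Complex.I) * Complex.exp ((2 * r + 1) * (Real.pi * Complex.I * z))) := by
    have : (-1 : ℂ) ^ r * Complex.I =
        Complex.exp (r * (Real.pi * Complex.I) + Real.pi / 2 * Complex.I) := by
      rw [Complex.exp_add, Complex.exp_nat_mul, Complex.exp_pi_mul_I, Complex.exp_pi_div_two_mul_I]
    rw [this, jacobiTheta₂_term, ← Complex.exp_add, ← Complex.exp_add, ← Complex.exp_add,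
      ← Complex.exp_add]
    congr 1
    push_cast
    ring
  have e2 : Complex.exp (Real.pi * Complex.I * τ / 4 + Real.pi * Complex.I * (z + 1 / 2)) *
      jacobiTheta₂_term (-((r : ℤ) + 1)) (z + (τ + 1) / 2) τ =
      Complex.exp (Real.pi * Complex.I * τ / 4) *
        Complex.exp (Real.pi * Complex.I * (r ^ 2 + r) * τ) *
          (((-1) ^ r * -Complex.I) * Complex.exp (-((2 * r + 1) * (Real.pi * Complex.I * z)))) := by
    have : (-1 : ℂ) ^ r * -Complex.I =
        Complex.exp (-(r * (Real.pi * Complex.I)) + -Real.pi / 2 * Complex.I) := by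
      rw [Complex.exp_add, Complex.exp_neg, Complex.exp_nat_mul, Complex.exp_pi_mul_I,
        Complex.exp_neg_pi_div_two_mul_I, ← inv_pow]
      norm_num
    rw [this, jacobiTheta₂_term, ← Complex.exp_add, ← Complex.exp_add, ← Complex.exp_add,
      ← Complex.exp_add]
    congr 1
    push_cast
    ring
  rw [e1, e2]
  have := dirichlet_mul z r
  linear_combination (-Complex.exp (Real.pi * Complex.I * τ / 4) * Complex.I * (-1) ^ r *
    Complex.exp (Real.pi * Complex.I * (r ^ 2 + r) * τ)) * this

/-- At `τ = i` the leading term `1` of the series dominates the others. -/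
lemma kap_ne_zero (x : ℝ) : kap x Complex.I ≠ 0 := by
  have h := (hasSum_kap (x : ℂ) (τ := Complex.I) (by simp))
  rw [← hasSum_nat_add_iff' 1] at h
  simp only [Finset.range_one, Finset.sum_singleton, pow_zero, one_mul, Nat.cast_zero, neg_zero,
    Finset.Icc_self, Int.cast_zero, mul_zero, zero_mul, Complex.exp_zero, ne_eq, OfNat.ofNat_ne_zero,
    not_false_eq_true, zero_pow, add_zero] at h
  have hg : HasSum (fun r : ℕ => (3 / 8 : ℝ) * (1 / 4) ^ r) (1 / 2) := by
    have := (hasSum_geometric_of_lt_one (r := (1 / 4 : ℝ)) (by norm_num) (by norm_num)).mul_left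
      (3 / 8)
    rwa [show (3 / 8 : ℝ) * (1 - 1 / 4)⁻¹ = 1 / 2 by norm_num] at this
  have hb : ‖kap x Complex.I - 1‖ ≤ 1 / 2 := by
    rw [← h.tsum_eq]
    refine tsum_of_norm_bounded hg fun r => ?_
    have h1 : ‖∑ m ∈ Finset.Icc (-((r + 1 : ℕ) : ℤ)) ((r + 1 : ℕ) : ℤ),
        Complex.exp (2 * Real.pi * Complex.I * m * x)‖ ≤ 2 * r + 3 := by
      refine (norm_sum_le _ _).trans ?_
      have : ∀ m ∈ Finset.Icc (-((r + 1 : ℕ) : ℤ)) ((r + 1 : ℕ) : ℤ),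
          ‖Complex.exp (2 * Real.pi * Complex.I * m * x)‖ ≤ 1 := by
        intro m _
        rw [show 2 * Real.pi * Complex.I * m * x = ((2 * Real.pi * m * x : ℝ) : ℂ) * Complex.I by
          push_cast; ring, Complex.norm_exp_ofReal_mul_I]
      refine (Finset.sum_le_card_nsmul _ _ 1 this).trans ?_
      rw [Int.card_Icc, nsmul_one]
      have : ((((r + 1 : ℕ) : ℤ) + 1 - -((r + 1 : ℕ) : ℤ)).toNat : ℝ) = 2 * r + 3 := by
        have : (((r + 1 : ℕ) : ℤ) + 1 - -((r + 1 : ℕ) : ℤ)).toNat = 2 * r + 3 := by omega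
        rw [this]
        push_cast
        ring
      rw [this]
    have h2 : ‖Complex.exp (Real.pi * Complex.I * (((r + 1 : ℕ) : ℂ) ^ 2 + (r + 1 : ℕ)) *
        Complex.I)‖ ≤ (1 / 8) ^ (r + 1) := by
      have e : Real.pi * Complex.I * (((r + 1 : ℕ) : ℂ) ^ 2 + (r + 1 : ℕ)) * Complex.I =
          ((-(Real.pi * (((r + 1 : ℕ) : ℝ) ^ 2 + (r + 1 : ℕ))) : ℝ) : ℂ) := by
        push_cast
        linear_combination (Real.pi * (((r : ℂ) + 1) ^ 2 + (r + 1))) * Complex.I_mul_I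
      rw [e, ← Complex.ofReal_exp, Complex.norm_real, Real.norm_of_nonneg (Real.exp_pos _).le]
      have h8 : Real.exp (-3) ≤ 1 / 8 := by
        rw [Real.exp_neg, ← one_div]
        refine one_div_le_one_div_of_le (by norm_num) ?_
        have : Real.exp 3 = Real.exp 1 ^ 3 := by rw [← Real.exp_nat_mul]; norm_num
        rw [this]
        have h2 : (2 : ℝ) ≤ Real.exp 1 := by linarith [Real.add_one_le_exp (1 : ℝ)]
        calc (8 : ℝ) = 2 ^ 3 := by norm_num
          _ ≤ _ := by gcongr
      calc Real.exp (-(Real.pi * (((r + 1 : ℕ) : ℝ) ^ 2 + (r + 1 : ℕ))))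
          ≤ Real.exp ((r + 1 : ℕ) * (-3)) := by
            rw [Real.exp_le_exp]
            have : (0 : ℝ) ≤ (r + 1 : ℕ) := by positivity
            nlinarith [Real.pi_gt_three, sq_nonneg (((r + 1 : ℕ) : ℝ)), mul_nonneg
              (sub_nonneg.2 Real.pi_gt_three.le) this]
        _ = Real.exp (-3) ^ (r + 1) := by rw [Real.exp_nat_mul]
        _ ≤ _ := by gcongr
    have h3 : (2 * r + 3 : ℝ) ≤ 3 * 2 ^ r := by
      have := one_add_mul_le_pow (a := (1 : ℝ)) (by norm_num) r
      norm_num at this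
      linarith [(Nat.cast_nonneg r : (0 : ℝ) ≤ r)]
    rw [norm_mul, norm_mul, norm_pow, norm_neg, norm_one, one_pow, one_mul]
    calc _ ≤ (1 / 8 : ℝ) ^ (r + 1) * (3 * 2 ^ r) :=
          mul_le_mul h2 (h1.trans h3) (norm_nonneg _) (by positivity)
      _ = 3 / 8 * (1 / 4) ^ r := by
          rw [pow_succ, show (1 / 4 : ℝ) = 1 / 8 * 2 by norm_num, mul_pow]
          ring
  intro h0
  rw [h0, zero_sub, norm_neg, norm_one] at hb
  norm_num at hb

lemma theta11_add_one (z τ : ℂ) : theta11 (z + 1) τ = -theta11 z τ := by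
  rw [theta11, theta11, show z + 1 + (τ + 1) / 2 = z + (τ + 1) / 2 + 1 by ring,
    jacobiTheta₂_add_left, show Real.pi * Complex.I * τ / 4 + Real.pi * Complex.I * (z + 1 + 1 / 2) =
      Real.pi * Complex.I * τ / 4 + Real.pi * Complex.I * (z + 1 / 2) + Real.pi * Complex.I by ring,
    Complex.exp_add _ (Real.pi * Complex.I), Complex.exp_pi_mul_I]
  ring

lemma theta11_add_tau (z τ : ℂ) : theta11 (z + τ) τ =
    -Complex.exp (-(Real.pi * Complex.I * τ) - 2 * Real.pi * Complex.I * z) * theta11 z τ := by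
  rw [theta11, theta11, show z + τ + (τ + 1) / 2 = z + (τ + 1) / 2 + τ by ring,
    jacobiTheta₂_add_left', ← mul_assoc, ← mul_assoc]
  congr 1
  have : -Complex.exp (-(Real.pi * Complex.I * τ) - 2 * Real.pi * Complex.I * z) =
      Complex.exp (-(Real.pi * Complex.I)) *
        Complex.exp (-(Real.pi * Complex.I * τ) - 2 * Real.pi * Complex.I * z) := by
    rw [Complex.exp_neg (Real.pi * Complex.I), Complex.exp_pi_mul_I]
    norm_num
  rw [this, ← Complex.exp_add, ← Complex.exp_add, ← Complex.exp_add]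
  congr 1
  ring

variable {D : ℕ}

lemma bigTheta_add_one (z : ℂ) (u v : USphere D) (τ : ℂ) :
    bigTheta (z + 1) u v τ = bigTheta z u v τ := by
  rw [bigTheta, bigTheta, add_right_comm, theta11_add_one, add_sub_right_comm, theta11_add_one]
  ring

lemma bigTheta_add_tau (z : ℂ) (u v : USphere D) (τ : ℂ) : bigTheta (z + τ) u v τ =
    Complex.exp (-(2 * Real.pi * Complex.I * τ) - 4 * Real.pi * Complex.I * z) *
      bigTheta z u v τ := by
  rw [bigTheta, bigTheta, add_right_comm, theta11_add_tau, add_sub_right_comm, theta11_add_tau,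
    show -(2 * Real.pi * Complex.I * τ) - 4 * Real.pi * Complex.I * z =
      (-(Real.pi * Complex.I * τ) - 2 * Real.pi * Complex.I * (z + angle u v)) +
        (-(Real.pi * Complex.I * τ) - 2 * Real.pi * Complex.I * (z - angle u v)) by ring,
    Complex.exp_add]
  ring

lemma bigTheta_add_int (z : ℂ) (u v : USphere D) (τ : ℂ) (l : ℤ) :
    bigTheta (z + l) u v τ = bigTheta z u v τ := by
  induction l with
  | zero => simp
  | succ l ih =>
    rw [Int.cast_add, Int.cast_one, ← add_assoc, bigTheta_add_one, ih]
  | pred l ih =>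
    rw [← ih, ← bigTheta_add_one (z + _)]
    congr 1
    push_cast
    ring

lemma bigTheta_add_int_mul_tau (z : ℂ) (u v : USphere D) (τ : ℂ) (l : ℤ) :
    bigTheta (z + l * τ) u v τ = Complex.exp (-(2 * Real.pi * Complex.I * l ^ 2 * τ) -
      4 * Real.pi * Complex.I * (l * z)) * bigTheta z u v τ := by
  induction l with
  | zero => simp
  | succ l ih =>
    have : z + ((l : ℤ) + 1 : ℤ) * τ = z + (l : ℤ) * τ + τ := by push_cast; ring
    rw [this, bigTheta_add_tau, ih, ← mul_assoc, ← Complex.exp_add]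
    congr 2
    push_cast
    ring
  | pred l ih =>
    have h := bigTheta_add_tau (z + ((-l - 1 : ℤ) : ℂ) * τ) u v τ
    have h1 : z + ((-l - 1 : ℤ) : ℂ) * τ + τ = z + ((-l : ℤ) : ℂ) * τ := by push_cast; ring
    rw [h1, ih] at h
    have h2 := congrArg (fun x => Complex.exp (-(-(2 * Real.pi * Complex.I * τ) -
      4 * Real.pi * Complex.I * (z + ((-l - 1 : ℤ) : ℂ) * τ))) * x) h
    simp only [← mul_assoc, ← Complex.exp_add, neg_add_cancel, Complex.exp_zero, one_mul] at h2
    rw [← h2]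
    congr 2
    push_cast
    ring

lemma two_cos_angle (u v : USphere D) :
    2 * Complex.cos (2 * Real.pi * angle u v) = 2 * dot (toC u) (toC v) := by
  have h := abs_le.1 (abs_inner_le_one u v)
  rw [dot_toC, angle]
  have : (2 * Real.pi * ((Real.arccos (inner ℝ (u : EuclideanSpace ℝ (Fin D)) v) /
      (2 * Real.pi) : ℝ) : ℂ)) = (Real.arccos (inner ℝ (u : EuclideanSpace ℝ (Fin D)) v) : ℂ) := by
    push_cast
    field_simp
  rw [this, ← Complex.ofReal_cos, Real.cos_arccos h.1 h.2]

lemma bigTheta_eq (z : ℂ) (u v : USphere D) {τ : ℂ} (hτ : 0 < τ.im) : bigTheta z u v τ =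
    -(Complex.exp (2 * Real.pi * Complex.I * z) + Complex.exp (-(2 * Real.pi * Complex.I * z)) -
      2 * dot (toC u) (toC v)) * (kap (z + angle u v) τ * kap (z - angle u v) τ) := by
  rw [bigTheta, theta11_eq_kap _ hτ, theta11_eq_kap _ hτ, ← two_cos_angle]
  have h1 : Complex.exp (-(Real.pi * Complex.I * τ / 2)) *
      (Complex.exp (Real.pi * Complex.I * τ / 4) * Complex.exp (Real.pi * Complex.I * τ / 4)) = 1 := by
    rw [← Complex.exp_add, ← Complex.exp_add]
    convert Complex.exp_zero using 2
    ring
  have h2 : Complex.exp (2 * Real.pi * Complex.I * z) + Complex.exp (-(2 * Real.pi * Complex.I * z)) =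
      2 * Complex.cos (2 * Real.pi * z) := by
    rw [Complex.cos, show 2 * Real.pi * z * Complex.I = 2 * Real.pi * Complex.I * z by ring,
      show -(2 * Real.pi * z) * Complex.I = -(2 * Real.pi * Complex.I * z) by ring]
    ring
  have h3 : 4 * (Complex.sin (Real.pi * (z + angle u v)) * Complex.sin (Real.pi * (z - angle u v))) =
      2 * Complex.cos (2 * Real.pi * angle u v) - 2 * Complex.cos (2 * Real.pi * z) := by
    rw [show 2 * Real.pi * (angle u v : ℂ) =
        Real.pi * (z + angle u v) - Real.pi * (z - angle u v) by ring,
      show 2 * Real.pi * z = Real.pi * (z + angle u v) + Real.pi * (z - angle u v) by ring,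
      Complex.cos_sub, Complex.cos_add]
    ring
  rw [h2]
  linear_combination (4 * Complex.sin (Real.pi * (z + angle u v)) *
    Complex.sin (Real.pi * (z - angle u v)) * (kap (z + angle u v) τ * kap (z - angle u v) τ)) * h1 +
    (kap (z + angle u v) τ * kap (z - angle u v) τ) * h3

end Theta

/-! ### Expansions in powers of `q^{1/2}` -/

/-- An expansion in powers of `e^{π i τ}` which is valid for large `Im τ` is valid in the whole upper
half plane if the function is holomorphic there. -/
lemma hasSum_exp_of_large_im {H : ℂ → ℂ} (hH : DifferentiableOn ℂ H {τ | 0 < τ.im}) {T : ℝ}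
    (hT : 0 ≤ T) {A : ℕ → ℂ}
    (hA : ∀ τ : ℂ, T < τ.im → HasSum (fun j => A j * Complex.exp (Real.pi * Complex.I * τ * j)) (H τ))
    {τ : ℂ} (hτ : 0 < τ.im) :
    HasSum (fun j => A j * Complex.exp (Real.pi * Complex.I * τ * j)) (H τ) := by
  have hopen : IsOpen {τ : ℂ | 0 < τ.im} := isOpen_lt continuous_const Complex.continuous_im
  have hexp : ∀ (τ : ℂ) (j : ℕ), Complex.exp (Real.pi * Complex.I * τ * j) =
      (Function.Periodic.qParam 2 τ) ^ j := by
    intro τ j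
    rw [Function.Periodic.qParam, ← Complex.exp_nat_mul]
    congr 1
    push_cast
    ring
  have hq2 : ∀ τ : ℂ, Function.Periodic.qParam 2 (τ + 2) = Function.Periodic.qParam 2 τ := by
    intro τ
    rw [Function.Periodic.qParam, Function.Periodic.qParam, ← Complex.exp_periodic (2 * Real.pi * Complex.I * τ / ((2 : ℝ) : ℂ))]
    congr 1
    push_cast
    ring
  have hper : ∀ τ : ℂ, 0 < τ.im → H (τ + 2) = H τ := by
    have hU : IsPreconnected {τ : ℂ | 0 < τ.im} := (convex_halfSpace_im_gt 0).isPreconnected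
    have h1 : AnalyticOnNhd ℂ H {τ | 0 < τ.im} := hH.analyticOnNhd hopen
    have h2 : AnalyticOnNhd ℂ (fun τ => H (τ + 2)) {τ | 0 < τ.im} := by
      intro τ hτ
      have : AnalyticAt ℂ H (τ + 2) := h1 _ (by simpa using hτ)
      exact this.comp_of_eq (f := fun τ : ℂ => τ + 2) (by fun_prop) rfl
    refine h2.eqOn_of_preconnected_of_eventuallyEq h1 hU
      (z₀ := ((T + 1 : ℝ) : ℂ) * Complex.I) (by simp; linarith) ?_
    have hn : {τ : ℂ | T < τ.im} ∈ 𝓝 (((T + 1 : ℝ) : ℂ) * Complex.I) :=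
      (isOpen_lt continuous_const Complex.continuous_im).mem_nhds (by simp)
    filter_upwards [hn] with τ hτ
    have h3 := hA (τ + 2) (by simpa using hτ)
    simp only [hexp, hq2] at h3
    have h4 := hA τ hτ
    simp only [hexp] at h4
    exact h3.unique h4
  set g : ℂ → ℂ := fun τ => if 0 < τ.im then H τ else 0 with hg
  have hgp : Function.Periodic g ((2 : ℝ) : ℂ) := by
    intro τ
    simp only [hg]
    have : (τ + ((2 : ℝ) : ℂ)).im = τ.im := by simp
    rw [this]
    split_ifs with h
    · have := hper τ h
      push_cast
      exact this
    · rfl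
  set h : ℂ → ℂ := Function.update (Function.Periodic.cuspFunction 2 g) 0 (A 0) with hh
  have hne : ∀ q : ℂ, q ≠ 0 → h q = Function.Periodic.cuspFunction 2 g q := fun q hq =>
    Function.update_of_ne hq _ _
  have hval : ∀ τ : ℂ, 0 < τ.im → h (Function.Periodic.qParam 2 τ) = H τ := by
    intro τ hτ
    rw [hne _ (Function.Periodic.qParam_ne_zero τ),
      Function.Periodic.eq_cuspFunction two_ne_zero hgp, hg]
    exact if_pos hτ
  have hps : HasFPowerSeriesAt h (FormalMultilinearSeries.ofScalars ℂ A) 0 := by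
    rw [hasFPowerSeriesAt_iff]
    have hn : Metric.ball (0 : ℂ) (Real.exp (-Real.pi * T)) ∈ 𝓝 0 :=
      Metric.ball_mem_nhds _ (Real.exp_pos _)
    filter_upwards [hn] with z hz
    simp only [FormalMultilinearSeries.coeff_ofScalars, smul_eq_mul, zero_add]
    by_cases hz0 : z = 0
    · subst hz0
      have : h 0 = A 0 := Function.update_self _ _ _
      rw [this]
      convert hasSum_single 0 (fun j hj => ?_) using 1
      · simp
      · simp [hj]
    · have h1 : T < (Function.Periodic.invQParam 2 z).im := by
        rw [Function.Periodic.im_invQParam]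
        have h2 := Real.log_lt_log (norm_pos_iff.2 hz0) (mem_ball_zero_iff.1 hz)
        rw [Real.log_exp] at h2
        have h3 : -2 / (2 * Real.pi) * Real.log ‖z‖ = -Real.log ‖z‖ / Real.pi := by
          field_simp
        rw [h3, lt_div_iff₀ Real.pi_pos]
        linarith
      have h2 := hA _ h1
      rw [← hval _ (hT.trans_lt h1)] at h2
      simp only [hexp] at h2
      rw [Function.Periodic.qParam_right_inv two_ne_zero hz0] at h2
      simpa only [mul_comm] using h2
  set q := Function.Periodic.qParam 2 τ with hq
  have hq1 : ‖q‖ < 1 := Function.Periodic.norm_qParam_lt_one two_pos hτ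
  obtain ⟨R, hqR, hR1⟩ := exists_between hq1
  have hR0 : 0 < R := (norm_nonneg q).trans_lt hqR
  lift R to NNReal using hR0.le
  have hd : DifferentiableOn ℂ h (Metric.closedBall 0 R) := by
    intro z hz
    refine DifferentiableAt.differentiableWithinAt ?_
    by_cases hz0 : z = 0
    · rw [hz0]
      exact hps.differentiableAt
    · have h1 : 0 < (Function.Periodic.invQParam 2 z).im := by
        rw [Function.Periodic.im_invQParam]
        have h2 := Real.log_neg (norm_pos_iff.2 hz0)
          ((mem_closedBall_zero_iff.1 hz).trans_lt hR1)
        have h3 : -2 / (2 * Real.pi) * Real.log ‖z‖ = -Real.log ‖z‖ / Real.pi := by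
          field_simp
        rw [h3]
        exact div_pos (by linarith) Real.pi_pos
      have h2 : DifferentiableAt ℂ g (Function.Periodic.invQParam 2 z) := by
        have h3 := (hH _ h1).differentiableAt (hopen.mem_nhds h1)
        refine h3.congr_of_eventuallyEq ?_
        filter_upwards [hopen.mem_nhds h1] with τ hτ
        exact if_pos hτ
      have h3 := Function.Periodic.differentiableAt_cuspFunction two_ne_zero hgp h2
      rw [Function.Periodic.qParam_right_inv two_ne_zero hz0] at h3
      refine h3.congr_of_eventuallyEq ?_
      filter_upwards [isOpen_ne.mem_nhds hz0] with y hy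
      exact hne y hy
  have hball := hd.hasFPowerSeriesOnBall (by exact_mod_cast hR0)
  have hsum := hball.hasSum (y := q) (by
    rw [Metric.eball_coe, mem_ball_zero_iff]
    exact hqR)
  rw [hball.hasFPowerSeriesAt.eq_formalMultilinearSeries hps, zero_add, hval τ hτ] at hsum
  simp only [FormalMultilinearSeries.ofScalars_apply_eq, smul_eq_mul] at hsum
  simpa only [hexp] using hsum

section Expandable

variable {n : ℕ}

/-- `F` is on `U` the sum of an absolutely convergent series of monomials in `e^{π i ζ_k}` and
`q^{1/2} = e^{π i τ}`, invariant under common translations of all times, in which every power of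
`q^{1/2}` is nonnegative and has only finitely many coefficients. -/
def Expandable (U : Set ((Fin n → ℂ) × ℂ)) (F : (Fin n → ℂ) × ℂ → ℂ) : Prop :=
  ∃ (ι : Type) (c : ι → ℂ) (a : ι → Fin n → ℤ) (b : ι → ℕ),
    (∀ j, {i | c i ≠ 0 ∧ b i = j}.Finite) ∧ (∀ i, c i ≠ 0 → ∑ k, a i k = 0) ∧
    ∀ p ∈ U, Summable (fun i => ‖c i * Complex.exp (phase (a i) (b i) p)‖) ∧
      HasSum (fun i => c i * Complex.exp (phase (a i) (b i) p)) (F p)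

variable {U : Set ((Fin n → ℂ) × ℂ)} {F G : (Fin n → ℂ) × ℂ → ℂ}

lemma Expandable.mono {V : Set ((Fin n → ℂ) × ℂ)} (hF : Expandable U F) (hVU : V ⊆ U) :
    Expandable V F := by
  obtain ⟨ι, c, a, b, hfin, hz, hs⟩ := hF
  exact ⟨ι, c, a, b, hfin, hz, fun p hp => hs p (hVU hp)⟩

lemma Expandable.const (C : ℂ) : Expandable U fun _ => C := by
  refine ⟨Unit, fun _ => C, 0, 0, fun j => Set.toFinite _, fun _ _ => by simp, fun p _ =>
    ⟨(hasSum_fintype _).summable, ?_⟩⟩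
  have h0 : phase (0 : Fin n → ℤ) ((0 : ℕ) : ℤ) p = 0 := by simp [phase_apply]
  simp only [Pi.zero_apply, h0, Complex.exp_zero, mul_one]
  exact hasSum_unique fun _ : Unit => C

lemma phase_add (a a' : Fin n → ℤ) (b b' : ℤ) (p : (Fin n → ℂ) × ℂ) :
    phase (a + a') (b + b') p = phase a b p + phase a' b' p := by
  simp only [phase_apply, Pi.add_apply]
  push_cast
  simp only [add_mul, Finset.sum_add_distrib]
  ring

lemma hasSum_mul_of_summable_norm {ι ι' : Type*} (f : ι → ℂ) (g : ι' → ℂ) {s t : ℂ}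
    (hf : Summable (fun i => ‖f i‖) ∧ HasSum f s) (hg : Summable (fun i => ‖g i‖) ∧ HasSum g t) :
    (Summable fun x : ι × ι' => ‖f x.1 * g x.2‖) ∧
      HasSum (fun x : ι × ι' => f x.1 * g x.2) (s * t) :=
  ⟨hf.1.mul_norm hg.1, hf.2.mul hg.2 (summable_mul_of_summable_norm hf.1 hg.1)⟩

lemma Expandable.mul (hF : Expandable U F) (hG : Expandable U G) :
    Expandable U fun p => F p * G p := by
  obtain ⟨ι, c, a, b, hfin, hz, hs⟩ := hF
  obtain ⟨ι', c', a', b', hfin', hz', hs'⟩ := hG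
  refine ⟨ι × ι', fun x => c x.1 * c' x.2, fun x => a x.1 + a' x.2, fun x => b x.1 + b' x.2,
    fun j => ?_, fun x hx => ?_, fun p hp => ?_⟩
  · refine ((Finset.HasAntidiagonal.antidiagonal j).finite_toSet.biUnion fun y _ =>
      (hfin y.1).prod (hfin' y.2)).subset ?_
    rintro ⟨i, i'⟩ ⟨hc, hj⟩
    exact mem_iUnion₂.2 ⟨(b i, b' i'), Finset.HasAntidiagonal.mem_antidiagonal.2 hj,
      ⟨left_ne_zero_of_mul hc, rfl⟩, ⟨right_ne_zero_of_mul hc, rfl⟩⟩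
  · simp only [Pi.add_apply, Finset.sum_add_distrib, hz _ (left_ne_zero_of_mul hx),
      hz' _ (right_ne_zero_of_mul hx), add_zero]
  · have key : ∀ x : ι × ι', c x.1 * c' x.2 * Complex.exp (phase (a x.1 + a' x.2)
        ((b x.1 + b' x.2 : ℕ) : ℤ) p) = c x.1 * Complex.exp (phase (a x.1) (b x.1) p) *
          (c' x.2 * Complex.exp (phase (a' x.2) (b' x.2) p)) := by
      intro x
      rw [Nat.cast_add, phase_add, Complex.exp_add]
      ring
    simp only [key]
    exact hasSum_mul_of_summable_norm (fun i => c i * Complex.exp (phase (a i) (b i) p))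
      (fun i => c' i * Complex.exp (phase (a' i) (b' i) p)) (hs p hp) (hs' p hp)

lemma Expandable.pow (hF : Expandable U F) (N : ℕ) : Expandable U fun p => F p ^ N := by
  induction N with
  | zero => simpa using Expandable.const 1
  | succ N ih => simpa only [pow_succ] using ih.mul hF

lemma Expandable.prod {κ : Type*} (s : Finset κ) {F : κ → (Fin n → ℂ) × ℂ → ℂ}
    (hF : ∀ i ∈ s, Expandable U (F i)) : Expandable U fun p => ∏ i ∈ s, F i p := by
  classical
  induction s using Finset.induction_on with
  | empty => simpa using Expandable.const 1
  | insert i s hi ih =>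
    simp only [Finset.prod_insert hi]
    exact (hF i (Finset.mem_insert_self _ _)).mul
      (ih fun j hj => hF j (Finset.mem_insert_of_mem hj))

lemma Expandable.analyticOnNhd (hU : IsOpen U) (hF : Expandable U F) : AnalyticOnNhd ℂ F U := by
  obtain ⟨ι, c, a, b, -, -, hs⟩ := hF
  exact (analyticOnNhd_tsum_phase c a (fun i => b i) hU fun p hp => (hs p hp).1).congr hU
    fun p hp => (hs p hp).2.tsum_eq

lemma Expandable.translate (hF : Expandable U F) {p : (Fin n → ℂ) × ℂ} (hp : p ∈ U) {t : ℂ}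
    (hp' : (p.1 + fun _ => t, p.2) ∈ U) : F (p.1 + fun _ => t, p.2) = F p := by
  obtain ⟨ι, c, a, b, -, hz, hs⟩ := hF
  refine (hs _ hp').2.unique ((hs p hp).2.congr_fun fun i => ?_)
  by_cases hc : c i = 0
  · simp [hc]
  · have h : ∑ k, ((a i k : ℤ) : ℂ) = 0 := by exact_mod_cast hz i hc
    simp only [phase_apply, Pi.add_apply, mul_add, Finset.sum_add_distrib, ← Finset.sum_mul, h]
    simp

/-- The theta factor of the interval between two points is expandable. -/
lemma expandable_kap (k l : Fin n) (α : ℂ) :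
    Expandable (timeDomain n) fun p => kap (p.1 k - p.1 l + α) p.2 := by
  have key : ∀ (x : ℕ × ℤ) (p : (Fin n → ℂ) × ℂ),
      kapCoef x * Complex.exp (2 * Real.pi * Complex.I * x.2 * α) *
        Complex.exp (phase (Pi.single k (2 * x.2) - Pi.single l (2 * x.2))
          ((x.1 ^ 2 + x.1 : ℕ) : ℤ) p) =
      kapCoef x * Complex.exp (Real.pi * Complex.I *
        ((x.1 ^ 2 + x.1) * p.2 + 2 * x.2 * (p.1 k - p.1 l + α))) := by
    intro x p
    rw [mul_assoc, ← Complex.exp_add, phase_apply]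
    congr 2
    have : ∑ i, (((Pi.single k (2 * x.2) - Pi.single l (2 * x.2) : Fin n → ℤ) i : ℤ) : ℂ) * p.1 i =
        2 * x.2 * (p.1 k - p.1 l) := by
      simp only [Pi.sub_apply, Pi.single_apply, Int.cast_sub, sub_mul, Finset.sum_sub_distrib,
        Int.cast_ite, Int.cast_mul, Int.cast_ofNat, Int.cast_zero, ite_mul, zero_mul,
        Finset.sum_ite_eq', Finset.mem_univ, if_true]
      ring
    rw [this]
    push_cast
    ring
  refine ⟨ℕ × ℤ, fun x => kapCoef x * Complex.exp (2 * Real.pi * Complex.I * x.2 * α),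
    fun x => Pi.single k (2 * x.2) - Pi.single l (2 * x.2), fun x => x.1 ^ 2 + x.1, fun j => ?_,
    fun x _ => ?_, fun p hp => ?_⟩
  · refine ((Set.finite_Iic j).prod (Set.finite_Icc (-(j : ℤ)) j)).subset ?_
    rintro ⟨r, m⟩ ⟨hc, hj⟩
    have h1 : |m| ≤ r := by
      by_contra h
      exact left_ne_zero_of_mul hc (if_neg h)
    have h2 : r ≤ j := by
      have : (r, m).1 ^ 2 + (r, m).1 = j := hj
      simp only at this
      nlinarith
    have h3 := abs_le.1 h1
    refine ⟨h2, ?_, ?_⟩ <;> simp only <;> omega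
  · simp [Finset.sum_sub_distrib]
  · simp only [key]
    exact ⟨summable_kap _ hp, (summable_kap _ hp).of_norm.hasSum⟩

variable {D : ℕ}

/-- The quotient of `Ω_n` by the product of the compact picture intervals. -/
def kapProd (u : Fin n → USphere D) (p : (Fin n → ℂ) × ℂ) : ℂ :=
  ∏ x : Fin n × Fin n with x.1 < x.2,
    -1 * (kap (p.1 x.1 - p.1 x.2 + angle (u x.1) (u x.2)) p.2 *
      kap (p.1 x.1 - p.1 x.2 + -angle (u x.1) (u x.2)) p.2)

lemma bigOmega_pow (u : Fin n → USphere D) {p : (Fin n → ℂ) × ℂ} (hp : p ∈ timeDomain n) (N : ℕ) :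
    bigOmega u p ^ N = evalAt p.1 (links u N) * kapProd u p ^ N := by
  rw [evalAt_links, ← mul_pow, kapProd, bigOmega, ← Finset.prod_mul_distrib]
  congr 1
  refine Finset.prod_congr rfl fun x _ => ?_
  rw [bigTheta_eq _ _ _ hp, ← sub_eq_add_neg]
  ring

lemma expandable_kapProd (u : Fin n → USphere D) : Expandable (timeDomain n) (kapProd u) :=
  Expandable.prod _ fun _ _ => (Expandable.const (-1)).mul
    ((expandable_kap _ _ _).mul (expandable_kap _ _ _))

lemma analyticOnNhd_bigOmega_pow (u : Fin n → USphere D) (N : ℕ) :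
    AnalyticOnNhd ℂ (fun p => bigOmega u p ^ N) (timeDomain n) :=
  ((evalAt_analytic _ _).mul (((expandable_kapProd u).pow N).analyticOnNhd isOpen_timeDomain)).congr
    isOpen_timeDomain fun _ hp => (bigOmega_pow u hp N).symm

/-- The function `Ω_n` does not vanish identically. -/
lemma subset_closure_bigOmega_ne_zero (u : Fin n → USphere D) :
    timeDomain n ⊆ closure {p ∈ timeDomain n | bigOmega u p ≠ 0} := by
  have h1 := subset_closure_evalAt_links_ne_zero u 1
  have h2 := ((expandable_kapProd u).analyticOnNhd isOpen_timeDomain).subset_closure_ne_zero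
    isOpen_timeDomain convex_timeDomain.isPreconnected (x₀ := (0, Complex.I))
    (by simp [timeDomain]) (by
      refine Finset.prod_ne_zero_iff.2 fun x _ => mul_ne_zero (by norm_num) (mul_ne_zero ?_ ?_)
      · simpa using kap_ne_zero (angle (u x.1) (u x.2))
      · simpa using kap_ne_zero (-angle (u x.1) (u x.2)))
  have ho : IsOpen {p ∈ timeDomain n | kapProd u p ≠ 0} :=
    ((expandable_kapProd u).analyticOnNhd isOpen_timeDomain).continuousOn.isOpen_inter_preimage
      isOpen_timeDomain isOpen_ne
  refine (subset_closure_inter_of_dense ho h1 h2 (sep_subset _ _)).trans (closure_mono ?_)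
  rintro p ⟨⟨hp, h3⟩, -, h4⟩
  refine ⟨hp, fun h0 => ?_⟩
  have := bigOmega_pow u hp 1
  rw [h0, pow_one, pow_one] at this
  exact mul_ne_zero h3 h4 this.symm

end Expandable

/-! ### Time differences -/

section Section

variable {n : ℕ} {R : Type*} [CommRing R]

/-- The times with first time `0` and given time differences. -/
def sec (w : Fin (n - 1) → R) : Fin n → R := fun j => -∑ k : Fin (n - 1), if (k : ℕ) < j then w k else 0

lemma sec_add (w w' : Fin (n - 1) → R) : sec (fun k => w k + w' k) = fun j => sec w j + sec w' j := by
  funext j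
  rw [sec, sec, sec, ← neg_add, ← Finset.sum_add_distrib]
  congr 1
  exact Finset.sum_congr rfl fun k _ => by split_ifs <;> simp

lemma sec_intCast (l : Fin (n - 1) → ℤ) (j : Fin n) :
    ((sec l j : ℤ) : R) = sec (fun k => (l k : R)) j := by
  simp only [sec]
  push_cast
  rfl

lemma sec_mul (w : Fin (n - 1) → R) (t : R) (j : Fin n) : sec w j * t = sec (fun k => w k * t) j := by
  simp only [sec, neg_mul, Finset.sum_mul, ite_mul, zero_mul]

lemma sec_sub_sec (w : Fin (n - 1) → R) {a b : Fin n} (hab : a < b) :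
    sec w a - sec w b = ∑ k : Fin (n - 1), if (a : ℕ) ≤ k ∧ (k : ℕ) < b then w k else 0 := by
  rw [sec, sec, neg_sub_neg, ← Finset.sum_sub_distrib]
  refine Finset.sum_congr rfl fun k _ => ?_
  have : (a : ℕ) < b := hab
  split_ifs <;> first | (exfalso; omega) | simp

lemma timeDiff_sec (w : Fin (n - 1) → ℂ) : timeDiff (sec w) = w := by
  funext k
  rw [timeDiff, sec_sub_sec _ (Fin.mk_lt_mk.2 (Nat.lt_succ_self _))]
  rw [Finset.sum_eq_single k]
  · simp
  · intro i _ hi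
    rw [if_neg]
    simp only
    exact fun h => hi (Fin.ext (by omega))
  · simp

/-- The times are determined by their differences, up to a common translation. -/
lemma exists_sec_timeDiff (ζ : Fin n → ℂ) : ∃ t : ℂ, sec (timeDiff ζ) = ζ + fun _ => t := by
  rcases n with _ | n
  · exact ⟨0, Subsingleton.elim _ _⟩
  refine ⟨sec (timeDiff ζ) 0 - ζ 0, funext fun j => ?_⟩
  induction j using Fin.induction with
  | zero => simp
  | succ i ih =>
    have h := congrFun (timeDiff_sec (timeDiff ζ)) i
    have h1 : sec (timeDiff ζ) i.castSucc - sec (timeDiff ζ) i.succ = ζ i.castSucc - ζ i.succ := h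
    simp only [Pi.add_apply] at ih ⊢
    linear_combination ih - h1

lemma sum_mul_sec (a : Fin n → R) (w : Fin (n - 1) → R) :
    ∑ j, a j * sec w j = ∑ k : Fin (n - 1), (-∑ j ∈ Finset.univ.filter (fun j : Fin n => (k : ℕ) < (j : ℕ)), a j) * w k := by
  simp only [sec, mul_neg, Finset.mul_sum, neg_mul, Finset.sum_neg_distrib, Finset.sum_mul]
  rw [Finset.sum_comm]
  congr 1
  refine Finset.sum_congr rfl fun k _ => ?_
  rw [Finset.sum_filter]
  exact Finset.sum_congr rfl fun j _ => by split_ifs <;> simp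

lemma sum_sec_mul_parity (p : Fin n → Fin 2) (l : Fin (n - 1) → ℤ) :
    ∑ j, sec l j * ((p j : ℕ) : ℤ) = -∑ k, l k * epsilon p k := by
  have h := sum_mul_sec (fun j => ((p j : ℕ) : ℤ)) l
  simp only [mul_comm (sec l _)]
  rw [h, ← Finset.sum_neg_distrib]
  exact Finset.sum_congr rfl fun k _ => by rw [epsilon]; ring

/-- The matrix `A^{(n)}` is the matrix of the sum over all pairs of points. -/
lemma sum_pairs_sec (l w : Fin (n - 1) → R) :
    ∑ x : Fin n × Fin n with x.1 < x.2, (sec l x.1 - sec l x.2) * (sec w x.1 - sec w x.2) =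
      ∑ j, ∑ k, l j * (thetaMatrix n j k : R) * w k := by
  have h1 : ∀ x ∈ Finset.univ.filter (fun x : Fin n × Fin n => x.1 < x.2),
      (sec l x.1 - sec l x.2) * (sec w x.1 - sec w x.2) = ∑ j : Fin (n - 1), ∑ k : Fin (n - 1),
        if ((x.1 : ℕ) ≤ j ∧ (x.1 : ℕ) ≤ k) ∧ ((j : ℕ) < x.2 ∧ (k : ℕ) < x.2) then l j * w k
          else 0 := by
    intro x hx
    rw [sec_sub_sec _ (Finset.mem_filter.1 hx).2, sec_sub_sec _ (Finset.mem_filter.1 hx).2,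
      Finset.sum_mul_sum]
    refine Finset.sum_congr rfl fun j _ => Finset.sum_congr rfl fun k _ => ?_
    split_ifs <;> first | (exfalso; omega) | simp
  rw [Finset.sum_congr rfl h1, Finset.sum_comm]
  refine Finset.sum_congr rfl fun j _ => ?_
  rw [Finset.sum_comm]
  refine Finset.sum_congr rfl fun k _ => ?_
  have hj := j.2
  have hk := k.2
  have h2 : ((Finset.univ.filter fun x : Fin n × Fin n => x.1 < x.2).filter fun x =>
      ((x.1 : ℕ) ≤ j ∧ (x.1 : ℕ) ≤ k) ∧ ((j : ℕ) < x.2 ∧ (k : ℕ) < x.2)) =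
      Finset.Iic (⟨min (j : ℕ) k, by omega⟩ : Fin n) ×ˢ
        Finset.Ioi (⟨max (j : ℕ) k, by omega⟩ : Fin n) := by
    ext x
    simp only [Finset.mem_filter, Finset.mem_univ, true_and, Finset.mem_product, Finset.mem_Iic,
      Finset.mem_Ioi, Fin.le_def, Fin.lt_def]
    omega
  rw [← Finset.sum_filter, h2, Finset.sum_const, Finset.card_product, Fin.card_Iic, Fin.card_Ioi,
    nsmul_eq_mul, thetaMatrix]
  have h3 : (((min (j : ℕ) k + 1) * (n - 1 - max (j : ℕ) k) : ℕ) : ℤ) =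
      (min (j : ℤ) k + 1) * ((n : ℤ) - 1 - max (j : ℤ) k) := by
    rw [Nat.cast_mul, Nat.cast_sub (by omega), Nat.cast_sub (by omega)]
    push_cast
    ring
  rw [← h3, Int.cast_natCast]
  ring

end Section

section Numerator

variable {n : ℕ} {G : (Fin n → ℂ) × ℂ → ℂ}

lemma sec_mem_tube (w : Fin (n - 1) → ℂ) {τ : ℂ} (h : 2 * ∑ j, |(sec w j).im| < τ.im) :
    (sec w, τ) ∈ tube n := by
  have h0 : ∀ j, |(sec w j).im| ≤ ∑ j, |(sec w j).im| := fun j =>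
    Finset.single_le_sum (f := fun j => |(sec w j).im|) (fun _ _ => abs_nonneg _)
      (Finset.mem_univ j)
  have h1 : 0 ≤ ∑ j, |(sec w j).im| := Finset.sum_nonneg fun _ _ => abs_nonneg _
  refine ⟨by simp only; linarith, fun j k => ?_⟩
  have := le_abs_self (sec w j).im
  have := neg_le_abs (sec w k).im
  have := h0 j
  have := h0 k
  simp only
  linarith

/-- At first time `0`, an expandable function has a Taylor series in `q^{1/2}` whose coefficients are
Laurent polynomials. For given times the points `(sec w, τ)` lie in the tube only if `Im τ` is large;
holomorphy extends the expansion to all `τ`. -/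
lemma Expandable.exists_expansion (hG : Expandable (tube n) G)
    (hGa : AnalyticOnNhd ℂ G (timeDomain n)) :
    ∃ P : ℕ → (Fin (n - 1) → ℤ) →₀ ℂ, ∀ (w : Fin (n - 1) → ℂ) (τ : ℂ), 0 < τ.im →
    HasSum (fun j : ℕ => ((P j).sum fun k c => c * Complex.exp (Real.pi * Complex.I * ∑ i, k i * w i))
      * Complex.exp (Real.pi * Complex.I * τ * j)) (G (sec w, τ)) := by
  obtain ⟨ι, c, a, b, hfin, -, hs⟩ := hG
  set m : ι → Fin (n - 1) → ℤ := fun i k => -∑ j ∈ Finset.univ.filter (fun j : Fin n => (k : ℕ) < (j : ℕ)), a i j with hm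
  refine ⟨fun j => ∑ i ∈ (hfin j).toFinset, Finsupp.single (m i) (c i), fun w τ hτ => ?_⟩
  refine hasSum_exp_of_large_im (H := fun τ => G (sec w, τ)) (T := 2 * ∑ j, |(sec w j).im|) ?_
    (by positivity) (fun τ hτ => ?_) hτ
  · intro τ hτ
    refine DifferentiableAt.differentiableWithinAt ?_
    exact (hGa (sec w, τ) hτ).differentiableAt.comp τ
      (DifferentiableAt.prodMk (differentiableAt_const _) differentiableAt_id)
  · refine ((hs _ (sec_mem_tube w hτ)).2.tsum_fiberwise b).congr_fun fun j => ?_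
    rw [tsum_subtype (b ⁻¹' {j}) fun i => c i * Complex.exp (phase (a i) (b i) (sec w, τ)),
      tsum_eq_sum (s := (hfin j).toFinset), ← Finsupp.sum_finsetSum_index, Finset.sum_mul]
    · refine Finset.sum_congr rfl fun i hi => ?_
      have hb : b i = j := ((hfin j).mem_toFinset.1 hi).2
      rw [indicator_of_mem (by exact hb), Finsupp.sum_single_index (by simp), mul_assoc,
        ← Complex.exp_add, phase_apply]
      congr 2
      have h1 := sum_mul_sec (fun j => (a i j : ℂ)) w
      simp only [h1, hm, hb]
      push_cast
      ring
    · simp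
    · intro k x y
      ring
    · intro i hi
      by_cases hb : b i = j
      · have hc : c i = 0 := by
          by_contra hc
          exact hi ((hfin j).mem_toFinset.2 ⟨hc, hb⟩)
        simp [indicator, hc]
      · exact indicator_of_notMem (by exact hb) _

variable {D : ℕ}

lemma bigOmega_shiftTimes_one (u : Fin n → USphere D) (l : Fin n → ℤ) (p : (Fin n → ℂ) × ℂ) :
    bigOmega u (shiftTimes 1 0 l p) = bigOmega u p := by
  refine Finset.prod_congr rfl fun x _ => ?_
  rw [shiftTimes_apply]
  refine Eq.trans ?_ (bigTheta_add_int _ _ _ _ (l x.1 - l x.2))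
  congr 1
  push_cast
  ring

lemma bigOmega_shiftTimes_tau (u : Fin n → USphere D) (l : Fin n → ℤ) (p : (Fin n → ℂ) × ℂ) :
    bigOmega u (shiftTimes 0 1 l p) = Complex.exp
      (-(2 * Real.pi * Complex.I *
        (∑ x : Fin n × Fin n with x.1 < x.2, ((l x.1 : ℂ) - l x.2) * (l x.1 - l x.2)) * p.2) -
      4 * Real.pi * Complex.I *
        ∑ x : Fin n × Fin n with x.1 < x.2, ((l x.1 : ℂ) - l x.2) * (p.1 x.1 - p.1 x.2)) *
      bigOmega u p := by
  rw [bigOmega, bigOmega, Finset.mul_sum, Finset.mul_sum, Finset.sum_mul, ← Finset.sum_neg_distrib,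
    ← Finset.sum_sub_distrib, Complex.exp_sum, ← Finset.prod_mul_distrib]
  refine Finset.prod_congr rfl fun x _ => ?_
  have h : (shiftTimes 0 1 l p).1 x.1 - (shiftTimes 0 1 l p).1 x.2 =
      p.1 x.1 - p.1 x.2 + ((l x.1 - l x.2 : ℤ) : ℂ) * p.2 := by
    simp only [shiftTimes_apply]
    push_cast
    ring
  rw [h]
  have h2 : (shiftTimes 0 1 l p).2 = p.2 := rfl
  rw [h2, bigTheta_add_int_mul_tau]
  congr 2
  push_cast
  ring

lemma neg_one_zpow_neg (k : ℤ) : (-1 : ℂ) ^ (-k) = (-1) ^ k := by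
  rw [zpow_neg, ← inv_zpow]
  norm_num

/-- A holomorphic function of the times with the quasi-periodicity of `Ω_n^N`, up to statistical
signs, and with an expansion in powers of `q^{1/2}`, defines a numerator of an elliptic function. -/
lemma isThetaNumerator_sec {N : ℕ} {p : Fin n → Fin 2}
    (hG : Expandable (tube n) G)
    (hGa : AnalyticOnNhd ℂ G (timeDomain n))
    (h1 : ∀ l, ∀ x ∈ timeDomain n, G (shiftTimes 1 0 l x) =
      (-1 : ℂ) ^ (∑ k, l k * ((p k : ℕ) : ℤ)) * G x)
    (h2 : ∀ l, ∀ x ∈ timeDomain n, G (shiftTimes 0 1 l x) =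
      (-1 : ℂ) ^ (∑ k, l k * ((p k : ℕ) : ℤ)) * (Complex.exp
      (-(2 * Real.pi * Complex.I *
        (∑ x : Fin n × Fin n with x.1 < x.2, ((l x.1 : ℂ) - l x.2) * (l x.1 - l x.2)) * x.2) -
      4 * Real.pi * Complex.I *
        ∑ y : Fin n × Fin n with y.1 < y.2, ((l y.1 : ℂ) - l y.2) * (x.1 y.1 - x.1 y.2)) ^ N *
          G x)) :
    IsThetaNumerator n N p (fun x => G (sec x.1, x.2)) where
  holo := by
    intro x hx
    have hlin : AnalyticAt ℂ (fun x : (Fin (n - 1) → ℂ) × ℂ => (sec x.1, x.2)) x := by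
      refine AnalyticAt.prod ?_ analyticAt_snd
      refine AnalyticAt.pi fun j => ?_
      refine AnalyticAt.neg (Finset.analyticAt_fun_sum _ fun k _ => ?_)
      split_ifs
      · exact ((ContinuousLinearMap.proj k : (Fin (n - 1) → ℂ) →L[ℂ] ℂ).comp
          (ContinuousLinearMap.fst ℂ _ ℂ)).analyticAt x
      · exact analyticAt_const
    exact AnalyticAt.comp (g := G) (f := fun x : (Fin (n - 1) → ℂ) × ℂ => (sec x.1, x.2))
      (hGa (sec x.1, x.2) hx) hlin
  expansion := hG.exists_expansion hGa
  period_one := by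
    intro l w τ hτ
    have h := h1 (sec l) (sec w, τ) hτ
    rw [sum_sec_mul_parity, neg_one_zpow_neg] at h
    rw [← h]
    congr 1
    rw [shiftTimes_apply]
    simp only [sec_add, zero_mul, add_zero, mul_one, sec_intCast]
  period_tau := by
    intro l w τ hτ
    have h := h2 (sec l) (sec w, τ) hτ
    simp only [sec_intCast, sum_pairs_sec] at h
    rw [sum_sec_mul_parity, neg_one_zpow_neg] at h
    have e : (shiftTimes 0 1 (sec l) (sec w, τ)) = (sec (fun k => w k + l k * τ), τ) := by
      rw [shiftTimes_apply]
      simp only [sec_add, zero_add, one_mul, sec_intCast, sec_mul]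
    rw [e] at h
    refine h.trans ?_
    rw [← Complex.exp_nat_mul, ← mul_assoc]
    congr 3
    ring

end Numerator

/-! ### The numerators of the correlation functions -/

section Correlators

variable {D : ℕ} [NeZero D] {𝓗 : Type*} [NormedAddCommGroup 𝓗] [InnerProductSpace ℂ 𝓗]
  {I : Type*} [Fintype I] [DecidableEq I] (Q : Theory D 𝓗 I) (hQ : Q.FiniteDegeneracy) {n : ℕ}
  {f : (Fin n → I) → (Fin n → USphere D) → (Fin n → ℂ) × ℂ → ℂ}

lemma Theory.expandable_redSum (hf : ∀ A u, Q.ConvergesToMeromorphic hQ A u (f A u)) {N : ℕ}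
    (hN : Q.IsLocalityExponent N) (A : Fin n → I) (u : Fin n → USphere D) :
    Expandable (tube n) (Q.redSum hQ N A u) := by
  refine ⟨(Fin n → ℤ) × ℕ, fun x => Q.redCoef hQ N A u (x.1, x.2),
    fun x i => Q.twiceDim (A i) + 2 * x.1 i, fun x => x.2, fun j => ?_, fun x hx => ?_,
    fun p hp => ?_⟩
  · refine ((Q.finite_support_act_coef hQ hN A u j).prod (Set.finite_singleton j)).subset ?_
    rintro ⟨k, i⟩ ⟨hc, hi⟩
    have hi : i = j := hi
    subst hi
    exact ⟨hc, rfl⟩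
  · by_contra h
    exact hx (Q.coef_mem_energy hQ A u N (x.1, x.2) h)
  · have hs := Q.summable_redCoef hQ hf hN A u hp
    simp only [expTerm_eq_exp_phase] at hs
    have hinj : Function.Injective fun x : (Fin n → ℤ) × ℕ => ((x.1, (x.2 : ℤ)) : (Fin n → ℤ) × ℤ) :=
      fun x y h => by
        simp only [Prod.mk.injEq, Int.natCast_inj] at h
        exact Prod.ext h.1 h.2
    refine ⟨hs.comp_injective hinj, ?_⟩
    have h1 := hs.of_norm.hasSum
    rw [← hinj.hasSum_iff] at h1
    · simp only [Theory.redSum, expTerm_eq_exp_phase]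
      exact h1
    · rintro ⟨k, j⟩ hkj
      have hj : j < 0 := by
        by_contra h
        exact hkj ⟨(k, j.toNat), Prod.ext rfl (Int.toNat_of_nonneg (not_lt.1 h))⟩
      have : Q.redCoef hQ N A u (k, j) = 0 := Q.act_coef_eq_zero_of_neg hQ A u N (k, j) hj
      rw [this, zero_mul]

/-- Every point can be translated into the tube by integral multiples of `τ`. -/
lemma exists_shiftTimes_mem_tube {p : (Fin n → ℂ) × ℂ} (hp : p ∈ timeDomain n) :
    ∃ l : Fin n → ℤ, shiftTimes 0 1 l p ∈ tube n := by
  have hp0 : 0 < p.2.im := hp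
  refine ⟨fun k => -⌊(p.1 k).im / p.2.im⌋, hp, fun j k => ?_⟩
  have h : ∀ k, (p.1 k + ((-⌊(p.1 k).im / p.2.im⌋ : ℤ) : ℂ) * (0 + 1 * p.2)).im =
      Int.fract ((p.1 k).im / p.2.im) * p.2.im := by
    intro k
    rw [zero_add, one_mul, Complex.add_im, ← Complex.ofReal_intCast, Complex.im_ofReal_mul,
      Int.fract]
    push_cast
    field_simp
    ring
  simp only [shiftTimes_apply, h]
  have h1 := mul_lt_mul_of_pos_right (Int.fract_lt_one ((p.1 j).im / p.2.im)) hp0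
  have h2 := mul_nonneg (Int.fract_nonneg ((p.1 k).im / p.2.im)) hp0.le
  linarith

/-- The product of a correlation function with a power of `Ω_n` is holomorphic. In the tube this is a
consequence of the convergence of the series of the product, and the translates of the tube by
periods cover the whole domain. -/
lemma Theory.exists_numerator (hf : ∀ A u, Q.ConvergesToMeromorphic hQ A u (f A u)) {N : ℕ}
    (hN : Q.IsLocalityExponent N) (A : Fin n → I) (u : Fin n → USphere D) :
    ∃ G, AnalyticOnNhd ℂ G (timeDomain n) ∧
      MeroEq (timeDomain n) (fun p => bigOmega u p ^ N * f A u p) G ∧ Expandable (tube n) G := by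
  set B : (Fin n → ℂ) × ℂ → ℂ := fun p => kapProd u p ^ N * Q.redSum hQ N A u p with hB
  have hBe : Expandable (tube n) B := (((expandable_kapProd u).pow N).mono
    tube_subset_timeDomain).mul (Q.expandable_redSum hQ hf hN A u)
  have hBa : AnalyticOnNhd ℂ B (tube n) := hBe.analyticOnNhd isOpen_tube
  have hBf : MeroEq (tube n) (fun p => bigOmega u p ^ N * f A u p) B := by
    refine (Q.meroEq_redSum hQ hf hN A u 1).map fun p hp h => ?_
    have h3 : permSign (Q.parity ∘ A) 1 = 0 := by
      rw [permSign, Finset.filter_false_of_mem, Finset.sum_empty]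
      rintro x - ⟨h1, h2⟩
      exact absurd h1 h2.not_gt
    rw [h3, pow_zero, one_mul] at h
    have h4 : evalAt p.1 (links u N) * f A u p = Q.redSum hQ N A u p := h
    rw [bigOmega_pow u (tube_subset_timeDomain hp), mul_right_comm, h4, mul_comm]
  have hloc : ∀ x ∈ timeDomain n, ∃ V : Set ((Fin n → ℂ) × ℂ), ∃ g : (Fin n → ℂ) × ℂ → ℂ,
      IsOpen V ∧ x ∈ V ∧ AnalyticOnNhd ℂ g V ∧
        MeroEq V (fun p => bigOmega u p ^ N * f A u p) g := by
    intro x hx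
    obtain ⟨l, hl⟩ := exists_shiftTimes_mem_tube hx
    set e := shiftTimes 0 1 l
    set E : (Fin n → ℂ) × ℂ → ℂ := fun p =>
      -(2 * Real.pi * Complex.I *
        (∑ x : Fin n × Fin n with x.1 < x.2, ((l x.1 : ℂ) - l x.2) * (l x.1 - l x.2)) * p.2) -
      4 * Real.pi * Complex.I *
        ∑ x : Fin n × Fin n with x.1 < x.2, ((l x.1 : ℂ) - l x.2) * (p.1 x.1 - p.1 x.2) with hE
    have hEa : AnalyticOnNhd ℂ E univ := by
      intro p _
      have hc : ∀ k, AnalyticAt ℂ (fun p : (Fin n → ℂ) × ℂ => p.1 k) p := fun k =>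
        ((ContinuousLinearMap.proj k : (Fin n → ℂ) →L[ℂ] ℂ).comp
          (ContinuousLinearMap.fst ℂ _ ℂ)).analyticAt p
      exact ((analyticAt_const.mul analyticAt_snd).neg).sub (analyticAt_const.mul
        (Finset.analyticAt_fun_sum _ fun x _ => analyticAt_const.mul ((hc x.1).sub (hc x.2))))
    refine ⟨e ⁻¹' tube n, fun p => (-1 : ℂ) ^ (∑ k, l k * ((Q.parity (A k) : ℕ) : ℤ)) *
      (Complex.exp (-E p) ^ N * B (e p)), isOpen_tube.preimage e.continuous, hl, ?_, ?_⟩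
    · refine analyticOnNhd_const.mul (AnalyticOnNhd.mul ?_ ?_)
      · exact ((hEa.neg.cexp).pow N).mono (subset_univ _)
      · exact fun p hp => (hBa _ hp).comp (analyticOnNhd_shiftTimes 0 1 l p trivial)
    · have h1 := hBf.comp_homeomorph e
      have h2 := (Q.meroEq_shiftTimes_tau hQ hf A u l).mono (isOpen_tube.preimage e.continuous)
        (fun p hp => hp.1)
      refine h1.map₂ h2 fun p _ e1 e2 => ?_
      have e2 : f A u (e p) = _ := e2
      have e3 : bigOmega u (e p) = Complex.exp (E p) * bigOmega u p := bigOmega_shiftTimes_tau u l p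
      simp only [Function.comp_apply] at e1
      rw [← e1, e2, e3]
      have h3 : (-1 : ℂ) ^ (∑ k, l k * ((Q.parity (A k) : ℕ) : ℤ)) *
          (-1 : ℂ) ^ (∑ k, l k * ((Q.parity (A k) : ℕ) : ℤ)) = 1 := by
        rw [← mul_zpow]
        norm_num
      have h4 : Complex.exp (-E p) ^ N * Complex.exp (E p) ^ N = 1 := by
        rw [← mul_pow, ← Complex.exp_add, neg_add_cancel, Complex.exp_zero, one_pow]
      calc bigOmega u p ^ N * f A u p = ((-1 : ℂ) ^ (∑ k, l k * ((Q.parity (A k) : ℕ) : ℤ)) *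
          (-1 : ℂ) ^ (∑ k, l k * ((Q.parity (A k) : ℕ) : ℤ))) *
            (Complex.exp (-E p) ^ N * Complex.exp (E p) ^ N) *
              (bigOmega u p ^ N * f A u p) := by rw [h3, h4, one_mul, one_mul]
        _ = _ := by ring
  obtain ⟨G, hGa, hG⟩ := exists_analyticOnNhd_meroEq isOpen_timeDomain hloc
  have hGB : EqOn G B (tube n) :=
    ((hG.mono isOpen_tube tube_subset_timeDomain).symm.trans hBf).eqOn_of_continuousOn
      (hGa.continuousOn.mono tube_subset_timeDomain) hBa.continuousOn
  refine ⟨G, hGa, hG, ?_⟩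
  obtain ⟨ι, c, a, b, h1, h2, h3⟩ := hBe
  exact ⟨ι, c, a, b, h1, h2, fun p hp => by rw [hGB hp]; exact h3 p hp⟩

/-- A holomorphic function with an expansion in the tube is invariant under common translations of
all times. -/
lemma Expandable.translate_of_analytic {G : (Fin n → ℂ) × ℂ → ℂ} (hG : Expandable (tube n) G)
    (hGa : AnalyticOnNhd ℂ G (timeDomain n)) (t : ℂ) {p : (Fin n → ℂ) × ℂ}
    (hp : p ∈ timeDomain n) : G (p.1 + fun _ => t, p.2) = G p := by
  have h1 : AnalyticOnNhd ℂ (fun p : (Fin n → ℂ) × ℂ => G (p.1 + fun _ => t, p.2))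
      (timeDomain n) := by
    intro p hp
    have he : (fun p : (Fin n → ℂ) × ℂ => ((p.1 + fun _ => t, p.2) : (Fin n → ℂ) × ℂ)) =
        fun p => p + ((fun _ => t : Fin n → ℂ), 0) := by
      funext p
      refine Prod.ext rfl (add_zero _).symm
    have h2 : AnalyticAt ℂ (fun p : (Fin n → ℂ) × ℂ =>
        ((p.1 + fun _ => t, p.2) : (Fin n → ℂ) × ℂ)) p := by
      rw [he]
      exact analyticAt_id.add analyticAt_const
    exact AnalyticAt.comp (g := G)
      (f := fun p : (Fin n → ℂ) × ℂ => ((p.1 + fun _ => t, p.2) : (Fin n → ℂ) × ℂ))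
      (hGa (p.1 + fun _ => t, p.2) hp) h2
  have h0 : ((0 : Fin n → ℂ), Complex.I) ∈ tube n := ⟨by simp, fun j k => by simp⟩
  refine h1.eqOn_of_preconnected_of_eventuallyEq hGa convex_timeDomain.isPreconnected
    (tube_subset_timeDomain h0) ?_ hp
  filter_upwards [isOpen_tube.mem_nhds h0] with p hp
  refine hG.translate hp ⟨hp.1, fun j k => ?_⟩
  have := hp.2 j k
  simpa using this

/-- The numerator `F` is the value of `Ω_n^N f` at first time `0`. -/
lemma Theory.exists_isThetaNumerator (hf : ∀ A u, Q.ConvergesToMeromorphic hQ A u (f A u)) {N : ℕ}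
    (hN : Q.IsLocalityExponent N) (A : Fin n → I) (u : Fin n → USphere D) :
    ∃ F : (Fin (n - 1) → ℂ) × ℂ → ℂ, IsThetaNumerator n N (Q.parity ∘ A) F ∧
      MeroEq (timeDomain n) (f A u) (fun p => F (timeDiff p.1, p.2) / bigOmega u p ^ N) := by
  obtain ⟨G, hGa, hG, hGe⟩ := Q.exists_numerator hQ hf hN A u
  have hcont : ∀ (a b : ℂ) (l : Fin n → ℤ),
      AnalyticOnNhd ℂ (fun p => G (shiftTimes a b l p)) (timeDomain n) := fun a b l p hp =>
    (hGa (shiftTimes a b l p) hp).comp (analyticOnNhd_shiftTimes a b l p trivial)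
  refine ⟨fun x => G (sec x.1, x.2), isThetaNumerator_sec hGe hGa ?_ ?_, ?_⟩
  · intro l
    refine MeroEq.eqOn_of_continuousOn (U := timeDomain n) ?_ (hcont 1 0 l).continuousOn
      (continuousOn_const.mul hGa.continuousOn)
    refine ((hG.comp_shiftTimes 1 0 l).map₂ (h := fun p => G (shiftTimes 1 0 l p))
      (h' := fun p => (-1 : ℂ) ^ (∑ k, l k * ((Q.parity (A k) : ℕ) : ℤ)) *
        (bigOmega u p ^ N * f A u p)) (Q.meroEq_shiftTimes_one hQ hf A u l)
          fun p _ e1 e2 => ?_).map₂ hG fun p _ e1 e2 => ?_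
    · simp only [Function.comp_apply] at e1 e2
      rw [← e1, e2, bigOmega_shiftTimes_one]
      ring
    · rw [e1, e2]
      rfl
  · intro l
    refine MeroEq.eqOn_of_continuousOn (U := timeDomain n) ?_ (hcont 0 1 l).continuousOn ?_
    · refine ((hG.comp_shiftTimes 0 1 l).map₂ (h := fun p => G (shiftTimes 0 1 l p))
        (h' := fun p => (-1 : ℂ) ^ (∑ k, l k * ((Q.parity (A k) : ℕ) : ℤ)) *
          (bigOmega u (shiftTimes 0 1 l p) ^ N * f A u p)) (Q.meroEq_shiftTimes_tau hQ hf A u l)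
            fun p _ e1 e2 => ?_).map₂ hG fun p _ e1 e2 => ?_
      · simp only [Function.comp_apply] at e1 e2
        rw [← e1, e2]
        ring
      · rw [e1, ← e2, bigOmega_shiftTimes_tau, mul_pow, mul_assoc (_ ^ N)]
        rfl
    · refine continuousOn_const.mul (ContinuousOn.mul ?_ hGa.continuousOn)
      fun_prop
  · obtain ⟨W, hW, hWU, hd, he⟩ := hG
    have ho : IsOpen {p ∈ timeDomain n | bigOmega u p ≠ 0} := by
      have h1 := (analyticOnNhd_bigOmega_pow u 1).continuousOn.isOpen_inter_preimage
        isOpen_timeDomain (isOpen_ne (x := (0 : ℂ)))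
      simp only [pow_one] at h1
      exact h1
    refine ⟨W ∩ {p ∈ timeDomain n | bigOmega u p ≠ 0}, hW.inter ho, inter_subset_left.trans hWU,
      subset_closure_inter_of_dense ho hd (subset_closure_bigOmega_ne_zero u) (sep_subset _ _),
      fun p hp => ?_⟩
    obtain ⟨t, ht⟩ := exists_sec_timeDiff p.1
    simp only [ht]
    rw [hGe.translate_of_analytic hGa t hp.2.1, ← he hp.1,
      mul_div_cancel_left₀ _ (pow_ne_zero N hp.2.2)]

end Correlators

end GCI

end

theorem corollary3p6 {D : ℕ} [NeZero D] {𝓗 : Type*} [NormedAddCommGroup 𝓗]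
    [InnerProductSpace ℂ 𝓗] [CompleteSpace 𝓗] {I : Type*} [Fintype I] [DecidableEq I]
    (Q : GCI.Theory D 𝓗 I) (hQ : Q.FiniteDegeneracy) (n : ℕ)
    (f : (Fin n → I) → (Fin n → GCI.USphere D) → (Fin n → ℂ) × ℂ → ℂ)
    (hf : ∀ A u, Q.ConvergesToMeromorphic hQ A u (f A u)) :
    -- double (anti)periodicity in every conformal time
    (∀ A u (m : Fin n),
      GCI.MeroEq (GCI.timeDomain n) (fun p => f A u (p.1 + Pi.single m 1, p.2))
        (fun p => (-1 : ℂ) ^ (Q.parity (A m) : ℕ) * f A u p) ∧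
      GCI.MeroEq (GCI.timeDomain n) (fun p => f A u (p.1 + Pi.single m p.2, p.2))
        (fun p => (-1 : ℂ) ^ (Q.parity (A m) : ℕ) * f A u p)) ∧
    -- symmetry under permutations, with the statistical sign
    (∀ A u (σ : Equiv.Perm (Fin n)),
      GCI.MeroEq (GCI.timeDomain n) (fun p => f (A ∘ σ) (u ∘ σ) (p.1 ∘ σ, p.2))
        (fun p => (-1 : ℂ) ^ GCI.permSign (Q.parity ∘ A) σ * f A u p)) ∧
    -- the form of the basic elliptic functions
    ∃ N : ℕ, ∀ A u, ∃ F : (Fin (n - 1) → ℂ) × ℂ → ℂ,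
      GCI.IsThetaNumerator n N (Q.parity ∘ A) F ∧
      GCI.MeroEq (GCI.timeDomain n) (f A u)
        (fun p => F (GCI.timeDiff p.1, p.2) / GCI.bigOmega u p ^ N) := by
  obtain ⟨N, hN⟩ := Q.exists_isLocalityExponent
  exact ⟨fun A u m => ⟨Q.meroEq_shift_one hQ hf A u m, Q.meroEq_shift_tau hQ hf A u m⟩,
    fun A u σ => Q.meroEq_perm hQ hf A u σ, N, fun A u => Q.exists_isThetaNumerator hQ hf hN A u⟩
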